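/- Let $\mathcal K$ be an idempotent-complete tensor-triangulated category: a triangulated category in which idempotents split, with a symmetric monoidal structure $(\otimes,\mathbb 1)$ such that every functor $x\otimes-$ is exact (the isomorphisms $x\otimes\Sigma^n y\cong\Sigma^n(x\otimes y)$ being natural in $x,y$ and compatible with the associativity and unit isomorphisms). Let $A$ be a tt-ring in $\mathcal K$, i.e. a commutative monoid $(A,\mu,\eta)$ in $\mathcal K$ that is separable: there is $\sigma:A\to A\otimes A$ with $\mu\sigma=\mathrm{id}_A$ and $(1\otimes\mu)(\sigma\otimes1)=\sigma\mu=(\mu\otimes1)(1\otimes\sigma)$. Let $A\text{-}\mathrm{Mod}_{\mathcal K}$ be the category of $A$-modules in $\mathcal K$, with the tensor product $\otimes_A$ (the coequalizer of the two actions of $A$ on $x\otimes y$) and with the triangulated structure in which a triangle is distinguished iff its underlying triangle in $\mathcal K$ is; let $F_A:\mathcal K\to A\text{-}\mathrm{Mod}_{\mathcal K}$, $y\mapsto A\otimes y$. For $\mathcal C=\mathcal K$ or $A\text{-}\mathrm{Mod}_{\mathcal K}$, let $\mathrm{Spc}(\mathcal C)$ be the set of prime (proper) thick tensor ideals $\mathcal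 P$ of $\mathcal C$, with open basis $\{\mathcal P : x\in\mathcal P\}$ for $x\in\mathcal C$; put $\mathrm{supp}(x)=\{\mathcal P : x\notin\mathcal P\}$ and $\varphi_A:\mathrm{Spc}(A\text{-}\mathrm{Mod}_{\mathcal K})\to\mathrm{Spc}(\mathcal K)$, $\mathcal P\mapsto F_A^{-1}(\mathcal P)$. Suppose that $A$ has finite degree $d$: the tower of commutative rings $A^{[0]}=\mathbb 1\to A^{[1]}=A\to A^{[2]}\to\cdots$ determined by ring isomorphisms $(\mu,g_n): A^{[n+1]}\otimes_{A^{[n]}}A^{[n+1]}\cong A^{[n+1]}\times A^{[n+2]}$, with structure maps $g_n\circ(1\otimes\eta):A^{[n+1]}\to A^{[n+2]}$, satisfies $A^{[d]}\neq0$ and $A^{[d+1]}=0$. Then: (a) (Incomparability) If $\mathcal P\subseteq\mathcal P'$ in $\mathrm{Spc}(A\text{-}\mathrm{Mod}_{\mathcal K})$ satisfy $\varphi_A(\mathcal P)=\varphi_A(\mathcal P')$, then $\mathcal P=\mathcal P'$. (b) The space $\mathrm{Spc}(A\text{-}\mathrm{Mod}_{\mathcal K})$ and the subspace $\mathrm{supp}(A)\subseteq\mathrm{Spc}(\mathcal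 K)$ have the same Krull dimension (supremum of the lengths of chains of irreducible closed subsets). (c) Every fiber of $\varphi_A$ is discrete and has at most $d$ points. -/

import Mathlib

open CategoryTheory CategoryTheory.Category CategoryTheory.Limits MonoidalCategory Pretriangulated
  MonObj

universe v u

set_option linter.unusedSectionVars false

namespace TTGeometry

section Modules

variable {K : Type u} [Category.{v} K] [MonoidalCategory K] {A : K} [MonObj A]

/-- The action of `A` on a module, as a morphism `A ⊗ X ⟶ X`. -/
abbrev act (X : Mod K A) : A ⊗ X.X ⟶ X.X := ModObj.smul (M := A) (X := X.X)

lemma one_act (X : Mod K A) : η ▷ X.X ≫ act X = (λ_ X.X).hom :=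
  ModObj.one_smul (M := A) X.X

lemma mul_act (X : Mod K A) : μ ▷ X.X ≫ act X = (α_ A A X.X).hom ≫ A ◁ act X ≫ act X :=
  ModObj.mul_smul (M := A) X.X

lemma lin {X Y : Mod K A} (f : X ⟶ Y) : act X ≫ f.hom = A ◁ f.hom ≫ act Y :=
  IsModHom.smul_hom (A := A) (f := f.hom)

/-- Constructor for `A`-linear morphisms. -/
def mkLin {X Y : Mod K A} (f : X.X ⟶ Y.X) (h : act X ≫ f = A ◁ f ≫ act Y) : X ⟶ Y :=
  Mod.Hom.mk' f h

/-- An isomorphism in `K` that is `A`-linear is an isomorphism of modules. -/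
def mkIso {X Y : Mod K A} (e : X.X ≅ Y.X) (h : act X ≫ e.hom = A ◁ e.hom ≫ act Y) : X ≅ Y where
  hom := mkLin e.hom h
  inv := mkLin e.inv (by
    rw [Iso.comp_inv_eq, assoc, h, ← MonoidalCategory.whiskerLeft_comp_assoc, e.inv_hom_id,
      MonoidalCategory.whiskerLeft_id, id_comp])
  hom_inv_id := by ext; exact e.hom_inv_id
  inv_hom_id := by ext; exact e.inv_hom_id

end Modules

/-- The tensor product commutes with the shift: natural isomorphisms `x ⊗ Σⁿ y ≅ Σⁿ (x ⊗ y)`,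
coherent in `n` (this is `Functor.CommShift`), natural in both variables, and compatible with the
associativity and unit isomorphisms of the monoidal structure. -/
class TensorShift (K : Type u) [Category.{v} K] [HasShift K ℤ] [MonoidalCategory K] where
  commShift (x : K) : (tensorLeft x).CommShift ℤ
  commShift_map {x y : K} (f : x ⟶ y) :
    NatTrans.CommShift (F₁ := tensorLeft x) (F₂ := tensorLeft y) ((tensoringLeft K).map f) ℤ
  commShift_assoc (x y : K) : NatTrans.CommShift (tensorLeftTensor x y).hom ℤ
  commShift_unit :
    NatTrans.CommShift (F₁ := tensorLeft (𝟙_ K)) (F₂ := 𝟭 K) (leftUnitorNatIso K).hom ℤ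

attribute [instance] TensorShift.commShift

section Shift

variable {K : Type u} [Category.{v} K] [HasShift K ℤ] [MonoidalCategory K] [TensorShift K]

/-- The isomorphism `x ⊗ Σⁿ y ≅ Σⁿ (x ⊗ y)`. -/
noncomputable def tensorShiftIso (x y : K) (n : ℤ) : x ⊗ y⟦n⟧ ≅ (x ⊗ y)⟦n⟧ :=
  ((tensorLeft x).commShiftIso n).app y

lemma tensorShiftIso_naturality_right (x : K) {y z : K} (f : y ⟶ z) (n : ℤ) :
    x ◁ f⟦n⟧' ≫ (tensorShiftIso x z n).hom = (tensorShiftIso x y n).hom ≫ (x ◁ f)⟦n⟧' :=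
  ((tensorLeft x).commShiftIso n).hom.naturality f

lemma tensorShiftIso_naturality_left {x y : K} (f : x ⟶ y) (z : K) (n : ℤ) :
    f ▷ z⟦n⟧ ≫ (tensorShiftIso y z n).hom = (tensorShiftIso x z n).hom ≫ (f ▷ z)⟦n⟧' :=
  (@NatTrans.shift_app_comm _ _ _ _ (tensorLeft x) (tensorLeft y) ((tensoringLeft K).map f) ℤ _ _ _
    _ _ (TensorShift.commShift_map f) n z).symm

lemma tensorShiftIso_assoc (x y z : K) (n : ℤ) :
    (α_ x y (z⟦n⟧)).hom ≫ x ◁ (tensorShiftIso y z n).hom ≫ (tensorShiftIso x (y ⊗ z) n).hom =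
      (tensorShiftIso (x ⊗ y) z n).hom ≫ ((α_ x y z).hom)⟦n⟧' := by
  have := TensorShift.commShift_assoc x y
  have h := NatTrans.shift_app_comm (tensorLeftTensor x y).hom n z
  rw [Functor.commShiftIso_comp_hom_app] at h
  exact h.symm

lemma tensorShiftIso_unit (z : K) (n : ℤ) :
    (tensorShiftIso (𝟙_ K) z n).hom ≫ ((λ_ z).hom)⟦n⟧' = (λ_ (z⟦n⟧)).hom := by
  have := TensorShift.commShift_unit (K := K)
  have h := NatTrans.shift_app_comm (F₁ := tensorLeft (𝟙_ K)) (F₂ := 𝟭 K)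
    (leftUnitorNatIso K).hom n z
  rw [Functor.commShiftIso_id_hom_app] at h
  exact h.trans (comp_id _)

lemma tensorShiftIso_zero (x y : K) :
    (tensorShiftIso x y 0).hom =
      x ◁ (shiftFunctorZero K ℤ).hom.app y ≫ (shiftFunctorZero K ℤ).inv.app (x ⊗ y) := by
  simp [tensorShiftIso, Functor.commShiftIso_zero]

lemma tensorShiftIso_add (x y : K) (a b : ℤ) :
    (tensorShiftIso x y (a + b)).hom =
      x ◁ (shiftFunctorAdd K a b).hom.app y ≫ (tensorShiftIso x (y⟦a⟧) b).hom ≫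
        (tensorShiftIso x y a).hom⟦b⟧' ≫ (shiftFunctorAdd K a b).inv.app (x ⊗ y) := by
  simp [tensorShiftIso, Functor.commShiftIso_add]

variable {A : K} [MonObj A]

/-- The action of `A` on `Σⁿ X`: `A ⊗ Σⁿ X ≅ Σⁿ (A ⊗ X) ⟶ Σⁿ X`. -/
noncomputable def shiftAct (X : Mod K A) (n : ℤ) : A ⊗ X.X⟦n⟧ ⟶ X.X⟦n⟧ :=
  (tensorShiftIso A X.X n).hom ≫ (act X)⟦n⟧'

/-- The shift of a module. -/
noncomputable def modShiftObj (n : ℤ) (X : Mod K A) : Mod K A where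
  X := X.X⟦n⟧
  mod :=
    { smul := shiftAct X n
      one_smul := by
        change η ▷ X.X⟦n⟧ ≫ shiftAct X n = (λ_ (X.X⟦n⟧)).hom
        rw [shiftAct, ← assoc, tensorShiftIso_naturality_left, assoc, ← Functor.map_comp, one_act,
          tensorShiftIso_unit]
      mul_smul := by
        change μ ▷ X.X⟦n⟧ ≫ shiftAct X n = (α_ A A (X.X⟦n⟧)).hom ≫ A ◁ shiftAct X n ≫ shiftAct X n
        rw [shiftAct, ← assoc, tensorShiftIso_naturality_left, assoc, ← Functor.map_comp, mul_act,
          Functor.map_comp, Functor.map_comp, MonoidalCategory.whiskerLeft_comp, assoc,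
          ← assoc (A ◁ _⟦n⟧'),  tensorShiftIso_naturality_right, assoc, ← assoc,
          ← tensorShiftIso_assoc]
        simp only [assoc] }

lemma shiftAct_naturality {X Y : Mod K A} (f : X ⟶ Y) (n : ℤ) :
    shiftAct X n ≫ f.hom⟦n⟧' = A ◁ f.hom⟦n⟧' ≫ shiftAct Y n := by
  rw [shiftAct, shiftAct, ← assoc (A ◁ _), tensorShiftIso_naturality_right, assoc, assoc,
    ← Functor.map_comp, ← Functor.map_comp, lin]

lemma shiftAct_zero (X : Mod K A) :
    shiftAct X 0 ≫ (shiftFunctorZero K ℤ).hom.app X.X =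
      A ◁ (shiftFunctorZero K ℤ).hom.app X.X ≫ act X := by
  rw [shiftAct, tensorShiftIso_zero]
  simp

lemma shiftAct_add (X : Mod K A) (m n : ℤ) :
    shiftAct X (m + n) ≫ (shiftFunctorAdd K m n).hom.app X.X =
      A ◁ (shiftFunctorAdd K m n).hom.app X.X ≫ shiftAct (modShiftObj m X) n := by
  change _ = _ ≫ (tensorShiftIso A (X.X⟦m⟧) n).hom ≫ (shiftAct X m)⟦n⟧'
  rw [shiftAct, tensorShiftIso_add, shiftAct]
  simp

/-- The shift functors on `A`-modules. -/
noncomputable def modShiftFunctor (A : K) [MonObj A] (n : ℤ) : Mod K A ⥤ Mod K A where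
  obj X := modShiftObj n X
  map {X Y} f := mkLin (X := modShiftObj n X) (Y := modShiftObj n Y) (f.hom⟦n⟧')
    (shiftAct_naturality f n)
  map_id X := by ext; exact CategoryTheory.Functor.map_id _ _
  map_comp f g := by ext; exact CategoryTheory.Functor.map_comp _ _ _

/-- The shift by `0` is the identity. -/
noncomputable def modShiftZero (A : K) [MonObj A] : modShiftFunctor A 0 ≅ 𝟭 (Mod K A) :=
  NatIso.ofComponents (fun X => mkIso (X := (modShiftFunctor A 0).obj X) (Y := X)
    ((shiftFunctorZero K ℤ).app X.X) (shiftAct_zero X)) (fun f => by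
      ext
      exact (shiftFunctorZero K ℤ).hom.naturality f.hom)

/-- The shift is additive in the integer. -/
noncomputable def modShiftAdd (A : K) [MonObj A] (m n : ℤ) :
    modShiftFunctor A (m + n) ≅ modShiftFunctor A m ⋙ modShiftFunctor A n :=
  NatIso.ofComponents (fun X => mkIso (X := (modShiftFunctor A (m + n)).obj X)
    (Y := (modShiftFunctor A n).obj ((modShiftFunctor A m).obj X))
    ((shiftFunctorAdd K m n).app X.X) (shiftAct_add X m n)) (fun f => by
      ext
      exact (shiftFunctorAdd K m n).hom.naturality f.hom)

lemma eqToHom_modShift_hom {m n : ℤ} (h : m = n) (X : Mod K A)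
    (h' : (modShiftFunctor A m).obj X = (modShiftFunctor A n).obj X) :
    (eqToHom h').hom = eqToHom (show X.X⟦m⟧ = X.X⟦n⟧ by rw [h]) := by
  subst h; rfl

/-- The shift on the category of `A`-modules, lifting the one of `K`. -/
noncomputable instance (A : K) [MonObj A] : HasShift (Mod K A) ℤ := hasShiftMk _ _
  { F := modShiftFunctor A
    zero := modShiftZero A
    add := modShiftAdd A
    assoc_hom_app := fun a b c X => by
      ext
      refine (shiftFunctorAdd_assoc_hom_app a b c X.X).trans ?_
      rw [Mod.comp_hom', eqToHom_modShift_hom (add_assoc a b c)]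
      have h : (shiftFunctorAdd' K a (b + c) (a + b + c) (add_assoc a b c).symm).hom.app X.X =
          eqToHom (show X.X⟦a + b + c⟧ = X.X⟦a + (b + c)⟧ by rw [add_assoc]) ≫
            (shiftFunctorAdd K a (b + c)).hom.app X.X := by
        simp [shiftFunctorAdd']
      exact (congrArg (· ≫ (shiftFunctorAdd K b c).hom.app (X.X⟦a⟧)) h).trans (assoc _ _ _)
    zero_add_hom_app := fun n X => by
      ext
      refine (shiftFunctorAdd_zero_add_hom_app n X.X).trans ?_
      rw [Mod.comp_hom', eqToHom_modShift_hom (zero_add n)]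
      rfl
    add_zero_hom_app := fun n X => by
      ext
      refine (shiftFunctorAdd_add_zero_hom_app n X.X).trans ?_
      rw [Mod.comp_hom', eqToHom_modShift_hom (add_zero n)]
      rfl }

lemma shift_X (X : Mod K A) (n : ℤ) : (X⟦n⟧).X = X.X⟦n⟧ := rfl
lemma shift_act (X : Mod K A) (n : ℤ) : act (X⟦n⟧) = shiftAct X n := rfl
lemma shift_hom {X Y : Mod K A} (f : X ⟶ Y) (n : ℤ) : (f⟦n⟧').hom = (f.hom)⟦n⟧' := rfl
end Shift

section Rel

variable {K : Type u} [Category.{v} K] [MonoidalCategory K]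

/-- A ring object `A` is separable if its multiplication has a section `σ` which is linear on both
sides. -/
class SeparableMonObj (A : K) [MonObj A] : Prop where
  exists_section : ∃ σ : A ⟶ A ⊗ A, σ ≫ μ = 𝟙 A ∧
    σ ▷ A ≫ (α_ A A A).hom ≫ A ◁ μ = μ ≫ σ ∧ A ◁ σ ≫ (α_ A A A).inv ≫ μ ▷ A = μ ≫ σ

variable [SymmetricCategory K] {A : K} [MonObj A]

/-- If `A` is commutative and separable, and `l`, `r` are two commuting actions of `A` on `M`, the
pair `(r, l)` has a split coequalizer as soon as the idempotent `t ≫ r` splits. -/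
lemma exists_splitting [IsCommMonObj A] [SeparableMonObj A] {M : K} (l r : A ⊗ M ⟶ M)
    (hl1 : η ▷ M ≫ l = (λ_ M).hom) (hl2 : μ ▷ M ≫ l = (α_ A A M).hom ≫ A ◁ l ≫ l)
    (hr2 : μ ▷ M ≫ r = (α_ A A M).hom ≫ A ◁ r ≫ r)
    (hc : A ◁ r ≫ l = (α_ A A M).inv ≫ (β_ A A).hom ▷ M ≫ (α_ A A M).hom ≫ A ◁ l ≫ r) :
    ∃ t : M ⟶ A ⊗ M, t ≫ l = 𝟙 M ∧ l ≫ t ≫ r = r ≫ t ≫ r := by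
  obtain ⟨σ, h1, h2, h3⟩ := SeparableMonObj.exists_section (A := A)
  have s1 : (λ_ A).inv ≫ (η ≫ σ) ▷ A ≫ (α_ A A A).hom ≫ A ◁ μ = σ := by
    rw [comp_whiskerRight, assoc, h2, MonObj.one_mul_assoc, Iso.inv_hom_id_assoc]
  have s2 : (ρ_ A).inv ≫ A ◁ (η ≫ σ) ≫ (α_ A A A).inv ≫ μ ▷ A = σ := by
    rw [MonoidalCategory.whiskerLeft_comp, assoc, h3, MonObj.mul_one_assoc, Iso.inv_hom_id_assoc]
  set s := η ≫ σ with hs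
  refine ⟨(λ_ M).inv ≫ s ▷ M ≫ (α_ A A M).hom ≫ A ◁ l, ?_, ?_⟩
  · simp only [assoc, ← hl2]
    rw [← comp_whiskerRight_assoc, hs, assoc, h1, comp_id, hl1, Iso.inv_hom_id]
  · trans σ ▷ M ≫ (α_ A A M).hom ≫ A ◁ l ≫ r
    · conv_rhs => rw [← s1]
      simp only [comp_whiskerRight, assoc]
      have : (A ◁ μ) ▷ M ≫ (α_ A A M).hom ≫ A ◁ l =
          (α_ A (A ⊗ A) M).hom ≫ A ◁ (α_ A A M).hom ≫ A ◁ A ◁ l ≫ A ◁ l := by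
        simp only [whisker_assoc, assoc, Iso.inv_hom_id_assoc, ← MonoidalCategory.whiskerLeft_comp, hl2]
      rw [reassoc_of% this, leftUnitor_inv_naturality_assoc, whisker_exchange_assoc]
      monoidal
    · have s3 : (λ_ A).inv ≫ s ▷ A ≫ (α_ A A A).hom ≫ A ◁ (β_ A A).hom ≫ (α_ A A A).inv ≫
          μ ▷ A = σ := by
        rw [← s2]
        have h : (λ_ A).inv ≫ s ▷ A = (ρ_ A).inv ≫ A ◁ s ≫ (β_ A (A ⊗ A)).hom := by
          rw [BraidedCategory.braiding_naturality_right, braiding_tensorUnit_right]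
          simp
        rw [reassoc_of% h, BraidedCategory.braiding_tensor_right_hom]
        simp only [assoc, Iso.inv_hom_id_assoc, ← MonoidalCategory.whiskerLeft_comp_assoc,
          SymmetricCategory.symmetry, MonoidalCategory.whiskerLeft_id, id_comp,
          Iso.hom_inv_id_assoc]
        rw [← comp_whiskerRight, IsCommMonObj.mul_comm]
      have e1 : A ◁ A ◁ l ≫ A ◁ r ≫ r =
          (α_ A A (A ⊗ M)).inv ≫ μ ▷ (A ⊗ M) ≫ A ◁ l ≫ r := by
        have : A ◁ r ≫ r = (α_ A A M).inv ≫ μ ▷ M ≫ r := by rw [hr2, Iso.inv_hom_id_assoc]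
        rw [this, associator_inv_naturality_right_assoc, whisker_exchange_assoc]
      simp only [assoc]
      rw [leftUnitor_inv_naturality_assoc, whisker_exchange_assoc,
        associator_naturality_right_assoc, ← MonoidalCategory.whiskerLeft_comp_assoc, hc]
      simp only [MonoidalCategory.whiskerLeft_comp, assoc]
      rw [e1]
      conv_lhs => rw [← s3]
      monoidal

/-- The action of `A` on `X ⊗ Y` through `X`. -/
def actLeft (X Y : Mod K A) : A ⊗ (X.X ⊗ Y.X) ⟶ X.X ⊗ Y.X :=
  (α_ A X.X Y.X).inv ≫ act X ▷ Y.X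

/-- The action of `A` on `X ⊗ Y` through `Y`. -/
def actRight (X Y : Mod K A) : A ⊗ (X.X ⊗ Y.X) ⟶ X.X ⊗ Y.X :=
  (α_ A X.X Y.X).inv ≫ (β_ A X.X).hom ▷ Y.X ≫ (α_ X.X A Y.X).hom ≫ X.X ◁ act Y

/-- `π : X ⊗ Y ⟶ Z` exhibits the `A`-module `Z` as `X ⊗_A Y`: it is the coequalizer of the two actions
of `A` on `X ⊗ Y`, and the action of `A` on `Z` is induced by them. -/
structure IsRelTensor (X Y Z : Mod K A) (π : X.X ⊗ Y.X ⟶ Z.X) : Prop where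
  balanced : actRight X Y ≫ π = actLeft X Y ≫ π
  linear : actLeft X Y ≫ π = A ◁ π ≫ act Z
  universal : Nonempty (IsColimit (Cofork.ofπ π balanced))

lemma actLeft_one (X Y : Mod K A) : η ▷ (X.X ⊗ Y.X) ≫ actLeft X Y = (λ_ (X.X ⊗ Y.X)).hom := by
  rw [actLeft, associator_inv_naturality_left_assoc, ← comp_whiskerRight, one_act]
  monoidal

lemma actLeft_mul (X Y : Mod K A) : μ ▷ (X.X ⊗ Y.X) ≫ actLeft X Y =
    (α_ A A (X.X ⊗ Y.X)).hom ≫ A ◁ actLeft X Y ≫ actLeft X Y := by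
  simp only [actLeft]
  rw [associator_inv_naturality_left_assoc, ← comp_whiskerRight, mul_act]
  monoidal

lemma actRight_one (X Y : Mod K A) : η ▷ (X.X ⊗ Y.X) ≫ actRight X Y = (λ_ (X.X ⊗ Y.X)).hom := by
  rw [actRight, associator_inv_naturality_left_assoc, ← comp_whiskerRight_assoc,
    BraidedCategory.braiding_naturality_left, comp_whiskerRight_assoc,
    associator_naturality_middle_assoc,
    ← MonoidalCategory.whiskerLeft_comp, one_act, braiding_tensorUnit_left]
  monoidal

lemma actRight_mul (X Y : Mod K A) : μ ▷ (X.X ⊗ Y.X) ≫ actRight X Y =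
    (α_ A A (X.X ⊗ Y.X)).hom ≫ A ◁ actRight X Y ≫ actRight X Y := by
  simp only [actRight]
  rw [associator_inv_naturality_left_assoc, ← comp_whiskerRight_assoc,
    BraidedCategory.braiding_naturality_left, comp_whiskerRight_assoc,
    associator_naturality_middle_assoc,
    ← MonoidalCategory.whiskerLeft_comp, mul_act, BraidedCategory.braiding_tensor_left_hom]
  simp only [MonoidalCategory.whiskerLeft_comp, assoc]
  have : A ◁ X.X ◁ act Y ≫ (α_ A X.X Y.X).inv ≫ (β_ A X.X).hom ▷ Y.X =
      (α_ A X.X _).inv ≫ (β_ A X.X).hom ▷ (A ⊗ Y.X) ≫ (X.X ⊗ A) ◁ act Y := by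
    rw [associator_inv_naturality_right_assoc, whisker_exchange]
  rw [reassoc_of% this]
  monoidal

lemma act_comm (X Y : Mod K A) : A ◁ actRight X Y ≫ actLeft X Y =
    (α_ A A (X.X ⊗ Y.X)).inv ≫ (β_ A A).hom ▷ (X.X ⊗ Y.X) ≫ (α_ A A (X.X ⊗ Y.X)).hom ≫
      A ◁ actLeft X Y ≫ actRight X Y := by
  simp only [actRight, actLeft, MonoidalCategory.whiskerLeft_comp, assoc]
  have e1 : A ◁ X.X ◁ act Y ≫ (α_ A X.X Y.X).inv ≫ act X ▷ Y.X =
      (α_ A X.X _).inv ≫ act X ▷ (A ⊗ Y.X) ≫ X.X ◁ act Y := by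
    rw [associator_inv_naturality_right_assoc, whisker_exchange]
  have e2 : A ◁ act X ▷ Y.X ≫ (α_ A X.X Y.X).inv ≫ (β_ A X.X).hom ▷ Y.X =
      (α_ A (A ⊗ X.X) Y.X).inv ≫ (β_ A (A ⊗ X.X)).hom ▷ Y.X ≫ act X ▷ A ▷ Y.X := by
    rw [associator_inv_naturality_middle_assoc, ← comp_whiskerRight,
      BraidedCategory.braiding_naturality_right, comp_whiskerRight]
  have e3 : (α_ A A (X.X ⊗ Y.X)).inv ≫ (β_ A A).hom ▷ (X.X ⊗ Y.X) ≫ (α_ A A (X.X ⊗ Y.X)).hom ≫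
      (α_ A A (X.X ⊗ Y.X)).inv ≫ (β_ A A).hom ▷ (X.X ⊗ Y.X) ≫ (α_ A A (X.X ⊗ Y.X)).hom = 𝟙 _ := by
    rw [Iso.hom_inv_id_assoc, ← comp_whiskerRight_assoc, SymmetricCategory.symmetry,
      id_whiskerRight, id_comp, Iso.inv_hom_id]
  rw [e1, reassoc_of% e2, BraidedCategory.braiding_tensor_right_hom, ← cancel_epi
    ((α_ A A (X.X ⊗ Y.X)).inv ≫ (β_ A A).hom ▷ (X.X ⊗ Y.X) ≫ (α_ A A (X.X ⊗ Y.X)).hom)]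
  simp only [assoc]
  rw [reassoc_of% e3]
  monoidal

section
variable [IsCommMonObj A] [SeparableMonObj A]

/-- The two actions on `X ⊗ Y` admit a section making any coequalizer split. -/
lemma exists_section_act (X Y : Mod K A) : ∃ t : X.X ⊗ Y.X ⟶ A ⊗ (X.X ⊗ Y.X),
    t ≫ actLeft X Y = 𝟙 _ ∧
      actLeft X Y ≫ t ≫ actRight X Y = actRight X Y ≫ t ≫ actRight X Y :=
  exists_splitting _ _ (actLeft_one X Y) (actLeft_mul X Y) (actRight_mul X Y) (act_comm X Y)

/-- The relative tensor product of two modules over a commutative separable ring object exists,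
as soon as idempotents split. -/
theorem exists_isRelTensor [IsIdempotentComplete K] (X Y : Mod K A) :
    ∃ (Z : Mod K A) (π : X.X ⊗ Y.X ⟶ Z.X), IsRelTensor X Y Z π := by
  obtain ⟨t, h1, h2⟩ := exists_section_act X Y
  have h3 : (t ≫ actRight X Y) ≫ (t ≫ actRight X Y) = t ≫ actRight X Y := by
    rw [assoc, ← h2, reassoc_of% h1]
  obtain ⟨Z, i, p, hip, hpi⟩ := IsIdempotentComplete.idempotents_split _ _ h3
  have hb : actRight X Y ≫ p = actLeft X Y ≫ p := by
    have := congrArg (· ≫ p) h2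
    simp only [assoc] at this
    simpa only [← assoc t, ← hpi, assoc, hip, comp_id] using this.symm
  have key : A ◁ p ≫ A ◁ i ≫ actLeft X Y ≫ p = actLeft X Y ≫ p := by
    rw [← MonoidalCategory.whiskerLeft_comp_assoc, hpi, MonoidalCategory.whiskerLeft_comp, assoc,
      reassoc_of% (act_comm X Y), hb, ← reassoc_of% (actLeft_mul X Y),
      ← comp_whiskerRight_assoc, IsCommMonObj.mul_comm, reassoc_of% (actLeft_mul X Y),
      Iso.inv_hom_id_assoc, ← MonoidalCategory.whiskerLeft_comp_assoc, h1,
      MonoidalCategory.whiskerLeft_id, id_comp]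
  refine ⟨{ X := Z
            mod :=
            { smul := A ◁ i ≫ actLeft X Y ≫ p
              one_smul := ?_
              mul_smul := ?_ } }, p, ⟨hb, key.symm, ⟨?_⟩⟩⟩
  · change η ▷ Z ≫ A ◁ i ≫ actLeft X Y ≫ p = (λ_ Z).hom
    rw [← whisker_exchange_assoc, reassoc_of% (actLeft_one X Y), leftUnitor_naturality_assoc, hip,
      comp_id]
  · change μ ▷ Z ≫ A ◁ i ≫ actLeft X Y ≫ p =
      (α_ A A Z).hom ≫ A ◁ (A ◁ i ≫ actLeft X Y ≫ p) ≫ A ◁ i ≫ actLeft X Y ≫ p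
    rw [← whisker_exchange_assoc, reassoc_of% (actLeft_mul X Y), MonoidalCategory.whiskerLeft_comp,
      MonoidalCategory.whiskerLeft_comp, assoc, assoc, key, associator_naturality_right_assoc]
  · exact IsSplitCoequalizer.isCoequalizer
      { rightSection := i
        leftSection := t
        condition := hb
        rightSection_π := hip
        leftSection_bottom := h1
        leftSection_top := hpi.symm }

/-- The canonical map to a relative tensor product is a split epimorphism. -/
lemma IsRelTensor.exists_section {X Y Z : Mod K A} {π : X.X ⊗ Y.X ⟶ Z.X}
    (h : IsRelTensor X Y Z π) : ∃ i : Z.X ⟶ X.X ⊗ Y.X, i ≫ π = 𝟙 _ := by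
  obtain ⟨t, h1, h2⟩ := exists_section_act X Y
  obtain ⟨hc⟩ := h.universal
  refine ⟨hc.desc (Cofork.ofπ (t ≫ actRight X Y) h2.symm), Cofork.IsColimit.hom_ext hc ?_⟩
  have := hc.fac (Cofork.ofπ (t ≫ actRight X Y) h2.symm) WalkingParallelPair.one
  change π ≫ _ = t ≫ actRight X Y at this
  change π ≫ _ ≫ π = π ≫ 𝟙 _
  rw [reassoc_of% this, h.balanced, reassoc_of% h1, comp_id]

/-- `A`-bilinear maps factor uniquely and linearly through the relative tensor product. -/
lemma IsRelTensor.exists_desc {X Y Z W : Mod K A} {π : X.X ⊗ Y.X ⟶ Z.X}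
    (h : IsRelTensor X Y Z π) (f : X.X ⊗ Y.X ⟶ W.X) (hb : actRight X Y ≫ f = actLeft X Y ≫ f)
    (hl : actLeft X Y ≫ f = A ◁ f ≫ act W) : ∃ g : Z ⟶ W, π ≫ g.hom = f := by
  obtain ⟨i, hi⟩ := h.exists_section
  obtain ⟨hc⟩ := h.universal
  obtain ⟨g, h1⟩ : ∃ g : Z.X ⟶ W.X, π ≫ g = f :=
    ⟨_, hc.fac (Cofork.ofπ f hb) WalkingParallelPair.one⟩
  refine ⟨mkLin g ?_, h1⟩
  have h2 : A ◁ i ≫ A ◁ π = 𝟙 _ := by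
    rw [← MonoidalCategory.whiskerLeft_comp, hi, MonoidalCategory.whiskerLeft_id]
  rw [← id_comp (act Z), ← h2, assoc, assoc, ← reassoc_of% h.linear, h1, hl, ← h1,
    MonoidalCategory.whiskerLeft_comp, assoc, reassoc_of% h2]

lemma IsRelTensor.hom_ext {X Y Z W : Mod K A} {π : X.X ⊗ Y.X ⟶ Z.X}
    (h : IsRelTensor X Y Z π) {f g : Z ⟶ W} (hfg : π ≫ f.hom = π ≫ g.hom) : f = g := by
  obtain ⟨hc⟩ := h.universal
  ext
  exact Cofork.IsColimit.hom_ext hc hfg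

/-- Relative tensor products are unique up to isomorphism. -/
lemma IsRelTensor.nonempty_iso {X Y Z Z' : Mod K A} {π : X.X ⊗ Y.X ⟶ Z.X}
    {π' : X.X ⊗ Y.X ⟶ Z'.X} (h : IsRelTensor X Y Z π) (h' : IsRelTensor X Y Z' π') :
    Nonempty (Z ≅ Z') := by
  obtain ⟨f, hf⟩ := h.exists_desc π' h'.balanced h'.linear
  obtain ⟨g, hg⟩ := h'.exists_desc π h.balanced h.linear
  refine ⟨⟨f, g, h.hom_ext ?_, h'.hom_ext ?_⟩⟩
  · rw [Mod.comp_hom', reassoc_of% hf, hg]; exact (comp_id _).symm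
  · rw [Mod.comp_hom', reassoc_of% hg, hf]; exact (comp_id _).symm

end

/-- The module `X ⊗ y`, for `X` a module and `y` an object of `K`; `A` acts on the first factor. -/
def modTensor (X : Mod K A) (y : K) : Mod K A where
  X := X.X ⊗ y
  mod :=
    { smul := (α_ A X.X y).inv ≫ act X ▷ y
      one_smul := by
        change η ▷ (X.X ⊗ y) ≫ (α_ A X.X y).inv ≫ act X ▷ y = (λ_ (X.X ⊗ y)).hom
        rw [associator_inv_naturality_left_assoc, ← comp_whiskerRight, one_act]
        monoidal
      mul_smul := by
        change μ ▷ (X.X ⊗ y) ≫ (α_ A X.X y).inv ≫ act X ▷ y =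
          (α_ A A (X.X ⊗ y)).hom ≫ A ◁ ((α_ A X.X y).inv ≫ act X ▷ y) ≫
            (α_ A X.X y).inv ≫ act X ▷ y
        rw [associator_inv_naturality_left_assoc, ← comp_whiskerRight, mul_act]
        monoidal }

lemma modTensor_act (X : Mod K A) (y : K) :
    act (modTensor X y) = (α_ A X.X y).inv ≫ act X ▷ y := rfl

/-- Extension of scalars `F_A : K ⥤ A-Mod_K`, `y ↦ (A ⊗ y, μ ⊗ 1)`. -/
def extend (A : K) [MonObj A] : K ⥤ Mod K A where
  obj y := modTensor (Mod.regular A) y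
  map {x y} f := mkLin (X := modTensor (Mod.regular A) x) (Y := modTensor (Mod.regular A) y)
    (A ◁ f) (by
      change ((α_ A A x).inv ≫ μ ▷ x) ≫ A ◁ f = A ◁ A ◁ f ≫ (α_ A A y).inv ≫ μ ▷ y
      rw [assoc, ← whisker_exchange, associator_inv_naturality_right_assoc])
  map_id x := by ext; exact MonoidalCategory.whiskerLeft_id _ _
  map_comp f g := by ext; exact MonoidalCategory.whiskerLeft_comp _ _ _

lemma extend_act (y : K) : act ((extend A).obj y) = (α_ A A y).inv ≫ μ ▷ y := rfl

/-- The projection map `X ⊗ (A ⊗ y) ⟶ X ⊗ y`. -/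
def projMap (X : Mod K A) (y : K) : X.X ⊗ (A ⊗ y) ⟶ X.X ⊗ y :=
  (α_ X.X A y).inv ≫ ((β_ X.X A).hom ≫ act X) ▷ y

lemma projMap_left [IsCommMonObj A] (X : Mod K A) (y : K) :
    actLeft X ((extend A).obj y) ≫ projMap X y = A ◁ projMap X y ≫ act (modTensor X y) := by
  change ((α_ A X.X (A ⊗ y)).inv ≫ act X ▷ (A ⊗ y)) ≫ projMap X y = _
  rw [projMap, modTensor_act, assoc, associator_inv_naturality_left_assoc, ← comp_whiskerRight,
    BraidedCategory.braiding_naturality_left_assoc, BraidedCategory.braiding_tensor_left_hom]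
  have : A ◁ act X ≫ act X = (α_ A A X.X).inv ≫ μ ▷ X.X ≫ act X := by
    rw [mul_act, Iso.inv_hom_id_assoc]
  simp only [assoc]
  rw [this, Iso.hom_inv_id_assoc, ← comp_whiskerRight_assoc, IsCommMonObj.mul_comm, mul_act]
  monoidal

lemma projMap_right (X : Mod K A) (y : K) :
    actRight X ((extend A).obj y) ≫ projMap X y = A ◁ projMap X y ≫ act (modTensor X y) := by
  change ((α_ A X.X (A ⊗ y)).inv ≫ (β_ A X.X).hom ▷ (A ⊗ y) ≫ (α_ X.X A (A ⊗ y)).hom ≫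
    X.X ◁ ((α_ A A y).inv ≫ μ ▷ y)) ≫ projMap X y = _
  rw [projMap, modTensor_act]
  simp only [assoc, MonoidalCategory.whiskerLeft_comp]
  rw [associator_inv_naturality_middle_assoc, ← comp_whiskerRight,
    BraidedCategory.braiding_naturality_right_assoc, mul_act,
    BraidedCategory.braiding_tensor_right_hom]
  have : (β_ A X.X).hom ▷ (A ⊗ y) ≫ (α_ _ A y).inv ≫ (β_ X.X A).hom ▷ A ▷ y = (α_ _ A y).inv := by
    rw [associator_inv_naturality_left_assoc, ← comp_whiskerRight, ← comp_whiskerRight,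
      SymmetricCategory.symmetry, id_whiskerRight, id_whiskerRight, comp_id]
  rw [show (β_ A X.X).hom ▷ (A ⊗ y) = (α_ _ A y).inv ≫ (β_ A X.X).hom ▷ A ▷ y ≫ (α_ _ A y).hom by
    monoidal]
  have e : (β_ A X.X).hom ▷ A ▷ y ≫ (β_ X.X A).hom ▷ A ▷ y = 𝟙 _ := by
    rw [← comp_whiskerRight, ← comp_whiskerRight, SymmetricCategory.symmetry, id_whiskerRight,
      id_whiskerRight]
  trans (α_ A X.X (A ⊗ y)).inv ≫ (α_ (A ⊗ X.X) A y).inv ≫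
    ((β_ A X.X).hom ▷ A ▷ y ≫ (β_ X.X A).hom ▷ A ▷ y) ≫ ((α_ A X.X A).hom ≫
      A ◁ (β_ X.X A).hom ≫ A ◁ act X ≫ act X) ▷ y
  · monoidal
  · rw [e]
    monoidal

/-- Projection formula: `X ⊗_A F_A(y)` is `X ⊗ y`. -/
lemma isRelTensor_extend [IsCommMonObj A] (X : Mod K A) (y : K) :
    IsRelTensor X ((extend A).obj y) (modTensor X y) (projMap X y) := by
  have hb : actRight X ((extend A).obj y) ≫ projMap X y =
      actLeft X ((extend A).obj y) ≫ projMap X y := by rw [projMap_left, projMap_right]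
  refine ⟨hb, projMap_left X y, ⟨?_⟩⟩
  let g : y ⟶ A ⊗ y := (λ_ y).inv ≫ η ▷ y
  let t : X.X ⊗ (A ⊗ y) ⟶ A ⊗ (X.X ⊗ (A ⊗ y)) :=
    (α_ X.X A y).inv ≫ (β_ X.X A).hom ▷ y ≫ (α_ A X.X y).hom ≫ A ◁ X.X ◁ g
  have ht1 : t ≫ actRight X ((extend A).obj y) = 𝟙 _ := by
    change ((α_ X.X A y).inv ≫ (β_ X.X A).hom ▷ y ≫ (α_ A X.X y).hom ≫ A ◁ X.X ◁ g) ≫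
      (α_ A X.X (A ⊗ y)).inv ≫ (β_ A X.X).hom ▷ (A ⊗ y) ≫ (α_ X.X A (A ⊗ y)).hom ≫
        X.X ◁ ((α_ A A y).inv ≫ μ ▷ y) = 𝟙 _
    simp only [assoc]
    rw [associator_inv_naturality_right_assoc, whisker_exchange_assoc,
      associator_naturality_right_assoc, Iso.hom_inv_id_assoc, ← comp_whiskerRight_assoc,
      SymmetricCategory.symmetry, id_whiskerRight, id_comp, Iso.inv_hom_id_assoc,
      ← MonoidalCategory.whiskerLeft_comp]
    have : A ◁ g ≫ (α_ A A y).inv ≫ μ ▷ y = 𝟙 _ := by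
      rw [MonoidalCategory.whiskerLeft_comp, assoc, associator_inv_naturality_middle_assoc,
        ← comp_whiskerRight, MonObj.mul_one]
      monoidal
    rw [this, MonoidalCategory.whiskerLeft_id]
  have ht2 : t ≫ actLeft X ((extend A).obj y) = projMap X y ≫ X.X ◁ g := by
    change ((α_ X.X A y).inv ≫ (β_ X.X A).hom ▷ y ≫ (α_ A X.X y).hom ≫ A ◁ X.X ◁ g) ≫
      (α_ A X.X (A ⊗ y)).inv ≫ act X ▷ (A ⊗ y) = _
    rw [projMap]
    simp only [assoc, comp_whiskerRight]
    rw [associator_inv_naturality_right_assoc, whisker_exchange, Iso.hom_inv_id_assoc]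
  have hi : X.X ◁ g ≫ projMap X y = 𝟙 _ := by
    rw [projMap, MonoidalCategory.whiskerLeft_comp, assoc, associator_inv_naturality_middle_assoc,
      ← comp_whiskerRight, BraidedCategory.braiding_naturality_right_assoc, one_act,
      braiding_tensorUnit_right]
    monoidal
  refine Cofork.IsColimit.mk _ (fun s => X.X ◁ g ≫ s.π) (fun s => ?_) (fun s m hm => ?_)
  · have h1 : (t ≫ actRight X ((extend A).obj y)) ≫ s.π = s.π := by rw [ht1]; exact id_comp _
    have h2 : (t ≫ actLeft X ((extend A).obj y)) ≫ s.π = (projMap X y ≫ X.X ◁ g) ≫ s.π :=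
      congrArg (· ≫ s.π) ht2
    exact (assoc _ _ _).symm.trans (h2.symm.trans ((assoc _ _ _).trans
      ((congrArg (t ≫ ·) s.condition.symm).trans ((assoc _ _ _).symm.trans h1))))
  · have h1 : (X.X ◁ g ≫ projMap X y) ≫ m = m := by rw [hi]; exact id_comp _
    exact (h1.symm.trans (assoc _ _ _)).trans (congrArg (X.X ◁ g ≫ ·) hm)

/-- `X ⊗ 𝟙` is `X`. -/
def modTensorUnitIso (X : Mod K A) : modTensor X (𝟙_ K) ≅ X :=
  mkIso (X := modTensor X (𝟙_ K)) (Y := X) (ρ_ X.X) (by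
    change ((α_ A X.X (𝟙_ K)).inv ≫ act X ▷ (𝟙_ K)) ≫ (ρ_ X.X).hom = A ◁ (ρ_ X.X).hom ≫ act X
    monoidal)

/-- `F_A(x) ⊗ y` is `F_A(x ⊗ y)`. -/
def extendTensorIso (x y : K) : modTensor ((extend A).obj x) y ≅ (extend A).obj (x ⊗ y) :=
  mkIso (X := modTensor ((extend A).obj x) y) (Y := (extend A).obj (x ⊗ y)) (α_ A x y) (by
    change ((α_ A (A ⊗ x) y).inv ≫ ((α_ A A x).inv ≫ μ ▷ x) ▷ y) ≫ (α_ A x y).hom =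
      A ◁ (α_ A x y).hom ≫ (α_ A A (x ⊗ y)).inv ≫ μ ▷ (x ⊗ y)
    monoidal)

/-- The tensor product `X ⊗_A Y` of two modules over a commutative separable ring object. -/
noncomputable def relTensor [IsCommMonObj A] [SeparableMonObj A] [IsIdempotentComplete K]
    (X Y : Mod K A) : Mod K A :=
  (exists_isRelTensor X Y).choose

/-- The canonical map `X ⊗ Y ⟶ X ⊗_A Y`. -/
noncomputable def relTensorπ [IsCommMonObj A] [SeparableMonObj A] [IsIdempotentComplete K]
    (X Y : Mod K A) : X.X ⊗ Y.X ⟶ (relTensor X Y).X :=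
  (exists_isRelTensor X Y).choose_spec.choose

lemma relTensor_spec [IsCommMonObj A] [SeparableMonObj A] [IsIdempotentComplete K] (X Y : Mod K A) :
    IsRelTensor X Y (relTensor X Y) (relTensorπ X Y) :=
  (exists_isRelTensor X Y).choose_spec.choose_spec

end Rel

/-- The part of the structure of a tensor-triangulated category (with shift) that enters the
definition of its spectrum: the class of distinguished triangles and the tensor product of
objects. It only serves to write the definition of the spectrum once, for `K` and for the category
of modules; see `ttStruct` and `modTTStruct` for the two instances. -/
class TTStruct (C : Type u) [Category.{v} C] [HasShift C ℤ] where
  distinguished : Set (Triangle C)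
  tensor : C → C → C

/-- Thick `⊗`-ideals: triangulated subcategories (full, containing zero, closed under shifts and under
two-out-of-three in distinguished triangles), closed under direct summands and under tensoring with
arbitrary objects. -/
structure IsThickTensorIdeal {C : Type u} [Category.{v} C] [HasShift C ℤ] [TTStruct C]
    (P : ObjectProperty C) : Prop where
  containsZero : P.ContainsZero
  stableUnderShift : P.IsStableUnderShift ℤ
  obj₁ (T : Triangle C) (hT : T ∈ TTStruct.distinguished) : P T.obj₂ → P T.obj₃ → P T.obj₁
  obj₂ (T : Triangle C) (hT : T ∈ TTStruct.distinguished) : P T.obj₁ → P T.obj₃ → P T.obj₂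
  obj₃ (T : Triangle C) (hT : T ∈ TTStruct.distinguished) : P T.obj₁ → P T.obj₂ → P T.obj₃
  stableUnderRetracts : P.IsStableUnderRetracts
  tensor (x y : C) : P y → P (TTStruct.tensor x y)

/-- Prime thick `⊗`-ideals. -/
structure IsPrimeIdeal {C : Type u} [Category.{v} C] [HasShift C ℤ] [TTStruct C]
    (P : ObjectProperty C) : Prop extends IsThickTensorIdeal P where
  proper : ∃ x, ¬ P x
  prime (x y : C) : P (TTStruct.tensor x y) → P x ∨ P y

/-- The spectrum: the set of prime thick `⊗`-ideals. -/
@[ext]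
structure Spc (C : Type u) [Category.{v} C] [HasShift C ℤ] [TTStruct C] where
  carrier : ObjectProperty C
  isPrime : IsPrimeIdeal carrier

section Spc

variable {C : Type u} [Category.{v} C] [HasShift C ℤ] [TTStruct C]

/-- The topology on the spectrum with open basis the sets `U(x) = {P | x ∈ P}`. -/
instance : TopologicalSpace (Spc C) :=
  TopologicalSpace.generateFrom (Set.range fun x : C => {P : Spc C | P.carrier x})

/-- The support `supp(x) = {P | x ∉ P}`. -/
def supp (x : C) : Set (Spc C) := {P | ¬ P.carrier x}

end Spc

/-- A triangulated category with a monoidal structure compatible with the shift, such that all functors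
`x ⊗ -` are exact. -/
class TensorTriangulated (K : Type u) [Category.{v} K] [Preadditive K] [HasZeroObject K]
    [HasShift K ℤ] [∀ n : ℤ, (shiftFunctor K n).Additive] [Pretriangulated K]
    [MonoidalCategory K] extends TensorShift K where
  exact (x : K) : (tensorLeft x).IsTriangulated

section TT

variable (K : Type u) [Category.{v} K] [Preadditive K] [HasZeroObject K]
    [HasShift K ℤ] [∀ n : ℤ, (shiftFunctor K n).Additive] [Pretriangulated K]
    [MonoidalCategory K]

/-- Distinguished triangles and tensor product of `K`. -/
instance ttStruct : TTStruct K where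
  distinguished := distTriang K
  tensor x y := x ⊗ y

variable {K}
variable [SymmetricCategory K] [MonoidalPreadditive K] [IsIdempotentComplete K]
  [TensorTriangulated K] (A : K) [MonObj A] [IsCommMonObj A] [SeparableMonObj A]

/-- The tt-structure of `A`-modules in `K`, for a tt-ring `A`: a triangle of `A`-modules is
distinguished if and only if the underlying triangle in `K` is, and the tensor product is `⊗_A`. -/
noncomputable instance modTTStruct : TTStruct (Mod K A) where
  distinguished := {T | Triangle.mk (C := K) T.mor₁.hom T.mor₂.hom T.mor₃.hom ∈ distTriang K}
  tensor := relTensor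

variable {A}

lemma isZero_tensor {x : K} (h : IsZero x) (y : K) : IsZero (y ⊗ x) :=
  (tensorLeft y).map_isZero h

lemma isZero_mod {X : Mod K A} (h : IsZero X.X) : IsZero X where
  unique_to Y := ⟨⟨⟨mkLin (h.to_ Y.X) ((isZero_tensor h A).eq_of_src _ _)⟩, fun f => by
    ext; exact h.eq_of_src _ _⟩⟩
  unique_from Y := ⟨⟨⟨mkLin (h.from_ Y.X) (h.eq_of_tgt _ _)⟩, fun f => by
    ext; exact h.eq_of_tgt _ _⟩⟩

lemma extend_shift_linear (x : K) (n : ℤ) :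
    act ((extend A).obj (x⟦n⟧)) ≫ (tensorShiftIso A x n).hom =
      A ◁ (tensorShiftIso A x n).hom ≫ shiftAct ((extend A).obj x) n := by
  change ((α_ A A (x⟦n⟧)).inv ≫ μ ▷ (x⟦n⟧)) ≫ (tensorShiftIso A x n).hom =
    A ◁ (tensorShiftIso A x n).hom ≫ (tensorShiftIso A (A ⊗ x) n).hom ≫
      ((α_ A A x).inv ≫ μ ▷ x)⟦n⟧'
  have h : A ◁ (tensorShiftIso A x n).hom ≫ (tensorShiftIso A (A ⊗ x) n).hom =
      (α_ A A (x⟦n⟧)).inv ≫ (tensorShiftIso (A ⊗ A) x n).hom ≫ ((α_ A A x).hom)⟦n⟧' := by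
    rw [← tensorShiftIso_assoc, Iso.inv_hom_id_assoc]
  rw [reassoc_of% h, ← Functor.map_comp, Iso.hom_inv_id_assoc, ← tensorShiftIso_naturality_left,
    assoc]

/-- Extension of scalars commutes with the shift. -/
noncomputable def extendShiftIso (x : K) (n : ℤ) :
    (extend A).obj (x⟦n⟧) ≅ ((extend A).obj x)⟦n⟧ :=
  mkIso (X := (extend A).obj (x⟦n⟧)) (Y := ((extend A).obj x)⟦n⟧) (tensorShiftIso A x n)
    (extend_shift_linear x n)

/-- The image under `F_A` of a triangle. -/
noncomputable def extendTriangle (T : Triangle K) : Triangle (Mod K A) :=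
  Triangle.mk ((extend A).map T.mor₁) ((extend A).map T.mor₂)
    ((extend A).map T.mor₃ ≫ (extendShiftIso T.obj₁ 1).hom)

/-- Extension of scalars preserves distinguished triangles. -/
lemma extendTriangle_distinguished (T : Triangle K) (hT : T ∈ distTriang K) :
    extendTriangle (A := A) T ∈ TTStruct.distinguished (C := Mod K A) := by
  have := TensorTriangulated.exact A
  exact (tensorLeft A).map_distinguished T hT

/-- Extension of scalars preserves tensor products. -/
lemma extend_tensor (x y : K) :
    Nonempty (relTensor ((extend A).obj x) ((extend A).obj y) ≅ (extend A).obj (x ⊗ y)) := by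
  obtain ⟨e⟩ := (relTensor_spec ((extend A).obj x) ((extend A).obj y)).nonempty_iso
    (isRelTensor_extend ((extend A).obj x) y)
  exact ⟨e ≪≫ extendTensorIso x y⟩

lemma relTensor_unit (X : Mod K A) : Nonempty (relTensor X ((extend A).obj (𝟙_ K)) ≅ X) := by
  obtain ⟨e⟩ := (relTensor_spec X ((extend A).obj (𝟙_ K))).nonempty_iso
    (isRelTensor_extend X (𝟙_ K))
  exact ⟨e ≪≫ modTensorUnitIso X⟩

lemma IsThickTensorIdeal.of_iso {C : Type u} [Category.{v} C] [HasShift C ℤ] [TTStruct C]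
    {P : ObjectProperty C} (h : IsThickTensorIdeal P) {x y : C} (e : x ≅ y) (hx : P x) : P y :=
  h.stableUnderRetracts.of_retract (Retract.ofIso e.symm) hx

variable (A) in
lemma isPrimeIdeal_preimage {P : ObjectProperty (Mod K A)} (hP : IsPrimeIdeal P) :
    IsPrimeIdeal (P.inverseImage (extend A)) where
  containsZero := by
    obtain ⟨Z, hZ, hPZ⟩ := hP.containsZero.exists_zero
    obtain ⟨z, hz⟩ := HasZeroObject.zero (C := K)
    exact ⟨z, hz, hP.of_iso (hZ.iso (isZero_mod (isZero_tensor hz A))) hPZ⟩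
  stableUnderShift := ⟨fun n => ⟨fun x hx =>
    hP.of_iso (extendShiftIso x n).symm
      ((hP.stableUnderShift.isStableUnderShiftBy n).le_shift _ hx)⟩⟩
  obj₁ T hT := hP.obj₁ _ (extendTriangle_distinguished T hT)
  obj₂ T hT := hP.obj₂ _ (extendTriangle_distinguished T hT)
  obj₃ T hT := hP.obj₃ _ (extendTriangle_distinguished T hT)
  stableUnderRetracts := ⟨fun r hy => hP.stableUnderRetracts.of_retract (r.map (extend A)) hy⟩
  tensor x y hy := by
    obtain ⟨e⟩ := extend_tensor (A := A) x y
    exact hP.of_iso e (hP.tensor _ _ hy)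
  proper := by
    by_contra! h
    obtain ⟨X, hX⟩ := hP.proper
    obtain ⟨e⟩ := relTensor_unit X
    exact hX (hP.of_iso e (hP.tensor _ _ (h (𝟙_ K))))
  prime x y hxy := by
    obtain ⟨e⟩ := extend_tensor (A := A) x y
    exact hP.prime _ _ (hP.of_iso e.symm hxy)

variable (A) in
/-- The map `φ_A = Spc(F_A) : Spc(A-Mod_K) → Spc(K)`, `P ↦ F_A⁻¹(P)`. -/
noncomputable def spcMap (P : Spc (Mod K A)) : Spc K where
  carrier := P.carrier.inverseImage (extend A)
  isPrime := isPrimeIdeal_preimage A P.isPrime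

end TT

section Degree

variable {K : Type u} [Category.{v} K] [MonoidalCategory K]

/-- `s ⊗ r ⊗ s' ↦ s f(r) ⊗ s'`. -/
def balancingLeft {R S : K} [MonObj S] (f : R ⟶ S) : (S ⊗ R) ⊗ S ⟶ S ⊗ S :=
  (S ◁ f ≫ μ) ▷ S

/-- `s ⊗ r ⊗ s' ↦ s ⊗ f(r) s'`. -/
def balancingRight {R S : K} [MonObj S] (f : R ⟶ S) : (S ⊗ R) ⊗ S ⟶ S ⊗ S :=
  (α_ S R S).hom ≫ S ◁ (f ▷ S ≫ μ)

/-- A tower of commutative ring objects `B₀ → B₁ → B₂ → ⋯` such that, for all `n`,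
`(μ, proj n) : Bₙ₊₁ ⊗_{Bₙ} Bₙ₊₁ ⟶ Bₙ₊₁ × Bₙ₊₂` is an isomorphism of ring objects and the structure
map `Bₙ₊₁ → Bₙ₊₂` is `proj n ∘ (1 ⊗ η)`. Here the isomorphism is expressed by saying that the ring
homomorphism `(μ, proj n)` from `Bₙ₊₁ ⊗ Bₙ₊₁` is the coequalizer defining the tensor product over
`Bₙ`. Such a tower is determined by `B₀ → B₁` up to isomorphism. -/
structure SplittingTower (K : Type u) [Category.{v} K] [Preadditive K] [HasBinaryBiproducts K]
    [MonoidalCategory K] [SymmetricCategory K] where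
  obj : ℕ → CommMon K
  map (n : ℕ) : obj n ⟶ obj (n + 1)
  proj (n : ℕ) : (obj (n + 1)).X ⊗ (obj (n + 1)).X ⟶ (obj (n + 2)).X
  proj_hom (n : ℕ) : IsMonHom (proj n)
  map_succ (n : ℕ) : (map (n + 1)).hom.hom = (ρ_ _).inv ≫ (obj (n + 1)).X ◁ η ≫ proj n
  balanced (n : ℕ) :
    balancingLeft (map n).hom.hom ≫ biprod.lift μ (proj n) =
      balancingRight (map n).hom.hom ≫ biprod.lift μ (proj n)
  universal (n : ℕ) : Nonempty (IsColimit (Cofork.ofπ (biprod.lift μ (proj n)) (balanced n)))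

/-- `A` has finite degree `d`: in the splitting tower of `A`, that starts with `A^[0] = 𝟙` and
`A^[1] = A`, we have `A^[d] ≠ 0` and `A^[d+1] = 0`. -/
def HasDegree [Preadditive K] [HasBinaryBiproducts K] [SymmetricCategory K]
    (A : K) [MonObj A] [IsCommMonObj A] (d : ℕ) : Prop :=
  ∃ T : SplittingTower K, Nonempty (T.obj 0 ≅ CommMon.trivial K) ∧ Nonempty (T.obj 1 ≅ ⟨A⟩) ∧
    ¬ IsZero (T.obj d).X ∧ IsZero (T.obj (d + 1)).X

end Degree

end TTGeometry

open TTGeometry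

/-! The engine is an existence lemma as in commutative algebra, `exists_prime`: a thick tensor ideal
disjoint from a multiplicative class of objects lies in a prime disjoint from that class. It is
applied to pairs `F`, `U` as in `SeparableExtension`: `U (F x ⊗ z) ≅ x ⊗ U z`, and every `z` is a
summand of `F (U z)`, which is where separability enters. Ideals of the form `U⁻¹ P` then yield
lying over (the image of the map of spectra is the support of `U 𝟙`) and the lifting of inclusions:
a prime contained in the image of `R` is the image of a prime contained in `R`.

Fibers are treated by induction along the tower. Let `f : S → T` satisfy `T ⊗_S T ≅ T × T'`, with
the two ring maps `ℓ, r : T → T'`. For a `T`-module `Y`, the module `T ⊗_S Y` is a summand of `Y ⊕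
ℓ^*(T' ⊗_{T,r} Y)` (`IsSplitting.exists_retraction`). Hence, for primes `P₀` and `P` over the same
prime, either `P₀ ⊆ P`, or some prime `R` of `T'`-modules has `ℓ⁻¹ R = P₀` and `r⁻¹ R ⊆ P`
(`le_or_exists`). Incomparability for `r` passes to `f`: if `P₀` is minimal in its fiber and `P'' ⊇
P₀` lies in the same fiber, the dichotomy for `(P'', P₀)` gives `P'' = P₀` or an `R` with `ℓ⁻¹ R =
P''` and `r⁻¹ R = P₀`; lifting `P₀ ⊆ ℓ⁻¹ R` gives `R' ⊆ R` with `ℓ⁻¹ R' = P₀` and again `r⁻¹ R' =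
P₀`, so `R' = R` and `P'' = P₀`. Once inclusions in fibers are excluded, each point of a fiber is
either a chosen `P₀` or of the form `ℓ⁻¹ R` with `r⁻¹ R = P₀`, so a bound `n` for `r` becomes `n +
1` for `f`. The induction starts at `A^[d+1] = 0`, whose spectrum is empty, and reaches `𝟙 → A` with
the bound `d`.

For the dimension, spectra are sober, so chains of irreducible closed sets are chains of primes;
these are transported by lying over, lifting and incomparability. A finite fiber without inclusions
is T1, hence discrete.

What remains is that modules over tt-rings fit this framework. Separability turns `Z ⊗_A X` into a
split coequalizer, which every functor preserves; associativity, symmetry and exactness of the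
relative tensor product follow. -/

namespace TTGeometry

universe u₀ u₁ u₂

local infixr:70 " ⊡ " => TTStruct.tensor

/-! ### Thick tensor ideals, primes and separable extensions, with objects considered only up to
isomorphism. -/

section Abstract

variable {C : Type u₁} [Category.{v} C] [HasShift C ℤ] [TTStruct C]
  {D : Type u₂} [Category.{v} D] [HasShift D ℤ] [TTStruct D]

/-- A function on objects that behaves, up to isomorphism, like the one underlying an exact
functor. -/
structure IsExactMap (φ : C → D) : Prop where
  isZero {x : C} : IsZero x → IsZero (φ x)
  shift (x : C) (n : ℤ) : Nonempty (φ (x⟦n⟧) ≅ (φ x)⟦n⟧)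
  triangle (T : Triangle C) : T ∈ TTStruct.distinguished → ∃ T' : Triangle D,
    T' ∈ TTStruct.distinguished ∧ Nonempty (T'.obj₁ ≅ φ T.obj₁) ∧ Nonempty (T'.obj₂ ≅ φ T.obj₂) ∧
      Nonempty (T'.obj₃ ≅ φ T.obj₃)
  retract {x y : C} : Retract x y → Nonempty (Retract (φ x) (φ y))

/-- The properties, up to isomorphism, of the tensor product of a tensor-triangulated category. -/
structure IsTensorTriangulated (C : Type u₁) [Category.{v} C] [HasShift C ℤ] [TTStruct C] :
    Prop where
  exists_zero : ∃ z : C, IsZero z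
  exact (x : C) : IsExactMap (fun y : C => x ⊡ y)
  assoc (x y z : C) : Nonempty ((x ⊡ y) ⊡ z ≅ x ⊡ (y ⊡ z))
  comm (x y : C) : Nonempty (x ⊡ y ≅ y ⊡ x)
  exists_unit : ∃ e : C, ∀ x : C, Nonempty (x ⊡ e ≅ x)

namespace IsThickTensorIdeal

variable {P : ObjectProperty C} (hP : IsThickTensorIdeal P)
include hP

lemma of_retract {x y : C} (r : Retract x y) (hy : P y) : P x :=
  hP.stableUnderRetracts.of_retract r hy

lemma shift {x : C} (hx : P x) (n : ℤ) : P (x⟦n⟧) :=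
  (hP.stableUnderShift.isStableUnderShiftBy n).le_shift _ hx

lemma of_isZero {x : C} (hx : IsZero x) : P x := by
  obtain ⟨z, hz, hPz⟩ := hP.containsZero.exists_zero
  exact hP.of_iso (hz.iso hx) hPz

end IsThickTensorIdeal

/-- The preimage of a thick ideal under an exact map is a thick ideal, if it is an ideal. -/
lemma IsExactMap.isThickTensorIdeal_preimage {φ : C → D} (h : IsExactMap φ) {P : ObjectProperty D}
    (hP : IsThickTensorIdeal P) (h0 : ∃ z : C, IsZero z)
    (ht : ∀ x y : C, P (φ y) → P (φ (x ⊡ y))) :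
    IsThickTensorIdeal (C := C) (fun x => P (φ x)) where
  containsZero := by
    obtain ⟨z, hz⟩ := h0
    exact ⟨z, hz, hP.of_isZero (h.isZero hz)⟩
  stableUnderShift := ⟨fun n => ⟨fun x hx => by
    obtain ⟨e⟩ := h.shift x n
    exact hP.of_iso e.symm (hP.shift hx n)⟩⟩
  obj₁ T hT h₂ h₃ := by
    obtain ⟨T', hT', ⟨e₁⟩, ⟨e₂⟩, ⟨e₃⟩⟩ := h.triangle T hT
    exact hP.of_iso e₁ (hP.obj₁ T' hT' (hP.of_iso e₂.symm h₂) (hP.of_iso e₃.symm h₃))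
  obj₂ T hT h₁ h₃ := by
    obtain ⟨T', hT', ⟨e₁⟩, ⟨e₂⟩, ⟨e₃⟩⟩ := h.triangle T hT
    exact hP.of_iso e₂ (hP.obj₂ T' hT' (hP.of_iso e₁.symm h₁) (hP.of_iso e₃.symm h₃))
  obj₃ T hT h₁ h₂ := by
    obtain ⟨T', hT', ⟨e₁⟩, ⟨e₂⟩, ⟨e₃⟩⟩ := h.triangle T hT
    exact hP.of_iso e₃ (hP.obj₃ T' hT' (hP.of_iso e₁.symm h₁) (hP.of_iso e₂.symm h₂))
  stableUnderRetracts := ⟨fun {x y} r hy => by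
    obtain ⟨r'⟩ := h.retract (show Retract x y from r)
    exact hP.of_retract r' hy⟩
  tensor := ht

namespace IsTensorTriangulated

variable (hC : IsTensorTriangulated C) {P : ObjectProperty C} (hP : IsThickTensorIdeal P)
include hC hP

lemma mem_comm {x y : C} (h : P (x ⊡ y)) : P (y ⊡ x) := by
  obtain ⟨e⟩ := hC.comm x y
  exact hP.of_iso e h

lemma tensor_right {x : C} (hx : P x) (y : C) : P (x ⊡ y) :=
  hC.mem_comm hP (hP.tensor y x hx)

lemma mem_assoc {x y z : C} : P ((x ⊡ y) ⊡ z) ↔ P (x ⊡ (y ⊡ z)) := by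
  obtain ⟨e⟩ := hC.assoc x y z
  exact ⟨hP.of_iso e, hP.of_iso e.symm⟩

lemma mem_tensor_iso {x y z : C} (e : y ≅ z) (h : P (x ⊡ y)) : P (x ⊡ z) := by
  obtain ⟨r⟩ := (hC.exact x).retract (Retract.ofIso e.symm)
  exact hP.of_retract r h

/-- Ideal quotients of thick tensor ideals are thick tensor ideals. -/
lemma colon (x : C) : IsThickTensorIdeal (C := C) (fun y => P (x ⊡ y)) :=
  (hC.exact x).isThickTensorIdeal_preimage hP hC.exists_zero fun y z h => by
    obtain ⟨e⟩ := hC.comm z y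
    exact hC.mem_tensor_iso hP e ((hC.mem_assoc hP).1 (hC.mem_comm hP (hP.tensor y _ h)))

/-- Regrouping of four factors, needed to see that classes of objects `F x ⊗ z` are multiplicative.
-/
lemma mem_middle {a b c d : C} (h : P ((a ⊡ b) ⊡ (c ⊡ d))) : P ((a ⊡ c) ⊡ (b ⊡ d)) := by
  have hQ := hC.colon hP a
  refine (hC.mem_assoc hP).2 ((hC.mem_assoc hQ).1 ?_)
  have h' : P (a ⊡ ((b ⊡ c) ⊡ d)) := (hC.mem_assoc hQ).2 ((hC.mem_assoc hP).1 h)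
  have h2 : P (a ⊡ (d ⊡ (b ⊡ c))) := hC.mem_comm hQ h'
  obtain ⟨e⟩ := hC.comm b c
  exact hC.mem_comm hQ (hC.mem_tensor_iso (hC.colon hP a) e h2)

end IsTensorTriangulated

/-- The union of a nonempty chain of thick tensor ideals is one. -/
lemma isThickTensorIdeal_iUnion {c : Set (ObjectProperty C)} (hc : IsChain (· ≤ ·) c)
    (hne : c.Nonempty) (h : ∀ P ∈ c, IsThickTensorIdeal P) :
    IsThickTensorIdeal (C := C) (fun x => ∃ P ∈ c, P x) := by
  obtain ⟨P₀, hP₀⟩ := hne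
  have two {x y : C} (hx : ∃ P ∈ c, P x) (hy : ∃ P ∈ c, P y) : ∃ P ∈ c, P x ∧ P y := by
    obtain ⟨P, hP, hx⟩ := hx
    obtain ⟨P', hP', hy⟩ := hy
    rcases hc.total hP hP' with hle | hle
    · exact ⟨P', hP', hle _ hx, hy⟩
    · exact ⟨P, hP, hx, hle _ hy⟩
  refine ⟨?_, ⟨fun n => ⟨?_⟩⟩, ?_, ?_, ?_, ⟨?_⟩, ?_⟩
  · obtain ⟨z, hz, hz'⟩ := (h P₀ hP₀).containsZero.exists_zero
    exact ⟨z, hz, P₀, hP₀, hz'⟩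
  · rintro x ⟨P, hP, hx⟩
    exact ⟨P, hP, (h P hP).shift hx n⟩
  · intro T hT hx hy
    obtain ⟨P, hP, hx, hy⟩ := two hx hy
    exact ⟨P, hP, (h P hP).obj₁ T hT hx hy⟩
  · intro T hT hx hy
    obtain ⟨P, hP, hx, hy⟩ := two hx hy
    exact ⟨P, hP, (h P hP).obj₂ T hT hx hy⟩
  · intro T hT hx hy
    obtain ⟨P, hP, hx, hy⟩ := two hx hy
    exact ⟨P, hP, (h P hP).obj₃ T hT hx hy⟩
  · rintro x y r ⟨P, hP, hy⟩
    exact ⟨P, hP, (h P hP).of_retract r hy⟩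
  · rintro x y ⟨P, hP, hy⟩
    exact ⟨P, hP, (h P hP).tensor x y hy⟩

/-- An intersection of thick tensor ideals is one. -/
lemma isThickTensorIdeal_iInter (h0 : ∃ z : C, IsZero z) {c : Set (ObjectProperty C)}
    (h : ∀ P ∈ c, IsThickTensorIdeal P) :
    IsThickTensorIdeal (C := C) (fun x => ∀ P ∈ c, P x) where
  containsZero := by
    obtain ⟨z, hz⟩ := h0
    exact ⟨z, hz, fun P hP => (h P hP).of_isZero hz⟩
  stableUnderShift := ⟨fun n => ⟨fun x hx P hP => (h P hP).shift (hx P hP) n⟩⟩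
  obj₁ T hT hx hy P hP := (h P hP).obj₁ T hT (hx P hP) (hy P hP)
  obj₂ T hT hx hy P hP := (h P hP).obj₂ T hT (hx P hP) (hy P hP)
  obj₃ T hT hx hy P hP := (h P hP).obj₃ T hT (hx P hP) (hy P hP)
  stableUnderRetracts := ⟨fun r hy P hP => (h P hP).of_retract r (hy P hP)⟩
  tensor x y hy P hP := (h P hP).tensor x y (hy P hP)

/-- A thick tensor ideal that is disjoint from a multiplicative class of objects is contained in a
prime with the same property. -/
theorem exists_prime (hC : IsTensorTriangulated C) {J : ObjectProperty C}
    (hJ : IsThickTensorIdeal J) {S : ObjectProperty C} (hne : ∃ s, S s)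
    (hS : ∀ s t, S s → S t → ∃ w, S w ∧ ∀ P : ObjectProperty C, IsThickTensorIdeal P →
      P (s ⊡ t) → P w)
    (hJS : ∀ s, S s → ¬ J s) :
    ∃ R : Spc C, J ≤ R.carrier ∧ ∀ s, S s → ¬ R.carrier s := by
  obtain ⟨R, hJR, ⟨hR, hRS⟩, hmax⟩ := zorn_le_nonempty₀
    {P : ObjectProperty C | IsThickTensorIdeal P ∧ ∀ s, S s → ¬ P s}
    (fun c hc hch P₀ hP₀ => ⟨_, ⟨isThickTensorIdeal_iUnion hch ⟨P₀, hP₀⟩ fun P hP => (hc hP).1, by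
      rintro s hs ⟨P, hP, hPs⟩
      exact (hc hP).2 s hs hPs⟩, fun P hP x hx => ⟨P, hP, hx⟩⟩) J ⟨hJ, hJS⟩
  -- By maximality of `R`, every strictly larger thick tensor ideal meets `S`.
  have key {P : ObjectProperty C} (hP : IsThickTensorIdeal P) (hle : R ≤ P) {x : C} (hx : P x)
      (hx' : ¬ R x) : ∃ s, S s ∧ P s := by
    by_contra! hcon
    exact hx' (hmax ⟨hP, hcon⟩ hle x hx)
  refine ⟨⟨R, ⟨hR, ?_, fun x y hxy => ?_⟩⟩, hJR, hRS⟩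
  · obtain ⟨s, hs⟩ := hne
    exact ⟨s, hRS s hs⟩
  · by_contra! hcon
    -- The quotient ideal `(R : y)` contains `R` and `x`, so it contains some `s` in `S`. Then `(R :
    -- s)` contains `R` and `y`, so it contains some `t` in `S`, and `s ⊗ t` in `R` contradicts
    -- disjointness.
    obtain ⟨s, hs, hys⟩ := key (hC.colon hR y) (fun z hz => hR.tensor y z hz)
      (hC.mem_comm hR hxy) hcon.1
    obtain ⟨t, ht, hst⟩ := key (hC.colon hR s) (fun z hz => hR.tensor s z hz)
      (hC.mem_comm hR hys) hcon.2
    obtain ⟨w, hw, hw'⟩ := hS s t hs ht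
    exact hRS w hw (hw' R hR hst)

lemma Spc.not_mem_unit {e : C} (he : ∀ x : C, Nonempty (x ⊡ e ≅ x)) (P : Spc C) :
    ¬ P.carrier e := fun h => by
  obtain ⟨x, hx⟩ := P.isPrime.proper
  obtain ⟨i⟩ := he x
  exact hx (P.isPrime.of_iso i (P.isPrime.tensor x e h))

/-- The data of an exact tensor functor `F : C → D` (on objects) and of an exact right adjoint `U`,
satisfying the projection formula, such that the counit of the adjunction is split. -/
structure SeparableExtension (C : Type u₁) [Category.{v} C] [HasShift C ℤ] [TTStruct C]
    (D : Type u₂) [Category.{v} D] [HasShift D ℤ] [TTStruct D] where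
  F : C → D
  U : D → C
  exact_F : IsExactMap F
  exact_U : IsExactMap U
  tensor (x y : C) : Nonempty (F (x ⊡ y) ≅ F x ⊡ F y)
  proj (x : C) (z : D) : Nonempty (U (F x ⊡ z) ≅ x ⊡ U z)
  retract (z : D) : Nonempty (Retract z (F (U z)))

namespace SeparableExtension

variable (E : SeparableExtension C D)

lemma mem_F_tensor {P : ObjectProperty D} (hP : IsThickTensorIdeal P) {x y : C} :
    P (E.F (x ⊡ y)) ↔ P (E.F x ⊡ E.F y) := by
  obtain ⟨e⟩ := E.tensor x y
  exact ⟨hP.of_iso e, hP.of_iso e.symm⟩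

lemma mem_of_FU {P : ObjectProperty D} (hP : IsThickTensorIdeal P) {z : D} (h : P (E.F (E.U z))) :
    P z := by
  obtain ⟨r⟩ := E.retract z
  exact hP.of_retract r h

lemma mem_proj {P : ObjectProperty C} (hP : IsThickTensorIdeal P) {x : C} {z : D} :
    P (E.U (E.F x ⊡ z)) ↔ P (x ⊡ E.U z) := by
  obtain ⟨e⟩ := E.proj x z
  exact ⟨hP.of_iso e, hP.of_iso e.symm⟩

/-- The inverse image of a prime under a tensor functor. -/
def pull (hC : IsTensorTriangulated C) (R : Spc D) : Spc C where
  carrier x := R.carrier (E.F x)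
  isPrime :=
    { E.exact_F.isThickTensorIdeal_preimage R.isPrime.toIsThickTensorIdeal hC.exists_zero
        fun x y h => (E.mem_F_tensor R.isPrime.toIsThickTensorIdeal).2
          (R.isPrime.tensor _ _ h) with
      proper := by
        obtain ⟨z, hz⟩ := R.isPrime.proper
        exact ⟨E.U z, fun h => hz (E.mem_of_FU R.isPrime.toIsThickTensorIdeal h)⟩
      prime := fun x y h => R.isPrime.prime _ _
        ((E.mem_F_tensor R.isPrime.toIsThickTensorIdeal).1 h) }

lemma pull_mono {hC : IsTensorTriangulated C} {R R' : Spc D} (h : R.carrier ≤ R'.carrier) :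
    (E.pull hC R).carrier ≤ (E.pull hC R').carrier := fun _ hx => h _ hx

variable (hC : IsTensorTriangulated C) (hD : IsTensorTriangulated D)
include hC hD

/-- The objects `z` such that `U z` lies in a given thick tensor ideal form one. -/
lemma isThickTensorIdeal_U {P : ObjectProperty C} (hP : IsThickTensorIdeal P) :
    IsThickTensorIdeal (C := D) (fun z => P (E.U z)) :=
  E.exact_U.isThickTensorIdeal_preimage hP hD.exists_zero fun w z h => by
    -- Only stability under tensoring with an arbitrary `w` of `D` needs an argument: `w ⊗ z` is a
    -- summand of `F (U w) ⊗ z`, and `U` sends the latter to `U w ⊗ U z`.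
    obtain ⟨r⟩ := E.retract w
    obtain ⟨r'⟩ := (hD.exact z).retract r
    obtain ⟨e₁⟩ := hD.comm w z
    obtain ⟨e₂⟩ := hD.comm z (E.F (E.U w))
    obtain ⟨r₃⟩ := E.exact_U.retract
      (((Retract.ofIso e₁).trans (show Retract (z ⊡ w) (z ⊡ E.F (E.U w)) from r')).trans
        (Retract.ofIso e₂))
    exact hP.of_retract r₃ ((E.mem_proj hP).2 (hP.tensor _ _ h))

/-- The projection formula at the unit gives `U (F x) ≅ x ⊗ U 𝟙`. -/
lemma mem_UF {P : ObjectProperty C} (hP : IsThickTensorIdeal P) {x : C} (hx : P x) :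
    P (E.U (E.F x)) := by
  obtain ⟨e, he⟩ := hD.exists_unit
  obtain ⟨i⟩ := he (E.F x)
  exact (E.isThickTensorIdeal_U hC hD hP).of_iso i
    ((E.mem_proj hP).2 (hC.tensor_right hP hx _))

/-- Lying over: the image of `Spc F` consists of the primes that do not contain `U(𝟙)`. -/
lemma exists_pull_eq {e : D} (he : ∀ x : D, Nonempty (x ⊡ e ≅ x)) (Q : Spc C)
    (hQ : ¬ Q.carrier (E.U e)) : ∃ R, E.pull hC R = Q := by
  have hQ' := Q.isPrime.toIsThickTensorIdeal
  -- A prime containing `U⁻¹ Q` and avoiding all `F x` with `x ∉ Q` lies over `Q`. Disjointness is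
  -- the hypothesis on `Q`: `U (F x) ≅ x ⊗ U e` is in `Q` only if `x` or `U e` is.
  obtain ⟨R, hR, hRS⟩ := exists_prime hD (E.isThickTensorIdeal_U hC hD hQ')
    (S := fun w => ∃ x, ¬ Q.carrier x ∧ w = E.F x)
    (by
      obtain ⟨x, hx⟩ := Q.isPrime.proper
      exact ⟨_, x, hx, rfl⟩)
    (by
      rintro _ _ ⟨x, hx, rfl⟩ ⟨y, hy, rfl⟩
      refine ⟨_, ⟨x ⊡ y, fun h => ?_, rfl⟩, fun P hP h => (E.mem_F_tensor hP).2 h⟩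
      exact (Q.isPrime.prime _ _ h).elim hx hy)
    (by
      rintro _ ⟨x, hx, rfl⟩ h
      obtain ⟨i⟩ := he (E.F x)
      have h' := (E.isThickTensorIdeal_U hC hD hQ').of_iso i.symm h
      exact (Q.isPrime.prime _ _ ((E.mem_proj hQ').1 h')).elim hx hQ)
  refine ⟨R, Spc.ext (funext fun x => propext ⟨fun h => ?_, fun h => ?_⟩)⟩
  · by_contra hx
    exact hRS _ ⟨x, hx, rfl⟩ h
  · exact hR _ (E.mem_UF hC hD hQ' h)

lemma pull_not_mem {e : D} (he : ∀ x : D, Nonempty (x ⊡ e ≅ x)) (R : Spc D) :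
    ¬ (E.pull hC R).carrier (E.U e) := fun h =>
  R.not_mem_unit he (E.mem_of_FU R.isPrime.toIsThickTensorIdeal h)

/-- Primes contained in the image of a prime lift to primes contained in it. -/
lemma exists_le_pull_eq {P : Spc C} {R : Spc D} (h : P.carrier ≤ (E.pull hC R).carrier) :
    ∃ R' : Spc D, R'.carrier ≤ R.carrier ∧ E.pull hC R' = P := by
  have hP := P.isPrime.toIsThickTensorIdeal
  obtain ⟨x₀, hx₀⟩ := P.isPrime.proper
  obtain ⟨z₀, hz₀⟩ := R.isPrime.proper
  -- The class combines both requirements, avoiding `F x` for `x ∉ P` and avoiding `z` for `z ∉ R`;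
  -- `x₀` and `z₀` serve to separate them afterwards. For disjointness, `x ⊗ U z ∈ P` forces `U z ∈
  -- P`, hence `F (U z) ∈ R` by assumption, and then its summand `z` is in `R`.
  obtain ⟨R', hR', hS⟩ := exists_prime hD (E.isThickTensorIdeal_U hC hD hP)
    (S := fun w => ∃ x z, ¬ P.carrier x ∧ ¬ R.carrier z ∧ w = E.F x ⊡ z)
    ⟨_, x₀, z₀, hx₀, hz₀, rfl⟩
    (by
      rintro _ _ ⟨x, z, hx, hz, rfl⟩ ⟨x', z', hx', hz', rfl⟩
      refine ⟨_, ⟨x ⊡ x', z ⊡ z', fun h => ?_, fun h => ?_, rfl⟩, fun I hI hw => ?_⟩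
      · exact (P.isPrime.prime _ _ h).elim hx hx'
      · exact (R.isPrime.prime _ _ h).elim hz hz'
      · have h1 := hD.mem_comm hI (hD.mem_middle hI hw)
        obtain ⟨e⟩ := E.tensor x x'
        exact hD.mem_comm hI (hD.mem_tensor_iso hI e.symm h1))
    (by
      rintro _ ⟨x, z, hx, hz, rfl⟩ hU
      rcases P.isPrime.prime _ _ ((E.mem_proj hP).1 hU) with h1 | h1
      · exact hx h1
      · exact hz (E.mem_of_FU R.isPrime.toIsThickTensorIdeal (h _ h1)))
  have hI := R'.isPrime.toIsThickTensorIdeal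
  refine ⟨R', fun z hz => ?_, Spc.ext (funext fun x => propext ⟨fun hx => ?_, fun hx => ?_⟩)⟩
  · by_contra hz'
    exact hS _ ⟨x₀, z, hx₀, hz', rfl⟩ (hI.tensor _ _ hz)
  · by_contra hx'
    exact hS _ ⟨x, z₀, hx', hz₀, rfl⟩ (hD.tensor_right hI hx _)
  · exact hR' _ (E.mem_UF hC hD hP hx)

omit hD in
/-- Every prime contains one which is minimal among those with the same image. -/
lemma exists_minimal (hD0 : ∃ z : D, IsZero z) (R : Spc D) :
    ∃ R₀ : Spc D, R₀.carrier ≤ R.carrier ∧ E.pull hC R₀ = E.pull hC R ∧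
    ∀ R' : Spc D, R'.carrier ≤ R₀.carrier → E.pull hC R' = E.pull hC R → R' = R₀ := by
  -- Zorn's lemma for reverse inclusion. The intersection of a chain of primes is prime: if `x` is
  -- missing from one member and `y` from another, both are missing from the smaller one.
  obtain ⟨I, hIR, ⟨hI, hI'⟩, hmin⟩ := @zorn_le_nonempty₀ (ObjectProperty D)ᵒᵈ _
    {I | ∃ hI : IsPrimeIdeal (C := D) I, E.pull hC ⟨I, hI⟩ = E.pull hC R}
    (fun c hc hch P₀ hP₀ => by
      have hch' : IsChain (· ≤ ·) (show Set (ObjectProperty D) from c) := hch.symm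
      refine ⟨(fun x => ∀ P ∈ (show Set (ObjectProperty D) from c), P x : ObjectProperty D),
        ⟨⟨isThickTensorIdeal_iInter hD0 (fun P hP => (hc hP).1.toIsThickTensorIdeal), ?_, ?_⟩, ?_⟩,
        fun P hP x hx => hx P hP⟩
      · obtain ⟨x, hx⟩ := (hc hP₀).1.proper
        exact ⟨x, fun h => hx (h P₀ hP₀)⟩
      · intro x y hxy
        by_contra! hcon
        obtain ⟨⟨P, hP, hx⟩, P', hP', hy⟩ := hcon
        rcases hch'.total hP hP' with hle | hle
        · exact ((hc hP).1.prime x y (hxy P hP)).elim hx fun h => hy (hle _ h)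
        · exact ((hc hP').1.prime x y (hxy P' hP')).elim (fun h => hx (hle _ h)) hy
      · refine Spc.ext (funext fun x => propext ⟨fun h => ?_, fun h P hP => ?_⟩)
        · rw [← (hc hP₀).2]
          exact h P₀ hP₀
        · rw [← (hc hP).2] at h
          exact h)
    R.carrier ⟨R.isPrime, rfl⟩
  refine ⟨⟨I, hI⟩, hIR, hI', fun R' hR' hR => Spc.ext (le_antisymm hR' ?_)⟩
  exact hmin ⟨R'.isPrime, hR⟩ hR'

end SeparableExtension

end Abstract

/-! ### The inductive step, for three abstract categories. -/

section Step

variable {C₀ : Type u₀} [Category.{v} C₀] [HasShift C₀ ℤ] [TTStruct C₀]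
  {C₁ : Type u₁} [Category.{v} C₁] [HasShift C₁ ℤ] [TTStruct C₁]
  {C₂ : Type u₂} [Category.{v} C₂] [HasShift C₂ ℤ] [TTStruct C₂]
  (h₀ : IsTensorTriangulated C₀) (h₁ : IsTensorTriangulated C₁) (h₂ : IsTensorTriangulated C₂)
  (E : SeparableExtension C₀ C₁) (E₁ E₂ : SeparableExtension C₁ C₂)

namespace SeparableExtension

/-- There are no strict inclusions between primes with the same image. -/
def Incomparable : Prop :=
  ∀ P P' : Spc C₁, P.carrier ≤ P'.carrier → E.pull h₀ P = E.pull h₀ P' → P = P'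

/-- The fibers have at most `n` elements. -/
def FiberBound (n : ℕ) : Prop :=
  ∀ Q : Spc C₀, (E.pull h₀ ⁻¹' {Q}).encard ≤ n

variable {E E₁ E₂}
include h₁ h₂

/-- In the application `E`, `E₁`, `E₂` are the extensions along `f : S → T`, `r` and `ℓ`, and `hM`
expresses that `F (U y)` is a summand of `y ⊕ U₂ (F₁ y)`. One looks for `R` containing `U₂⁻¹ P₀` and
avoiding the objects `F₂ x ⊗ F₁ y` with `x ∉ P₀`, `y ∉ P`; the inclusion `P₀ ≤ P` is what the
failure of disjointness implies. -/
lemma le_or_exists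
    (hM : ∀ P : ObjectProperty C₁, IsThickTensorIdeal P → ∀ y, P y → P (E₂.U (E₁.F y)) →
      P (E.F (E.U y)))
    {P₀ P : Spc C₁} (h : E.pull h₀ P₀ = E.pull h₀ P) :
    P₀.carrier ≤ P.carrier ∨
      ∃ R : Spc C₂, E₂.pull h₁ R = P₀ ∧ (E₁.pull h₁ R).carrier ≤ P.carrier := by
  have hP₀ := P₀.isPrime.toIsThickTensorIdeal
  have hP := P.isPrime.toIsThickTensorIdeal
  have hJ := E₂.isThickTensorIdeal_U h₁ h₂ hP₀
  by_cases hd : ∃ x y, ¬ P₀.carrier x ∧ ¬ P.carrier y ∧ P₀.carrier (E₂.U (E₂.F x ⊡ E₁.F y))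
  -- Primality gives `U₂ (F₁ y) ∈ P₀` for some `y ∉ P`. For `y' ∈ P₀`, `hM` then places `F (U (y ⊗
  -- y'))` in `P₀`, hence in `P` because the images agree; so its summand `y ⊗ y'` is in `P`, and
  -- `y'` is.
  · left
    obtain ⟨x, y, hx, hy, hxy⟩ := hd
    have hy' : P₀.carrier (E₂.U (E₁.F y)) :=
      (P₀.isPrime.prime _ _ ((E₂.mem_proj hP₀).1 hxy)).resolve_left hx
    intro y' hy'₀
    have h3 : P₀.carrier (E₂.U (E₁.F (y ⊡ y'))) :=
      (E₁.mem_F_tensor hJ).2 (h₂.tensor_right hJ hy' _)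
    have h4 : (E.pull h₀ P₀).carrier (E.U (y ⊡ y')) := hM _ hP₀ _ (hP₀.tensor _ _ hy'₀) h3
    rw [h] at h4
    exact (P.isPrime.prime _ _ (E.mem_of_FU hP h4)).resolve_left hy
  · right
    push Not at hd
    obtain ⟨x₀, hx₀⟩ := P₀.isPrime.proper
    obtain ⟨y₀, hy₀⟩ := P.isPrime.proper
    obtain ⟨R, hR, hS⟩ := exists_prime h₂ hJ
      (S := fun w => ∃ x y, ¬ P₀.carrier x ∧ ¬ P.carrier y ∧ w = E₂.F x ⊡ E₁.F y)
      ⟨_, x₀, y₀, hx₀, hy₀, rfl⟩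
      (by
        rintro _ _ ⟨x, y, hx, hy, rfl⟩ ⟨x', y', hx', hy', rfl⟩
        refine ⟨_, ⟨x ⊡ x', y ⊡ y', fun h => ?_, fun h => ?_, rfl⟩, fun I hI hw => ?_⟩
        · exact (P₀.isPrime.prime _ _ h).elim hx hx'
        · exact (P.isPrime.prime _ _ h).elim hy hy'
        · obtain ⟨e⟩ := E₂.tensor x x'
          obtain ⟨e'⟩ := E₁.tensor y y'
          exact h₂.mem_tensor_iso hI e'.symm
            (h₂.mem_comm hI (h₂.mem_tensor_iso hI e.symm (h₂.mem_comm hI (h₂.mem_middle hI hw)))))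
      (by
        rintro _ ⟨x, y, hx, hy, rfl⟩
        exact hd x y hx hy)
    have hI := R.isPrime.toIsThickTensorIdeal
    refine ⟨R, Spc.ext (funext fun x => propext ⟨fun hx => ?_, fun hx => ?_⟩), fun y hy => ?_⟩
    · by_contra hx'
      exact hS _ ⟨x, y₀, hx', hy₀, rfl⟩ (h₂.tensor_right hI hx _)
    · exact hR _ (E₂.mem_UF h₁ h₂ hP₀ hx)
    · by_contra hy'
      exact hS _ ⟨x₀, y, hx₀, hy', rfl⟩ (hI.tensor _ _ hy)

variable (hM : ∀ P : ObjectProperty C₁, IsThickTensorIdeal P → ∀ y, P y → P (E₂.U (E₁.F y)) →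
    P (E.F (E.U y)))
  (hcomm : ∀ R : Spc C₂, E.pull h₀ (E₁.pull h₁ R) = E.pull h₀ (E₂.pull h₁ R))
include hM hcomm

/-- Incomparability descends along the splitting tower. -/
lemma Incomparable.step (hinc : E₁.Incomparable h₁) : E.Incomparable h₀ := by
  intro P P' hle hPP'
  -- It suffices to show that a minimal point of the fiber is contained in no other point of the
  -- fiber: both `P` and `P'` contain `P₀`.
  obtain ⟨P₀, hP₀P, hP₀, hmin⟩ := E.exists_minimal h₀ h₁.exists_zero P
  have key (P'' : Spc C₁) (hle' : P₀.carrier ≤ P''.carrier)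
      (h' : E.pull h₀ P'' = E.pull h₀ P) : P'' = P₀ := by
    rcases le_or_exists h₀ h₁ h₂ hM (P₀ := P'') (P := P₀) (by rw [h', hP₀]) with h | ⟨R, hR, hR'⟩
    · exact hmin P'' h h'
    · have e₁ := hmin _ hR' (by rw [hcomm, hR, h'])
      -- `R` lies over `P''` by `E₂`, so `P₀ ≤ P''` lifts to some `R' ≤ R`. By minimality of `P₀`
      -- both have image `P₀` under `E₁`, and incomparability for `E₁` gives `R' = R`.
      obtain ⟨R', hR'R, hR'P⟩ := E₂.exists_le_pull_eq h₁ h₂ (P := P₀) (R := R) (by rwa [hR])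
      have e₂ := hmin _ ((E₁.pull_mono hR'R).trans hR') (by rw [hcomm, hR'P, hP₀])
      rw [← hR, ← hR'P, hinc R' R hR'R (e₂.trans e₁.symm)]
  rw [key P hP₀P rfl, key P' (hP₀P.trans hle) hPP'.symm]

/-- The bounds on the fibers in the splitting tower. -/
lemma FiberBound.step (hinc : E₁.Incomparable h₁) {n : ℕ} (hn : E₁.FiberBound h₁ n) :
    E.FiberBound h₀ (n + 1) := by
  intro Q
  have hE := Incomparable.step h₀ h₁ h₂ hM hcomm hinc
  rcases (E.pull h₀ ⁻¹' {Q}).eq_empty_or_nonempty with he | ⟨P₀, hP₀⟩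
  · rw [he]; simp
  -- The dichotomy is applied to `(P, P₀)` for a fixed `P₀`; incomparability turns each resulting
  -- inclusion into an equality.
  · have hsub : E.pull h₀ ⁻¹' {Q} ⊆ insert P₀ (E₂.pull h₁ '' (E₁.pull h₁ ⁻¹' {P₀})) := by
      intro P hP
      have hPP : E.pull h₀ P = E.pull h₀ P₀ := hP.trans hP₀.symm
      rcases le_or_exists h₀ h₁ h₂ hM hPP with h | ⟨R, hR, hR'⟩
      · exact Or.inl (hE _ _ h hPP)
      · exact Or.inr ⟨R, hE _ _ hR' (by rw [hcomm, hR, hPP]), hR⟩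
    calc (E.pull h₀ ⁻¹' {Q}).encard
        ≤ (insert P₀ (E₂.pull h₁ '' (E₁.pull h₁ ⁻¹' {P₀}))).encard := Set.encard_le_encard hsub
      _ ≤ (E₂.pull h₁ '' (E₁.pull h₁ ⁻¹' {P₀})).encard + 1 := Set.encard_insert_le _ _
      _ ≤ (E₁.pull h₁ ⁻¹' {P₀}).encard + 1 := by gcongr; exact Set.encard_image_le _ _
      _ ≤ n + 1 := by gcongr; exact hn P₀
      _ = ((n + 1 : ℕ) : ℕ∞) := by norm_cast

end SeparableExtension

end Step

/-! ### Specialization and generic points in the spectrum. -/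

section Topology

variable {C : Type u₁} [Category.{v} C] [HasShift C ℤ] [TTStruct C]

lemma Spc.isOpen_mem (x : C) : IsOpen {P : Spc C | P.carrier x} :=
  TopologicalSpace.isOpen_generateFrom_of_mem ⟨x, rfl⟩

lemma isClosed_supp (x : C) : IsClosed (supp x) :=
  ⟨by simpa [supp, Set.compl_ofPred] using Spc.isOpen_mem x⟩

/-- The closure of a prime consists of the primes contained in it, the reverse of the convention for
rings. An open set containing `P'` contains every larger prime because this holds for the generating
sets. -/
lemma Spc.specializes_iff {P P' : Spc C} : P ⤳ P' ↔ P'.carrier ≤ P.carrier := by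
  constructor
  · intro h x hx
    exact h.mem_open (Spc.isOpen_mem x) hx
  · intro h
    rw [specializes_iff_forall_open]
    intro U hU hP'
    induction hU with
    | basic s hs =>
      obtain ⟨x, rfl⟩ := hs
      exact h _ hP'
    | univ => trivial
    | inter s t _ _ hs ht => exact ⟨hs hP'.1, ht hP'.2⟩
    | sUnion S _ hS =>
      obtain ⟨s, hs, hP'⟩ := hP'
      exact ⟨s, hs, hS s hs hP'⟩

instance : T0Space (Spc C) where
  t0 _ _ h := Spc.ext (le_antisymm (Spc.specializes_iff.1 h.specializes')
    (Spc.specializes_iff.1 h.specializes))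

/-- Irreducible closed subsets of the spectrum have generic points. -/
lemma IsTensorTriangulated.quasiSober (hC : IsTensorTriangulated C) : QuasiSober (Spc C) where
  sober {Z} hZ hZc := by
    -- The generic point of `Z` is the union of the primes in `Z`. By irreducibility any two objects
    -- of the union lie in a common member of `Z`, which gives the two-out-of-three axioms.
    let P : ObjectProperty C := fun x => (Z ∩ {p : Spc C | p.carrier x}).Nonempty
    have two {x y : C} (hx : P x) (hy : P y) : ∃ p ∈ Z, p.carrier x ∧ p.carrier y := by
      obtain ⟨p, hp, h⟩ := hZ.2 _ _ (Spc.isOpen_mem x) (Spc.isOpen_mem y) hx hy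
      exact ⟨p, hp, h⟩
    obtain ⟨e, he⟩ := hC.exists_unit
    obtain ⟨p₀, hp₀⟩ := hZ.1
    have hP : IsPrimeIdeal P :=
      { containsZero := by
          obtain ⟨z, hz⟩ := hC.exists_zero
          exact ⟨z, hz, p₀, hp₀, p₀.isPrime.toIsThickTensorIdeal.of_isZero hz⟩
        stableUnderShift := ⟨fun n => ⟨fun x ⟨p, hp, hx⟩ =>
          ⟨p, hp, p.isPrime.toIsThickTensorIdeal.shift hx n⟩⟩⟩
        obj₁ := fun T hT h h' => by
          obtain ⟨p, hp, hx, hy⟩ := two h h'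
          exact ⟨p, hp, p.isPrime.obj₁ T hT hx hy⟩
        obj₂ := fun T hT h h' => by
          obtain ⟨p, hp, hx, hy⟩ := two h h'
          exact ⟨p, hp, p.isPrime.obj₂ T hT hx hy⟩
        obj₃ := fun T hT h h' => by
          obtain ⟨p, hp, hx, hy⟩ := two h h'
          exact ⟨p, hp, p.isPrime.obj₃ T hT hx hy⟩
        stableUnderRetracts := ⟨fun r ⟨p, hp, hx⟩ =>
          ⟨p, hp, p.isPrime.toIsThickTensorIdeal.of_retract r hx⟩⟩
        tensor := fun x y ⟨p, hp, hy⟩ => ⟨p, hp, p.isPrime.tensor x y hy⟩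
        proper := ⟨e, fun ⟨p, _, h⟩ => p.not_mem_unit he h⟩
        prime := fun x y ⟨p, hp, h⟩ => (p.isPrime.prime x y h).imp
          (fun h => ⟨p, hp, h⟩) (fun h => ⟨p, hp, h⟩) }
    refine ⟨⟨P, hP⟩, ?_⟩
    refine Set.Subset.antisymm ?_ fun p hp => ?_
    · refine closure_minimal (Set.singleton_subset_iff.2 ?_) hZc
      by_contra hPZ
      -- Were `P` outside `Z`, finitely many of the sets `{p | x ∈ p}`, all containing `P`, would
      -- have intersection disjoint from `Z`. Each of them meets `Z` by definition of `P`, so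
      -- irreducibility forbids this.
      have hn : Zᶜ ∈ nhds (⟨P, hP⟩ : Spc C) := hZc.isOpen_compl.mem_nhds hPZ
      obtain ⟨_, ⟨f, ⟨hf, hf'⟩, rfl⟩, hPf, hfZ⟩ :=
        (TopologicalSpace.isTopologicalBasis_of_subbasis (t := instTopologicalSpaceSpc (C := C))
          rfl).mem_nhds_iff.1 hn
      lift f to Finset (Set (Spc C)) using hf
      obtain ⟨p, hp, hpf⟩ := isIrreducible_iff_sInter.1 hZ f
        (fun u hu => by
          obtain ⟨x, rfl⟩ := hf' hu
          exact Spc.isOpen_mem x)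
        (fun u hu => by
          obtain ⟨x, rfl⟩ := hf' hu
          exact hPf _ hu)
      exact hfZ hpf hp
    · rw [← specializes_iff_mem_closure, Spc.specializes_iff]
      exact fun x hx => ⟨p, hp, hx⟩

end Topology

/-! ### Krull dimension, and discreteness of finite fibers. -/

section Dimension

/-- Surjective strictly monotone maps along which inequalities lift downwards preserve the Krull
dimension. -/
lemma krullDim_eq_of_going_down {α : Type u₁} {β : Type u₂} [PartialOrder α] [PartialOrder β] (f : α → β)
    (hf : StrictMono f) (hs : Function.Surjective f)
    (hd : ∀ a b, b ≤ f a → ∃ a' ≤ a, f a' = b) : Order.krullDim α = Order.krullDim β := by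
  refine le_antisymm (Order.krullDim_le_of_strictMono f hf) ?_
  -- A chain is lifted from its top downwards, starting from any preimage `a` of its last term.
  have key (n : ℕ) : ∀ (q : LTSeries β) (a : α), q.length = n → f a = q.last →
      ∃ p : LTSeries α, p.length = n ∧ p.last = a := by
    induction n with
    | zero => exact fun q a _ _ => ⟨RelSeries.singleton _ a, rfl, rfl⟩
    | succ n ih =>
      intro q a hq ha
      have hlt : q.eraseLast.last < q.last := q.eraseLast_last_rel_last (by omega)
      obtain ⟨a', ha', hfa'⟩ := hd a q.eraseLast.last (by rw [ha]; exact hlt.le)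
      obtain ⟨p, hp, rfl⟩ := ih q.eraseLast a' (by simp [hq]) hfa'
      have hlt' : p.last < a := lt_of_le_not_ge ha' fun h => by
        have := hf.monotone h
        rw [hfa', ha] at this
        exact hlt.not_ge this
      exact ⟨p.snoc a hlt', by simp [hp], by simp⟩
  refine iSup_le fun q => ?_
  obtain ⟨a, ha⟩ := hs q.last
  obtain ⟨p, hp, -⟩ := key _ q a rfl ha
  rw [← hp]
  exact Order.LTSeries.length_le_krullDim p

attribute [local instance] specializationOrder in
/-- Surjective maps of sober spaces that lift generalizations and satisfy incomparability preserve
the Krull dimension. -/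
lemma topologicalKrullDim_eq_of_lifting {X : Type u₁} {Y : Type u₂} [TopologicalSpace X]
    [TopologicalSpace Y] [QuasiSober X] [T0Space X] [QuasiSober Y] [T0Space Y] (f : X → Y)
    (hf : ∀ x x', x ⤳ x' → f x ⤳ f x') (hinj : ∀ x x', x ⤳ x' → f x = f x' → x = x')
    (hs : Function.Surjective f) (hd : ∀ x y, f x ⤳ y → ∃ x', x ⤳ x' ∧ f x' = y) :
    topologicalKrullDim X = topologicalKrullDim Y := by
  -- Sobriety identifies irreducible closed subsets with points; in the specialization order `x ≤ y`
  -- means `y ⤳ x`.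
  refine (Order.krullDim_eq_of_orderIso (irreducibleSetEquivPoints (α := X))).trans
    (Eq.trans ?_ (Order.krullDim_eq_of_orderIso (irreducibleSetEquivPoints (α := Y))).symm)
  exact krullDim_eq_of_going_down f
    (fun x x' h => lt_of_le_of_ne (hf _ _ h.le) fun h' => h.ne (hinj _ _ h.le h'.symm).symm) hs hd

/-- A map of spectra induced by a separable extension that satisfies incomparability preserves the
Krull dimension of its image. -/
theorem SeparableExtension.krullDim_eq {C : Type u₁} [Category.{v} C] [HasShift C ℤ] [TTStruct C]
    {D : Type u₂} [Category.{v} D] [HasShift D ℤ] [TTStruct D] (E : SeparableExtension C D)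
    (hC : IsTensorTriangulated C) (hD : IsTensorTriangulated D)
    {e : D} (he : ∀ x : D, Nonempty (TTStruct.tensor x e ≅ x)) (hE : E.Incomparable hC) :
    topologicalKrullDim (Spc D) = topologicalKrullDim (supp (E.U e)) := by
  have := hC.quasiSober
  have := hD.quasiSober
  have : QuasiSober (supp (E.U e)) := (isClosed_supp _).isClosedEmbedding_subtypeVal.quasiSober
  have hle (P P' : supp (E.U e)) : P ⤳ P' ↔ P'.1.carrier ≤ P.1.carrier :=
    (Topology.IsInducing.subtypeVal.specializes_iff (x := P) (y := P')).symm.trans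
      Spc.specializes_iff
  refine topologicalKrullDim_eq_of_lifting (fun R => ⟨E.pull hC R, E.pull_not_mem hC hD he R⟩)
    (fun P P' h => (hle _ _).2 (E.pull_mono (hC := hC) (Spc.specializes_iff.1 h)))
    (fun P P' h h' => (hE _ _ (Spc.specializes_iff.1 h) (congrArg Subtype.val h').symm).symm)
    (fun Q => ?_) fun R Q h => ?_
  · obtain ⟨R, hR⟩ := E.exists_pull_eq hC hD he Q.1 Q.2
    exact ⟨R, Subtype.ext hR⟩
  · obtain ⟨R', hR', h'⟩ := E.exists_le_pull_eq hC hD ((hle _ _).1 h)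
    exact ⟨R', Spc.specializes_iff.2 hR', Subtype.ext h'⟩

/-- Finite fibers without inclusions are discrete. -/
lemma discreteTopology_of_incomparable {C : Type u₁} [Category.{v} C] [HasShift C ℤ] [TTStruct C]
    {s : Set (Spc C)} (hs : s.Finite)
    (h : ∀ P ∈ s, ∀ P' ∈ s, P.carrier ≤ P'.carrier → P = P') : DiscreteTopology s := by
  have : Finite s := hs
  have : T1Space s := by
    rw [t1Space_iff_specializes_imp_eq]
    intro P P' hP
    exact (Subtype.ext (h _ P'.2 _ P.2
      (Spc.specializes_iff.1 (Topology.IsInducing.subtypeVal.specializes_iff.2 hP)))).symm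
  infer_instance

end Dimension

/-! ### Split coequalizers. -/

section SplitCoequalizer

variable {K : Type u} [Category.{v} K]

/-- The factorization uses only the splitting data, so it persists after applying any functor, such
as tensoring or shifting. -/
lemma IsSplitCoequalizer.exists_desc {x y z w : K} {f g : x ⟶ y} {π : y ⟶ z}
    (h : IsSplitCoequalizer f g π) (k : y ⟶ w) (hk : f ≫ k = g ≫ k) :
    ∃ l : z ⟶ w, π ≫ l = k :=
  ⟨h.rightSection ≫ k, by
    rw [← assoc, ← h.leftSection_top, assoc, hk, ← assoc, h.leftSection_bottom, id_comp]⟩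

lemma IsSplitCoequalizer.epi {x y z : K} {f g : x ⟶ y} {π : y ⟶ z}
    (h : IsSplitCoequalizer f g π) : Epi π :=
  (SplitEpi.mk h.rightSection h.rightSection_π).epi

end SplitCoequalizer

/-! ### Splitting coequalizers of modules, and the modules `Z ⊗ x`. -/

section Linear

variable {K : Type u} [Category.{v} K] [MonoidalCategory K] {B : K} [MonObj B]

/-- Split coequalizers lift to modules, if the relevant idempotent splits. -/
lemma exists_isSplitCoequalizer_mod [IsIdempotentComplete K] {M N : Mod K B} (f g : M ⟶ N)
    (t : N.X ⟶ M.X) (h₁ : t ≫ g.hom = 𝟙 _) (h₂ : g.hom ≫ t ≫ f.hom = f.hom ≫ t ≫ f.hom) :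
    ∃ (W : Mod K B) (π : N ⟶ W), Nonempty (IsSplitCoequalizer f.hom g.hom π.hom) := by
  -- The coequalizer is the image of the idempotent `t ≫ f`, which is split in the ambient category;
  -- `t` itself need not be linear.
  have h3 : (t ≫ f.hom) ≫ (t ≫ f.hom) = t ≫ f.hom := by
    rw [assoc, ← h₂, reassoc_of% h₁]
  obtain ⟨Z, i, p, hip, hpi⟩ := IsIdempotentComplete.idempotents_split _ _ h3
  have hb : f.hom ≫ p = g.hom ≫ p := by
    have := congrArg (· ≫ p) h₂
    simp only [assoc] at this
    simpa only [← assoc t, ← hpi, assoc, hip, comp_id] using this.symm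
  have key : B ◁ p ≫ B ◁ i ≫ act N ≫ p = act N ≫ p := by
    rw [← MonoidalCategory.whiskerLeft_comp_assoc, hpi, MonoidalCategory.whiskerLeft_comp, assoc,
      ← reassoc_of% (lin f), hb, reassoc_of% (lin g), ← MonoidalCategory.whiskerLeft_comp_assoc, h₁,
      MonoidalCategory.whiskerLeft_id, id_comp]
  let W : Mod K B :=
    { X := Z
      mod :=
      { smul := B ◁ i ≫ act N ≫ p
        one_smul := by
          change η ▷ Z ≫ B ◁ i ≫ act N ≫ p = (λ_ Z).hom
          rw [← whisker_exchange_assoc, reassoc_of% (one_act N), leftUnitor_naturality_assoc, hip,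
            comp_id]
        mul_smul := by
          change μ ▷ Z ≫ B ◁ i ≫ act N ≫ p =
            (α_ B B Z).hom ≫ B ◁ (B ◁ i ≫ act N ≫ p) ≫ B ◁ i ≫ act N ≫ p
          rw [← whisker_exchange_assoc, reassoc_of% (mul_act N), MonoidalCategory.whiskerLeft_comp,
            MonoidalCategory.whiskerLeft_comp, assoc, assoc, key,
            associator_naturality_right_assoc] } }
  exact ⟨W, mkLin (X := N) (Y := W) p key.symm, ⟨
    { rightSection := i
      leftSection := t
      condition := hb
      rightSection_π := hip
      leftSection_bottom := h₁
      leftSection_top := hpi.symm }⟩⟩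

/-- Restriction of scalars. -/
abbrev restrict {A : K} [MonObj A] (g : A ⟶ B) [IsMonHom g] (Z : Mod K B) : Mod K A where
  X := Z.X
  mod := Mod.scalarRestriction g Z.X

variable [SymmetricCategory K]

/-- `Z ⊗ f`, as a morphism of modules. -/
def modTensorLeft (Z : Mod K B) {x y : K} (f : x ⟶ y) : modTensor Z x ⟶ modTensor Z y :=
  mkLin (X := modTensor Z x) (Y := modTensor Z y) (Z.X ◁ f) (by
    change ((α_ B Z.X x).inv ≫ act Z ▷ x) ≫ Z.X ◁ f = B ◁ (Z.X ◁ f) ≫ (α_ B Z.X y).inv ≫ act Z ▷ y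
    rw [assoc, ← whisker_exchange]
    monoidal)

/-- `φ ⊗ x`, as a morphism of modules. -/
def modTensorRight {Z Z' : Mod K B} (φ : Z ⟶ Z') (x : K) : modTensor Z x ⟶ modTensor Z' x :=
  mkLin (X := modTensor Z x) (Y := modTensor Z' x) (φ.hom ▷ x) (by
    change ((α_ B Z.X x).inv ≫ act Z ▷ x) ≫ φ.hom ▷ x =
      B ◁ (φ.hom ▷ x) ≫ (α_ B Z'.X x).inv ≫ act Z' ▷ x
    rw [assoc, ← comp_whiskerRight, lin]
    monoidal)

/-- The associativity isomorphism, as a morphism of modules. -/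
def modTensorAssoc (Z : Mod K B) (x y : K) :
    modTensor (modTensor Z x) y ≅ modTensor Z (x ⊗ y) :=
  mkIso (X := modTensor (modTensor Z x) y) (Y := modTensor Z (x ⊗ y)) (α_ Z.X x y) (by
    change ((α_ B (Z.X ⊗ x) y).inv ≫ ((α_ B Z.X x).inv ≫ act Z ▷ x) ▷ y) ≫ (α_ Z.X x y).hom =
      B ◁ (α_ Z.X x y).hom ≫ (α_ B Z.X (x ⊗ y)).inv ≫ act Z ▷ (x ⊗ y)
    monoidal)

end Linear

/-! ### Modules over a commutative algebra as bimodules. -/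

section RightAction

variable {K : Type u} [Category.{v} K] [MonoidalCategory K] [SymmetricCategory K]
  {A B : K} [MonObj A] [MonObj B] [IsCommMonObj B] (g : A ⟶ B) [IsMonHom g]

/-- The action of `A` on the right of a module over a commutative `A`-algebra `B`. -/
def rightAct (Z : Mod K B) : Z.X ⊗ A ⟶ Z.X := Z.X ◁ g ≫ (β_ Z.X B).hom ≫ act Z

/-- Left and right actions commute because `B` is commutative. -/
lemma rightAct_linear (Z : Mod K B) :
    (α_ B Z.X A).hom ≫ B ◁ rightAct g Z ≫ act Z = act Z ▷ A ≫ rightAct g Z := by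
  have e : B ◁ act Z ≫ act Z = (α_ B B Z.X).inv ≫ μ ▷ Z.X ≫ act Z := by
    rw [mul_act, Iso.inv_hom_id_assoc]
  rw [rightAct, ← whisker_exchange_assoc, BraidedCategory.braiding_naturality_left_assoc,
    BraidedCategory.braiding_tensor_left_hom]
  simp only [assoc, MonoidalCategory.whiskerLeft_comp]
  rw [e, Iso.hom_inv_id_assoc, ← comp_whiskerRight_assoc, IsCommMonObj.mul_comm]
  monoidal

lemma rightAct_naturality {Z Z' : Mod K B} (f : Z ⟶ Z') :
    rightAct g Z ≫ f.hom = f.hom ▷ A ≫ rightAct g Z' := by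
  rw [rightAct, rightAct, assoc, assoc, lin, ← whisker_exchange_assoc,
    BraidedCategory.braiding_naturality_left_assoc]

lemma rightAct_one (Z : Mod K B) : Z.X ◁ η ≫ rightAct g Z = (ρ_ Z.X).hom := by
  rw [rightAct, ← MonoidalCategory.whiskerLeft_comp_assoc, IsMonHom.one_hom,
    BraidedCategory.braiding_naturality_right_assoc, one_act, braiding_tensorUnit_right]
  simp

lemma rightAct_mul (Z : Mod K B) : rightAct g Z ▷ A ≫ rightAct g Z =
    (α_ Z.X A A).hom ≫ Z.X ◁ μ ≫ rightAct g Z := by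
  have e : B ◁ act Z ≫ act Z = (α_ B B Z.X).inv ≫ μ ▷ Z.X ≫ act Z := by
    rw [mul_act, Iso.inv_hom_id_assoc]
  trans (Z.X ◁ g) ▷ A ≫ (β_ Z.X B).hom ▷ A ≫ act Z ▷ A ≫ rightAct g Z
  · simp only [rightAct, comp_whiskerRight, assoc]
  · rw [← rightAct_linear, rightAct, ← MonoidalCategory.whiskerLeft_comp_assoc _ (μ : A ⊗ A ⟶ A),
      IsMonHom.mul_hom, BraidedCategory.braiding_naturality_right_assoc,
      BraidedCategory.braiding_naturality_right_assoc, BraidedCategory.braiding_tensor_right_hom,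
      ← comp_whiskerRight_assoc, BraidedCategory.braiding_naturality_right]
    simp only [assoc, MonoidalCategory.whiskerLeft_comp, comp_whiskerRight]
    rw [e, MonoidalCategory.tensorHom_def, comp_whiskerRight, associator_naturality_left_assoc,
      ← whisker_exchange_assoc]
    monoidal

end RightAction

/-! ### The tensor product `Z ⊗_A X` as a split coequalizer. -/

section Balanced

variable {K : Type u} [Category.{v} K] [MonoidalCategory K] [SymmetricCategory K]
  {A B : K} [MonObj A] [MonObj B] [IsCommMonObj B] (g : A ⟶ B) [IsMonHom g]

/-- The action of `A` on `Z ⊗ X` through the `B`-module `Z`, on the right of `Z`. -/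
def balL (Z : Mod K B) (X : Mod K A) : (Z.X ⊗ A) ⊗ X.X ⟶ Z.X ⊗ X.X := rightAct g Z ▷ X.X

/-- The action of `A` on `Z ⊗ X` through `X`, on the right of `Z`. -/
def balR (Z : Mod K B) (X : Mod K A) : (Z.X ⊗ A) ⊗ X.X ⟶ Z.X ⊗ X.X :=
  (α_ Z.X A X.X).hom ≫ Z.X ◁ act X

/-- `π : Z ⊗ X ⟶ W` exhibits the `B`-module `W` as `Z ⊗_A X`, for `Z` a `B`-module, `X` an
`A`-module and `B` an `A`-algebra. -/
structure IsBalanced (Z : Mod K B) (X : Mod K A) (W : Mod K B) (π : Z.X ⊗ X.X ⟶ W.X) : Prop where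
  -- Splitness is recorded, and not just the universal property, since the tensor functors are not
  -- assumed to preserve coequalizers.
  split : Nonempty (IsSplitCoequalizer (balR Z X) (balL g Z X) π)
  linear : act Z ▷ X.X ≫ π = (α_ B Z.X X.X).hom ≫ B ◁ π ≫ act W

variable {g}

namespace IsBalanced

variable {Z : Mod K B} {X : Mod K A} {W : Mod K B} {π : Z.X ⊗ X.X ⟶ W.X}
  (h : IsBalanced g Z X W π)
include h

lemma balanced : rightAct g Z ▷ X.X ≫ π = (α_ Z.X A X.X).hom ≫ Z.X ◁ act X ≫ π := by
  obtain ⟨s⟩ := h.split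
  exact s.condition.symm.trans (assoc _ _ _)

lemma epi : Epi π := by
  obtain ⟨s⟩ := h.split
  exact IsSplitCoequalizer.epi s

lemma epi_whiskerLeft (c : K) : Epi (c ◁ π) := by
  obtain ⟨s⟩ := h.split
  exact IsSplitCoequalizer.epi (s.map (tensorLeft c))

lemma epi_whiskerRight (c : K) : Epi (π ▷ c) := by
  obtain ⟨s⟩ := h.split
  exact IsSplitCoequalizer.epi (s.map (tensorRight c))

lemma exists_lift {w : K} (f : Z.X ⊗ X.X ⟶ w)
    (hb : rightAct g Z ▷ X.X ≫ f = (α_ Z.X A X.X).hom ≫ Z.X ◁ act X ≫ f) :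
    ∃ φ : W.X ⟶ w, π ≫ φ = f := by
  obtain ⟨s⟩ := h.split
  exact IsSplitCoequalizer.exists_desc s f ((assoc _ _ _).trans hb.symm)

lemma exists_lift_whiskerLeft (c : K) {w : K} (f : c ⊗ (Z.X ⊗ X.X) ⟶ w)
    (hb : c ◁ rightAct g Z ▷ X.X ≫ f = c ◁ (α_ Z.X A X.X).hom ≫ c ◁ Z.X ◁ act X ≫ f) :
    ∃ φ : c ⊗ W.X ⟶ w, c ◁ π ≫ φ = f := by
  obtain ⟨s⟩ := h.split
  refine IsSplitCoequalizer.exists_desc (s.map (tensorLeft c)) f ?_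
  change c ◁ ((α_ Z.X A X.X).hom ≫ Z.X ◁ act X) ≫ f = _
  rw [MonoidalCategory.whiskerLeft_comp, assoc]
  exact hb.symm

lemma exists_lift_whiskerRight (c : K) {w : K} (f : (Z.X ⊗ X.X) ⊗ c ⟶ w)
    (hb : rightAct g Z ▷ X.X ▷ c ≫ f = (α_ Z.X A X.X).hom ▷ c ≫ (Z.X ◁ act X) ▷ c ≫ f) :
    ∃ φ : W.X ⊗ c ⟶ w, π ▷ c ≫ φ = f := by
  obtain ⟨s⟩ := h.split
  refine IsSplitCoequalizer.exists_desc (s.map (tensorRight c)) f ?_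
  change ((α_ Z.X A X.X).hom ≫ Z.X ◁ act X) ▷ c ≫ f = _
  rw [comp_whiskerRight, assoc]
  exact hb.symm

/-- Morphisms out of `Z ⊗_A X` are linear if they come from linear ones. -/
lemma exists_linear {V : Mod K B} (φ : W.X ⟶ V.X)
    (hl : act Z ▷ X.X ≫ π ≫ φ = (α_ B Z.X X.X).hom ≫ B ◁ (π ≫ φ) ≫ act V) :
    ∃ φ' : W ⟶ V, φ'.hom = φ := by
  have := h.epi_whiskerLeft B
  refine ⟨mkLin φ ?_, rfl⟩
  rw [← cancel_epi (B ◁ π), ← cancel_epi (α_ B Z.X X.X).hom, ← reassoc_of% h.linear, hl,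
    MonoidalCategory.whiskerLeft_comp, assoc]

lemma exists_desc {V : Mod K B} (f : Z.X ⊗ X.X ⟶ V.X)
    (hb : rightAct g Z ▷ X.X ≫ f = (α_ Z.X A X.X).hom ≫ Z.X ◁ act X ≫ f)
    (hl : act Z ▷ X.X ≫ f = (α_ B Z.X X.X).hom ≫ B ◁ f ≫ act V) :
    ∃ φ : W ⟶ V, π ≫ φ.hom = f := by
  obtain ⟨φ, hφ⟩ := h.exists_lift f hb
  obtain ⟨φ', rfl⟩ := h.exists_linear φ (by rw [hφ, hl])
  exact ⟨φ', hφ⟩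

lemma hom_ext {V : Mod K B} {φ ψ : W ⟶ V} (hφ : π ≫ φ.hom = π ≫ ψ.hom) : φ = ψ := by
  have := h.epi
  ext
  rwa [cancel_epi] at hφ

/-- Functoriality of the balanced tensor product. -/
lemma exists_map {Z' : Mod K B} {X' : Mod K A} {W' : Mod K B} {π' : Z'.X ⊗ X'.X ⟶ W'.X}
    (h' : IsBalanced g Z' X' W' π') (φ : Z ⟶ Z') (ψ : X ⟶ X') :
    ∃ m : W ⟶ W', π ≫ m.hom = φ.hom ▷ X.X ≫ Z'.X ◁ ψ.hom ≫ π' := by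
  refine h.exists_desc _ ?_ ?_
  · rw [← comp_whiskerRight_assoc, rightAct_naturality, comp_whiskerRight_assoc,
      ← whisker_exchange_assoc, h'.balanced, ← whisker_exchange_assoc φ.hom ψ.hom,
      ← MonoidalCategory.whiskerLeft_comp_assoc Z.X (act X), lin ψ,
      MonoidalCategory.whiskerLeft_comp_assoc, whisker_exchange_assoc φ.hom (act X'),
      ← whisker_exchange_assoc (φ.hom ▷ A) ψ.hom]
    monoidal
  · rw [← comp_whiskerRight_assoc, lin φ, comp_whiskerRight_assoc, ← whisker_exchange_assoc,
      h'.linear]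
    monoidal

lemma nonempty_retract {Z' : Mod K B} {X' : Mod K A} {W' : Mod K B} {π' : Z'.X ⊗ X'.X ⟶ W'.X}
    (h' : IsBalanced g Z' X' W' π') (r : Retract Z Z') (r' : Retract X X') :
    Nonempty (Retract W W') := by
  obtain ⟨i, hi⟩ := h.exists_map h' r.i r'.i
  obtain ⟨p, hp⟩ := h'.exists_map h r.r r'.r
  refine ⟨⟨i, p, h.hom_ext ?_⟩⟩
  have e₁ : r.i.hom ≫ r.r.hom = 𝟙 _ := congrArg Mod.Hom.hom r.retract
  have e₂ : r'.i.hom ≫ r'.r.hom = 𝟙 _ := congrArg Mod.Hom.hom r'.retract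
  rw [Mod.comp_hom', reassoc_of% hi, hp, whisker_exchange_assoc, ← comp_whiskerRight_assoc, e₁,
    ← MonoidalCategory.whiskerLeft_comp_assoc, e₂]
  simp

lemma nonempty_iso {Z' : Mod K B} {X' : Mod K A} {W' : Mod K B} {π' : Z'.X ⊗ X'.X ⟶ W'.X}
    (h' : IsBalanced g Z' X' W' π') (e : Z ≅ Z') (e' : X ≅ X') :
    Nonempty (W ≅ W') := by
  obtain ⟨i, hi⟩ := h.exists_map h' e.hom e'.hom
  obtain ⟨p, hp⟩ := h'.exists_map h e.inv e'.inv
  have e₁ : e.hom.hom ≫ e.inv.hom = 𝟙 _ := congrArg Mod.Hom.hom e.hom_inv_id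
  have e₂ : e'.hom.hom ≫ e'.inv.hom = 𝟙 _ := congrArg Mod.Hom.hom e'.hom_inv_id
  have e₃ : e.inv.hom ≫ e.hom.hom = 𝟙 _ := congrArg Mod.Hom.hom e.inv_hom_id
  have e₄ : e'.inv.hom ≫ e'.hom.hom = 𝟙 _ := congrArg Mod.Hom.hom e'.inv_hom_id
  refine ⟨⟨i, p, h.hom_ext ?_, h'.hom_ext ?_⟩⟩
  · rw [Mod.comp_hom', reassoc_of% hi, hp, whisker_exchange_assoc, ← comp_whiskerRight_assoc, e₁,
      ← MonoidalCategory.whiskerLeft_comp_assoc, e₂]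
    simp
  · rw [Mod.comp_hom', reassoc_of% hp, hi, whisker_exchange_assoc, ← comp_whiskerRight_assoc, e₃,
      ← MonoidalCategory.whiskerLeft_comp_assoc, e₄]
    simp

end IsBalanced

section

variable [SeparableMonObj A]

variable (g) in
/-- The separability section `z ↦ ∑ z s' ⊗ s''` of the right action. -/
lemma exists_section_rightAct (Z : Mod K B) : ∃ w : Z.X ⟶ Z.X ⊗ A, w ≫ rightAct g Z = 𝟙 _ ∧
    rightAct g Z ≫ w = w ▷ A ≫ (α_ Z.X A A).hom ≫ Z.X ◁ μ := by
  obtain ⟨σ, h1, h2, h3⟩ := SeparableMonObj.exists_section (A := A)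
  -- The two linearity conditions say `σ(a) = σ(1) a = a σ(1)`, so the element `σ(1) = ∑ s' ⊗ s''`
  -- determines `σ`.
  have s1 : (λ_ A).inv ≫ (η ≫ σ) ▷ A ≫ (α_ A A A).hom ≫ A ◁ μ = σ := by
    rw [comp_whiskerRight, assoc, h2, MonObj.one_mul_assoc, Iso.inv_hom_id_assoc]
  have s2 : (ρ_ A).inv ≫ A ◁ (η ≫ σ) ≫ (α_ A A A).inv ≫ μ ▷ A = σ := by
    rw [MonoidalCategory.whiskerLeft_comp, assoc, h3, MonObj.mul_one_assoc, Iso.inv_hom_id_assoc]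
  have e : rightAct g Z ▷ A ≫ rightAct g Z = (α_ Z.X A A).hom ≫ Z.X ◁ μ ≫ rightAct g Z :=
    rightAct_mul g Z
  refine ⟨(ρ_ Z.X).inv ≫ Z.X ◁ (η ≫ σ) ≫ (α_ Z.X A A).inv ≫ rightAct g Z ▷ A, ?_, ?_⟩
  · simp only [assoc]
    rw [e, Iso.inv_hom_id_assoc, ← MonoidalCategory.whiskerLeft_comp_assoc, assoc, h1, comp_id,
      rightAct_one, Iso.inv_hom_id]
  -- Both sides are `z ⊗ a ↦ z · σ(a)`: one by `σ(a) = a σ(1)`, the other by `σ(a) = σ(1) a`.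
  · trans Z.X ◁ σ ≫ (α_ Z.X A A).inv ≫ rightAct g Z ▷ A
    · conv_rhs => rw [← s2]
      rw [rightUnitor_inv_naturality_assoc, ← whisker_exchange_assoc,
        associator_inv_naturality_left_assoc, ← comp_whiskerRight, e]
      monoidal
    · conv_lhs => rw [← s1]
      simp only [comp_whiskerRight, assoc]
      rw [associator_naturality_left_assoc, ← whisker_exchange]
      monoidal

variable (g) in
/-- The two actions of `A` on `Z ⊗ X` admit a section, natural in `X`, that makes any coequalizer
split. -/
lemma exists_section_bal (Z : Mod K B) : ∃ w : Z.X ⟶ Z.X ⊗ A, ∀ X : Mod K A,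
    w ▷ X.X ≫ balL g Z X = 𝟙 _ ∧
      balL g Z X ≫ w ▷ X.X ≫ balR Z X = balR Z X ≫ w ▷ X.X ≫ balR Z X := by
  obtain ⟨w, h₁, h₂⟩ := exists_section_rightAct g Z
  refine ⟨w, fun X => ⟨?_, ?_⟩⟩
  · rw [balL, ← comp_whiskerRight, h₁, id_whiskerRight]
  · rw [balL, ← comp_whiskerRight_assoc, h₂, balR, assoc, whisker_exchange_assoc]
    have e : A ◁ act X ≫ act X = (α_ A A X.X).inv ≫ μ ▷ X.X ≫ act X := by
      rw [mul_act, Iso.inv_hom_id_assoc]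
    rw [associator_naturality_right_assoc, ← MonoidalCategory.whiskerLeft_comp _ (A ◁ act X), e]
    monoidal

/-- Coequalizers of the two actions are split. -/
lemma IsBalanced.mk' {Z : Mod K B} {X : Mod K A} {W : Mod K B} {π : Z.X ⊗ X.X ⟶ W.X}
    (hb : rightAct g Z ▷ X.X ≫ π = (α_ Z.X A X.X).hom ≫ Z.X ◁ act X ≫ π)
    (hl : act Z ▷ X.X ≫ π = (α_ B Z.X X.X).hom ≫ B ◁ π ≫ act W) (hπ : Epi π)
    (hd : ∀ {w : K} (f : Z.X ⊗ X.X ⟶ w),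
      rightAct g Z ▷ X.X ≫ f = (α_ Z.X A X.X).hom ≫ Z.X ◁ act X ≫ f → ∃ φ : W.X ⟶ w, π ≫ φ = f) :
    IsBalanced g Z X W π := by
  obtain ⟨t, h₁, h₂⟩ : ∃ t : Z.X ⊗ X.X ⟶ (Z.X ⊗ A) ⊗ X.X, t ≫ balL g Z X = 𝟙 _ ∧
      balL g Z X ≫ t ≫ balR Z X = balR Z X ≫ t ≫ balR Z X := by
    obtain ⟨w, hw⟩ := exists_section_bal g Z
    exact ⟨w ▷ X.X, hw X⟩
  have hb' : balR Z X ≫ π = balL g Z X ≫ π := (assoc _ _ _).trans hb.symm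
  -- The idempotent `t ≫ balR` is balanced, hence descends along `π`; the descended map is the
  -- section.
  obtain ⟨s, hs⟩ := hd (t ≫ balR Z X) (by simpa only [balR, balL, assoc] using h₂)
  exact ⟨⟨
    { rightSection := s
      leftSection := t
      condition := hb'
      rightSection_π := by
        rw [← cancel_epi π, reassoc_of% hs, hb', reassoc_of% h₁, comp_id]
      leftSection_bottom := h₁
      leftSection_top := hs.symm }⟩, hl⟩

variable (g) in
/-- The tensor product `Z ⊗_A X` exists. -/
theorem exists_isBalanced [IsIdempotentComplete K] (Z : Mod K B) (X : Mod K A) :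
    ∃ (W : Mod K B) (π : Z.X ⊗ X.X ⟶ W.X), IsBalanced g Z X W π := by
  obtain ⟨t, h₁, h₂⟩ : ∃ t : Z.X ⊗ X.X ⟶ (Z.X ⊗ A) ⊗ X.X, t ≫ balL g Z X = 𝟙 _ ∧
      balL g Z X ≫ t ≫ balR Z X = balR Z X ≫ t ≫ balR Z X := by
    obtain ⟨w, hw⟩ := exists_section_bal g Z
    exact ⟨w ▷ X.X, hw X⟩
  let ρ : modTensor Z A ⟶ Z := mkLin (X := modTensor Z A) (Y := Z) (rightAct g Z) (by
    change ((α_ B Z.X A).inv ≫ act Z ▷ A) ≫ rightAct g Z = B ◁ rightAct g Z ≫ act Z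
    rw [assoc, ← rightAct_linear, Iso.inv_hom_id_assoc])
  obtain ⟨W, π, ⟨s⟩⟩ := exists_isSplitCoequalizer_mod (B := B)
    (M := modTensor (modTensor Z A) X.X) (N := modTensor Z X.X)
    ((modTensorAssoc Z A X.X).hom ≫ modTensorLeft Z (act X)) (modTensorRight ρ X.X) t h₁ h₂
  obtain ⟨p, hp⟩ : ∃ p : Z.X ⊗ X.X ⟶ W.X, p = π.hom := ⟨_, rfl⟩
  have hl : ((α_ B Z.X X.X).inv ≫ act Z ▷ X.X) ≫ p = B ◁ p ≫ act W := by rw [hp]; exact lin π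
  rw [assoc, Iso.inv_comp_eq] at hl
  refine ⟨W, p, ⟨?_⟩, hl⟩
  rw [hp]
  exact s

/-- The restriction to `A` of `Z ⊗_A X`. -/
lemma IsBalanced.restrictScalars {Z : Mod K B} {X : Mod K A} {W : Mod K B} {π : Z.X ⊗ X.X ⟶ W.X}
    [IsCommMonObj A] (h : IsBalanced g Z X W π) :
    IsBalanced (𝟙 A) (restrict g Z) X (restrict g W) π where
  split := by
    have e : rightAct (𝟙 A) (restrict g Z) = rightAct g Z := by
      change Z.X ◁ (𝟙 A) ≫ (β_ Z.X A).hom ≫ g ▷ Z.X ≫ act Z = _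
      rw [MonoidalCategory.whiskerLeft_id, id_comp,
        ← BraidedCategory.braiding_naturality_right_assoc]
      rfl
    have e' : balL (𝟙 A) (restrict g Z) X = balL g Z X := congrArg (· ▷ X.X) e
    rw [e']
    exact h.split
  linear := by
    change (g ▷ Z.X ≫ act Z) ▷ X.X ≫ π = (α_ A Z.X X.X).hom ≫ A ◁ π ≫ g ▷ W.X ≫ act W
    rw [comp_whiskerRight_assoc, h.linear, whisker_exchange_assoc]
    monoidal

/-- The tensor product of modules that enters the definition of the spectrum. -/
lemma isBalanced_relTensor [IsCommMonObj A] [IsIdempotentComplete K] (X Y : Mod K A) :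
    ∃ π, IsBalanced (𝟙 A) X Y (relTensor X Y) π := by
  -- Moving `A` past `X` identifies the pair defining `relTensor` with the pair of balancing maps.
  obtain ⟨θ, hθ, hL, hR⟩ : ∃ θ : A ⊗ (X.X ⊗ Y.X) ⟶ (X.X ⊗ A) ⊗ Y.X, Epi θ ∧
      actLeft X Y = θ ≫ balL (𝟙 A) X Y ∧ actRight X Y = θ ≫ balR X Y := by
    refine ⟨(α_ A X.X Y.X).inv ≫ (β_ A X.X).hom ▷ Y.X, inferInstance, ?_, ?_⟩
    · rw [actLeft, balL, rightAct, assoc, ← comp_whiskerRight, MonoidalCategory.whiskerLeft_id,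
        id_comp, SymmetricCategory.symmetry_assoc]
    · simp only [actRight, balR, assoc]
  have h := relTensor_spec X Y
  obtain ⟨hc⟩ := h.universal
  refine ⟨relTensorπ X Y, IsBalanced.mk' ?_ ?_ ?_ fun {w} f hf => ?_⟩
  · have := h.balanced
    rw [hL, hR, assoc, assoc, cancel_epi] at this
    exact this.symm.trans (assoc _ _ _)
  · have := h.linear
    rwa [actLeft, assoc, Iso.inv_comp_eq] at this
  · exact ⟨fun a b hab => Cofork.IsColimit.hom_ext hc hab⟩
  · have hf' : actRight X Y ≫ f = actLeft X Y ≫ f := by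
      rw [hL, hR, assoc, assoc]
      exact congrArg (θ ≫ ·) ((assoc _ _ _).trans hf.symm)
    exact ⟨_, hc.fac (Cofork.ofπ f hf') WalkingParallelPair.one⟩

end

end Balanced

/-! ### Associativity of balanced tensor products. -/

section Associativity

variable {K : Type u} [Category.{v} K] [MonoidalCategory K] [SymmetricCategory K]
  {A B C : K} [MonObj A] [MonObj B] [MonObj C] [IsCommMonObj B] [IsCommMonObj C]
  {g : A ⟶ B} [IsMonHom g] {h : B ⟶ C} [IsMonHom h]

namespace IsBalanced

lemma epi_whiskerRight_whiskerRight {Z : Mod K B} {X : Mod K A} {W : Mod K B}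
    {π : Z.X ⊗ X.X ⟶ W.X} (hπ : IsBalanced g Z X W π) (c d : K) : Epi (π ▷ c ▷ d) := by
  obtain ⟨s⟩ := hπ.split
  exact IsSplitCoequalizer.epi ((s.map (tensorRight c)).map (tensorRight d))

lemma epi_whiskerLeft_whiskerRight {Z : Mod K B} {X : Mod K A} {W : Mod K B}
    {π : Z.X ⊗ X.X ⟶ W.X} (hπ : IsBalanced g Z X W π) (c d : K) : Epi ((c ◁ π) ▷ d) := by
  obtain ⟨s⟩ := hπ.split
  exact IsSplitCoequalizer.epi ((s.map (tensorLeft c)).map (tensorRight d))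

/-- The right action on `Y ⊗_B Z` is induced by the one on `Z`. -/
lemma rightAct_eq {Y : Mod K C} {Z : Mod K B} {W : Mod K C} {π : Y.X ⊗ Z.X ⟶ W.X}
    (hπ : IsBalanced h Y Z W π) (g : A ⟶ B) [IsMonHom g] (k : A ⟶ C) [IsMonHom k]
    (hk : k = g ≫ h) :
    π ▷ A ≫ rightAct k W = (α_ Y.X Z.X A).hom ≫ Y.X ◁ rightAct g Z ≫ π := by
  have e : rightAct k W = W.X ◁ g ≫ W.X ◁ h ≫ (β_ W.X C).hom ≫ act W := by
    simp only [rightAct, hk, MonoidalCategory.whiskerLeft_comp, assoc]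
  have e' : C ◁ π ≫ act W = (α_ C Y.X Z.X).inv ≫ act Y ▷ Z.X ≫ π := by
    rw [hπ.linear, Iso.inv_hom_id_assoc]
  rw [e, ← whisker_exchange_assoc, ← whisker_exchange_assoc,
    BraidedCategory.braiding_naturality_left_assoc, e', BraidedCategory.braiding_tensor_left_hom]
  have e'' : Y.X ◁ act Z ≫ π = (α_ Y.X B Z.X).inv ≫ rightAct h Y ▷ Z.X ≫ π := by
    rw [hπ.balanced, Iso.inv_hom_id_assoc]
  simp only [rightAct, MonoidalCategory.whiskerLeft_comp, assoc, Iso.hom_inv_id_assoc] at e'' ⊢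
  rw [e'']
  have e3 : (Y.X ⊗ Z.X) ◁ h ≫ (α_ Y.X Z.X C).hom ≫ Y.X ◁ (β_ Z.X C).hom ≫ (α_ Y.X C Z.X).inv =
      (α_ Y.X Z.X B).hom ≫ Y.X ◁ (β_ Z.X B).hom ≫ (α_ Y.X B Z.X).inv ≫ (Y.X ◁ h) ▷ Z.X := by
    rw [associator_naturality_right_assoc, ← MonoidalCategory.whiskerLeft_comp_assoc,
      BraidedCategory.braiding_naturality_right, MonoidalCategory.whiskerLeft_comp_assoc,
      associator_inv_naturality_middle]
  rw [reassoc_of% e3]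
  simp only [comp_whiskerRight, assoc]
  monoidal

variable [SeparableMonObj A] [SeparableMonObj B]

/-- Associativity of balanced tensor products: if `ZX = Z ⊗_A X`, `L = Y ⊗_B ZX` and
`YZ = Y ⊗_B Z`, then `L = YZ ⊗_A X`. -/
lemma assoc_iso {k : A ⟶ C} [IsMonHom k] (hk : k = g ≫ h) {X : Mod K A} {Z ZX : Mod K B}
    {Y L YZ : Mod K C} {π₁ : Z.X ⊗ X.X ⟶ ZX.X} {π₂ : Y.X ⊗ ZX.X ⟶ L.X} {π₃ : Y.X ⊗ Z.X ⟶ YZ.X}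
    (h₁ : IsBalanced g Z X ZX π₁) (h₂ : IsBalanced h Y ZX L π₂) (h₃ : IsBalanced h Y Z YZ π₃) :
    ∃ π, IsBalanced k YZ X L π := by
  have e₁ : B ◁ π₁ ≫ act ZX = (α_ B Z.X X.X).inv ≫ act Z ▷ X.X ≫ π₁ := by
    rw [h₁.linear, Iso.inv_hom_id_assoc]
  have e₂ : C ◁ π₂ ≫ act L = (α_ C Y.X ZX.X).inv ≫ act Y ▷ ZX.X ≫ π₂ := by
    rw [h₂.linear, Iso.inv_hom_id_assoc]
  have e₃ : C ◁ π₃ ≫ act YZ = (α_ C Y.X Z.X).inv ≫ act Y ▷ Z.X ≫ π₃ := by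
    rw [h₃.linear, Iso.inv_hom_id_assoc]
  have hr := h₃.rightAct_eq g k hk
  -- The map `(Y ⊗_B Z) ⊗ X → Y ⊗_B (Z ⊗_A X)` descends from `Y ⊗ Z ⊗ X`. All identities below are
  -- checked there, after cancelling epimorphisms that are split and so remain epimorphisms after
  -- whiskering.
  obtain ⟨π, hπ⟩ := h₃.exists_lift_whiskerRight X.X ((α_ Y.X Z.X X.X).hom ≫ Y.X ◁ π₁ ≫ π₂) (by
    rw [associator_naturality_left_assoc, ← whisker_exchange_assoc, h₂.balanced,
      associator_naturality_right_assoc, ← MonoidalCategory.whiskerLeft_comp_assoc _ (B ◁ π₁), e₁]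
    monoidal)
  have := h₁.epi_whiskerLeft Y.X
  have := h₁.epi_whiskerLeft (Y.X ⊗ B)
  have := h₂.epi
  have := h₃.epi_whiskerRight X.X
  have := h₃.epi_whiskerRight_whiskerRight A X.X
  have := h₃.epi_whiskerLeft_whiskerRight C X.X
  have hπe : Epi π := by
    have : Epi (π₃ ▷ X.X ≫ π) := by rw [hπ]; infer_instance
    exact epi_of_epi (π₃ ▷ X.X) π
  refine ⟨π, IsBalanced.mk' ?_ ?_ hπe ?_⟩
  · rw [← cancel_epi (π₃ ▷ A ▷ X.X), ← comp_whiskerRight_assoc, hr,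
      associator_naturality_left_assoc, ← whisker_exchange_assoc, hπ]
    simp only [comp_whiskerRight, assoc]
    rw [hπ]
    have := congrArg (fun f => Y.X ◁ f ≫ π₂) h₁.balanced
    simp only [MonoidalCategory.whiskerLeft_comp, assoc] at this
    rw [associator_naturality_middle_assoc, this]
    monoidal
  · rw [← cancel_epi ((C ◁ π₃) ▷ X.X), ← comp_whiskerRight_assoc, e₃,
      associator_naturality_middle_assoc, ← MonoidalCategory.whiskerLeft_comp_assoc, hπ]
    simp only [comp_whiskerRight, assoc, MonoidalCategory.whiskerLeft_comp]
    rw [hπ, e₂, associator_naturality_left_assoc, ← whisker_exchange_assoc]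
    monoidal
  · intro w f hf
    -- A map that is `A`-balanced on `(Y ⊗_B Z) ⊗ X` is factored twice: first through `Y ⊗ (Z ⊗_A
    -- X)`, then through `Y ⊗_B (Z ⊗_A X)`.
    obtain ⟨f₁, hf₁⟩ := h₁.exists_lift_whiskerLeft Y.X ((α_ Y.X Z.X X.X).inv ≫ π₃ ▷ X.X ≫ f) (by
      have := congrArg (fun q => π₃ ▷ A ▷ X.X ≫ q) hf
      simp only [← comp_whiskerRight_assoc, hr] at this
      rw [associator_naturality_left_assoc, ← whisker_exchange_assoc] at this
      simp only [comp_whiskerRight, assoc] at this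
      rw [associator_inv_naturality_middle_assoc,
        ← cancel_epi ((α_ Y.X Z.X A).hom ▷ X.X ≫ (α_ Y.X (Z.X ⊗ A) X.X).hom)]
      simp only [assoc, Iso.hom_inv_id_assoc]
      rw [this]
      monoidal)
    obtain ⟨f₂, hf₂⟩ := h₂.exists_lift f₁ (by
      rw [← cancel_epi ((Y.X ⊗ B) ◁ π₁), whisker_exchange_assoc, hf₁,
        associator_naturality_right_assoc, ← MonoidalCategory.whiskerLeft_comp_assoc _ (B ◁ π₁), e₁]
      simp only [MonoidalCategory.whiskerLeft_comp, assoc]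
      rw [hf₁, associator_inv_naturality_left_assoc, ← comp_whiskerRight_assoc, h₃.balanced,
        associator_inv_naturality_middle_assoc]
      monoidal)
    refine ⟨f₂, ?_⟩
    rw [← cancel_epi (π₃ ▷ X.X), reassoc_of% hπ, hf₂, hf₁, Iso.hom_inv_id_assoc]

end IsBalanced

end Associativity

/-! ### Free modules, and the split counit of restriction of scalars. -/

section Unit

variable {K : Type u} [Category.{v} K] [MonoidalCategory K] [SymmetricCategory K]
  {A B : K} [MonObj A] [MonObj B] [IsCommMonObj B] (g : A ⟶ B) [IsMonHom g]
  [SeparableMonObj A]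

/-- `Z ⊗_A (A ⊗ y)` is `Z ⊗ y`. -/
lemma isBalanced_extend (Z : Mod K B) (y : K) :
    IsBalanced g Z ((extend A).obj y) (modTensor Z y) ((α_ Z.X A y).inv ≫ rightAct g Z ▷ y) := by
  have e₁ : Z.X ◁ η ≫ rightAct g Z = (ρ_ Z.X).hom := rightAct_one g Z
  have e₂ : rightAct g Z ▷ A ≫ rightAct g Z = (α_ Z.X A A).hom ≫ Z.X ◁ μ ≫ rightAct g Z :=
    rightAct_mul g Z
  refine IsBalanced.mk' ?_ ?_ ?_ ?_
  · change rightAct g Z ▷ (A ⊗ y) ≫ (α_ Z.X A y).inv ≫ rightAct g Z ▷ y =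
      (α_ Z.X A (A ⊗ y)).hom ≫ Z.X ◁ ((α_ A A y).inv ≫ μ ▷ y) ≫ (α_ Z.X A y).inv ≫
        rightAct g Z ▷ y
    rw [associator_inv_naturality_left_assoc, ← comp_whiskerRight, e₂]
    monoidal
  · change act Z ▷ (A ⊗ y) ≫ (α_ Z.X A y).inv ≫ rightAct g Z ▷ y =
      (α_ B Z.X (A ⊗ y)).hom ≫ B ◁ ((α_ Z.X A y).inv ≫ rightAct g Z ▷ y) ≫
        (α_ B Z.X y).inv ≫ act Z ▷ y
    rw [associator_inv_naturality_left_assoc, ← comp_whiskerRight, ← rightAct_linear]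
    monoidal
  · have e : Z.X ◁ ((λ_ y).inv ≫ η ▷ y) ≫ (α_ Z.X A y).inv ≫ rightAct g Z ▷ y = 𝟙 (Z.X ⊗ y) := by
      rw [MonoidalCategory.whiskerLeft_comp, assoc, associator_inv_naturality_middle_assoc,
        ← comp_whiskerRight, e₁]
      monoidal
    exact (SplitEpi.mk _ e).epi
  · intro w f hf
    obtain ⟨k, hk⟩ : ∃ k : Z.X ⊗ (A ⊗ y) ⟶ w, k = f := ⟨_, rfl⟩
    have hf' : rightAct g Z ▷ (A ⊗ y) ≫ k =
      (α_ Z.X A (A ⊗ y)).hom ≫ Z.X ◁ ((α_ A A y).inv ≫ μ ▷ y) ≫ k := by rw [hk]; exact hf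
    refine ⟨Z.X ◁ ((λ_ y).inv ≫ η ▷ y) ≫ k, Eq.trans ?_ hk⟩
    have : A ◁ ((λ_ y).inv ≫ η ▷ y) ≫ (α_ A A y).inv ≫ μ ▷ y = 𝟙 _ := by
      rw [MonoidalCategory.whiskerLeft_comp, assoc, associator_inv_naturality_middle_assoc,
        ← comp_whiskerRight, MonObj.mul_one]
      monoidal
    have e : ((α_ Z.X A y).inv ≫ rightAct g Z ▷ y) ≫ Z.X ◁ ((λ_ y).inv ≫ η ▷ y) ≫ k = k := by
      rw [assoc, ← whisker_exchange_assoc, hf', associator_naturality_right_assoc,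
        Iso.inv_hom_id_assoc, ← MonoidalCategory.whiskerLeft_comp_assoc, this,
        MonoidalCategory.whiskerLeft_id, id_comp]
    exact e

/-- Modules over a separable ring object are direct summands of free ones. -/
lemma exists_section_act_mod (Z : Mod K A) :
    ∃ t : Z ⟶ (extend A).obj Z.X, t.hom ≫ act Z = 𝟙 Z.X := by
  obtain ⟨σ, h1, h2, h3⟩ := SeparableMonObj.exists_section (A := A)
  have s1 : (λ_ A).inv ≫ (η ≫ σ) ▷ A ≫ (α_ A A A).hom ≫ A ◁ μ = σ := by
    rw [comp_whiskerRight, assoc, h2, MonObj.one_mul_assoc, Iso.inv_hom_id_assoc]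
  have s2 : (ρ_ A).inv ≫ A ◁ (η ≫ σ) ≫ (α_ A A A).inv ≫ μ ▷ A = σ := by
    rw [MonoidalCategory.whiskerLeft_comp, assoc, h3, MonObj.mul_one_assoc, Iso.inv_hom_id_assoc]
  have e : A ◁ act Z ≫ act Z = (α_ A A Z.X).inv ≫ μ ▷ Z.X ≫ act Z := by
    rw [mul_act, Iso.inv_hom_id_assoc]
  -- The section is `z ↦ ∑ s' ⊗ s'' z`, where `σ(1) = ∑ s' ⊗ s''`.
  refine ⟨mkLin (X := Z) (Y := (extend A).obj Z.X)
    ((λ_ Z.X).inv ≫ (η ≫ σ) ▷ Z.X ≫ (α_ A A Z.X).hom ≫ A ◁ act Z) ?_, ?_⟩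
  · change act Z ≫ (λ_ Z.X).inv ≫ (η ≫ σ) ▷ Z.X ≫ (α_ A A Z.X).hom ≫ A ◁ act Z =
      A ◁ ((λ_ Z.X).inv ≫ (η ≫ σ) ▷ Z.X ≫ (α_ A A Z.X).hom ≫ A ◁ act Z) ≫
        (α_ A A Z.X).inv ≫ μ ▷ Z.X
    trans σ ▷ Z.X ≫ (α_ A A Z.X).hom ≫ A ◁ act Z
    · conv_rhs => rw [← s1]
      rw [leftUnitor_inv_naturality_assoc, whisker_exchange_assoc,
        associator_naturality_right_assoc, ← MonoidalCategory.whiskerLeft_comp, e]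
      monoidal
    · conv_lhs => rw [← s2]
      simp only [MonoidalCategory.whiskerLeft_comp, assoc]
      rw [associator_inv_naturality_right_assoc, whisker_exchange]
      monoidal
  · change ((λ_ Z.X).inv ≫ (η ≫ σ) ▷ Z.X ≫ (α_ A A Z.X).hom ≫ A ◁ act Z) ≫ act Z = 𝟙 Z.X
    simp only [assoc]
    rw [e, Iso.hom_inv_id_assoc, ← comp_whiskerRight_assoc, assoc, h1, comp_id, one_act,
      Iso.inv_hom_id]

/-- The counit of extension and restriction of scalars is split. -/
lemma IsBalanced.retract_restrict [IsCommMonObj A] [SeparableMonObj B] {Z W : Mod K B}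
    {π : (Mod.regular B).X ⊗ (restrict g Z).X ⟶ W.X}
    (h : IsBalanced g (Mod.regular B) (restrict g Z) W π) : Nonempty (Retract Z W) := by
  obtain ⟨t, ht⟩ := exists_section_act_mod Z
  obtain ⟨t', ht'⟩ : ∃ t' : Z.X ⟶ B ⊗ Z.X, t' = t.hom := ⟨_, rfl⟩
  have htl : act Z ≫ t' = B ◁ t' ≫ (α_ B B Z.X).inv ≫ μ ▷ Z.X := by rw [ht']; exact lin t
  replace ht : t' ≫ act Z = 𝟙 Z.X := by rw [ht']; exact ht
  obtain ⟨p, hp⟩ : ∃ p : B ⊗ Z.X ⟶ W.X, p = π := ⟨_, rfl⟩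
  have hpl : μ ▷ Z.X ≫ p = (α_ B B Z.X).hom ≫ B ◁ p ≫ act W := by rw [hp]; exact h.linear
  have hr : rightAct g (Mod.regular B) = B ◁ g ≫ μ := by
    change B ◁ g ≫ (β_ B B).hom ≫ μ = _
    rw [IsCommMonObj.mul_comm]
  obtain ⟨r, hr⟩ := h.exists_desc (V := Z) (act Z) (by
      rw [hr]
      change (B ◁ g ≫ μ) ▷ Z.X ≫ act Z = (α_ B A Z.X).hom ≫ B ◁ (g ▷ Z.X ≫ act Z) ≫ act Z
      rw [comp_whiskerRight, assoc, mul_act]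
      monoidal) (mul_act Z)
  have hr' : p ≫ r.hom = act Z := by rw [hp]; exact hr
  -- The linear section of the action `B ⊗ Z → Z` given by separability of `B`, followed by the
  -- quotient map to `B ⊗_A Z`, splits the counit `r`.
  let i : Z ⟶ W := mkLin (t' ≫ p) (by
    rw [reassoc_of% htl, hpl, Iso.inv_hom_id_assoc, MonoidalCategory.whiskerLeft_comp, assoc])
  refine ⟨⟨i, r, ?_⟩⟩
  ext
  change (t' ≫ p) ≫ r.hom = 𝟙 Z.X
  rw [assoc, hr', ht]

end Unit

/-! ### Symmetry of the balanced tensor product. -/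

section Commutativity

variable {K : Type u} [Category.{v} K] [MonoidalCategory K] [SymmetricCategory K]
  {A : K} [MonObj A] [IsCommMonObj A]

/-- The relation `x a ⊗ y = x ⊗ a y` becomes the same relation for `Y ⊗ X` when the factors are
exchanged, left and right actions being identified by the braiding. -/
lemma balanced_braiding {X Y : Mod K A} {w : K} {f : X.X ⊗ Y.X ⟶ w}
    (hf : rightAct (𝟙 A) X ▷ Y.X ≫ f = (α_ X.X A Y.X).hom ≫ X.X ◁ act Y ≫ f) :
    rightAct (𝟙 A) Y ▷ X.X ≫ (β_ Y.X X.X).hom ≫ f =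
      (α_ Y.X A X.X).hom ≫ Y.X ◁ act X ≫ (β_ Y.X X.X).hom ≫ f := by
  have e : X.X ◁ act Y ≫ f = (α_ X.X A Y.X).inv ≫ (β_ X.X A).hom ▷ Y.X ≫ act X ▷ Y.X ≫ f := by
    rw [← Iso.inv_comp_eq] at hf
    rw [← hf, rightAct]
    simp
  rw [BraidedCategory.braiding_naturality_right_assoc, rightAct, MonoidalCategory.whiskerLeft_id,
    id_comp, comp_whiskerRight_assoc, BraidedCategory.braiding_naturality_left_assoc, e,
    BraidedCategory.braiding_tensor_left_hom, BraidedCategory.braiding_tensor_right_hom]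
  simp only [assoc, Iso.hom_inv_id_assoc]
  rw [← comp_whiskerRight_assoc (β_ A X.X).hom, SymmetricCategory.symmetry]
  simp

variable [SeparableMonObj A]

/-- The balanced tensor product is symmetric. -/
lemma IsBalanced.braiding {X Y W : Mod K A} {π : X.X ⊗ Y.X ⟶ W.X}
    (h : IsBalanced (𝟙 A) X Y W π) : IsBalanced (𝟙 A) Y X W ((β_ Y.X X.X).hom ≫ π) := by
  have := h.epi
  refine IsBalanced.mk' (balanced_braiding h.balanced) ?_ inferInstance fun {w} f hf => ?_
  · have e₁ : X.X ◁ act Y ≫ π = (α_ X.X A Y.X).inv ≫ (β_ X.X A).hom ▷ Y.X ≫ act X ▷ Y.X ≫ π := by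
      have hf := h.balanced
      rw [← Iso.inv_comp_eq] at hf
      rw [← hf, rightAct]
      simp
    rw [BraidedCategory.braiding_naturality_left_assoc, e₁,
      BraidedCategory.braiding_tensor_left_hom, h.linear]
    simp only [assoc, Iso.hom_inv_id_assoc]
    rw [← comp_whiskerRight_assoc (β_ A X.X).hom, SymmetricCategory.symmetry]
    simp
  · obtain ⟨φ, hφ⟩ := h.exists_lift _ (balanced_braiding hf)
    refine ⟨φ, ?_⟩
    rw [assoc, hφ, SymmetricCategory.symmetry_assoc]

end Commutativity

/-! ### Retracts of distinguished triangles. -/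

section RetractTriangle

variable {K : Type u} [Category.{v} K] [Preadditive K] [HasZeroObject K]
  [HasShift K ℤ] [∀ n : ℤ, (shiftFunctor K n).Additive] [Pretriangulated K]

/-- A retract of a distinguished triangle is distinguished. -/
theorem distinguished_of_retract {T T' : Triangle K} (r : Retract T T') (hT' : T' ∈ distTriang K) :
    T ∈ distTriang K := by
  have hr₁ : r.i.hom₁ ≫ r.r.hom₁ = 𝟙 _ := congrArg TriangleMorphism.hom₁ r.retract
  have hr₂ : r.i.hom₂ ≫ r.r.hom₂ = 𝟙 _ := congrArg TriangleMorphism.hom₂ r.retract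
  have hr₃ : r.i.hom₃ ≫ r.r.hom₃ = 𝟙 _ := congrArg TriangleMorphism.hom₃ r.retract
  -- Before it is known to be distinguished, `T` already inherits exactness under `Hom(W, -)` from
  -- `T'`.
  have exact₂ {W : K} (a : W ⟶ T.obj₂) (ha : a ≫ T.mor₂ = 0) : ∃ b, a = b ≫ T.mor₁ := by
    obtain ⟨b, hb⟩ := Triangle.coyoneda_exact₂ T' hT' (a ≫ r.i.hom₂) (by
      rw [assoc, ← r.i.comm₂, reassoc_of% ha, zero_comp])
    refine ⟨b ≫ r.r.hom₁, ?_⟩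
    rw [assoc, ← r.r.comm₁, ← reassoc_of% hb, hr₂, comp_id]
  have exact₃ {W : K} (a : W ⟶ T.obj₃) (ha : a ≫ T.mor₃ = 0) : ∃ b, a = b ≫ T.mor₂ := by
    obtain ⟨b, hb⟩ := Triangle.coyoneda_exact₃ T' hT' (a ≫ r.i.hom₃) (by
      rw [assoc, ← r.i.comm₃, reassoc_of% ha, zero_comp])
    refine ⟨b ≫ r.r.hom₂, ?_⟩
    rw [assoc, ← r.r.comm₂, ← reassoc_of% hb, hr₃, comp_id]
  have zero₁₂ : T.mor₁ ≫ T.mor₂ = 0 := by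
    rw [← comp_id (T.mor₁ ≫ T.mor₂), ← hr₃, assoc, r.i.comm₂_assoc, r.i.comm₁_assoc,
      comp_distTriang_mor_zero₁₂_assoc _ hT', zero_comp, comp_zero]
  have zero₃₁ : T.mor₃ ≫ T.mor₁⟦1⟧' = 0 := by
    have e : 𝟙 (T.obj₂⟦(1 : ℤ)⟧) = r.i.hom₂⟦(1 : ℤ)⟧' ≫ r.r.hom₂⟦(1 : ℤ)⟧' := by
      rw [← Functor.map_comp, hr₂, CategoryTheory.Functor.map_id]
    rw [← comp_id (T.mor₃ ≫ _), e, assoc, ← Functor.map_comp_assoc, r.i.comm₁,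
      Functor.map_comp_assoc, r.i.comm₃_assoc, comp_distTriang_mor_zero₃₁_assoc _ hT', zero_comp,
      comp_zero]
  -- The cone `C` of the first map of `T` is compared with `T.obj₃` through `T'.obj₃`. The
  -- comparison `c` is a monomorphism by a diagram chase and a split epimorphism by correcting `b`,
  -- so `T` is isomorphic to the triangle on `C`.
  obtain ⟨C, g, h, hD⟩ := distinguished_cocone_triangle T.mor₁
  obtain ⟨c', hc₁, hc₂⟩ : ∃ c' : C ⟶ T'.obj₃, g ≫ c' = r.i.hom₂ ≫ T'.mor₂ ∧
      h ≫ r.i.hom₁⟦(1 : ℤ)⟧' = c' ≫ T'.mor₃ :=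
    complete_distinguished_triangle_morphism _ _ hD hT' r.i.hom₁ r.i.hom₂ r.i.comm₁
  have exactC {W : K} (a : W ⟶ C) (ha : a ≫ h = 0) : ∃ b : W ⟶ T.obj₂, a = b ≫ g :=
    Triangle.coyoneda_exact₃ _ hD a ha
  have zero : T.mor₁ ≫ g = 0 := comp_distTriang_mor_zero₁₂ _ hD
  obtain ⟨b, hb⟩ : ∃ b : T.obj₃ ⟶ C, T.mor₃ = b ≫ h := Triangle.coyoneda_exact₁ _ hD T.mor₃ zero₃₁
  have hg : g ≫ c' ≫ r.r.hom₃ = T.mor₂ := by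
    rw [reassoc_of% hc₁, r.r.comm₂, reassoc_of% hr₂]
  have hh : (c' ≫ r.r.hom₃) ≫ T.mor₃ = h := by
    rw [assoc, ← r.r.comm₃, ← reassoc_of% hc₂, ← Functor.map_comp, hr₁,
      CategoryTheory.Functor.map_id, comp_id]
  obtain ⟨c, hc⟩ : ∃ c : C ⟶ T.obj₃, c = c' ≫ r.r.hom₃ := ⟨_, rfl⟩
  rw [← hc] at hg hh
  have hmono : Mono c := by
    refine Preadditive.mono_of_cancel_zero _ fun a ha => ?_
    obtain ⟨b, hb⟩ := exactC a (by rw [← hh, reassoc_of% ha, zero_comp])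
    obtain ⟨d, hd⟩ := exact₂ b (by rw [← hg, ← reassoc_of% hb, ha])
    rw [hb, hd, assoc, zero, comp_zero]
  obtain ⟨d, hd⟩ := exact₃ (𝟙 _ - b ≫ c) (by
    rw [Preadditive.sub_comp, assoc, hh, ← hb, id_comp, sub_self])
  have : IsSplitEpi c := ⟨⟨⟨b + d ≫ g, by
    rw [Preadditive.add_comp, assoc, hg, ← hd, add_sub_cancel]⟩⟩⟩
  have : IsIso c := isIso_of_mono_of_isSplitEpi c
  let e : C ≅ T.obj₃ := asIso c
  refine isomorphic_distinguished _ hD _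
    (Iso.symm (Triangle.isoMk _ _ (Iso.refl _) (Iso.refl _) e ?_ ?_ ?_))
  · exact (comp_id _).trans (id_comp _).symm
  · exact hg.trans (id_comp _).symm
  · change h ≫ (𝟙 T.obj₁)⟦(1 : ℤ)⟧' = c ≫ T.mor₃
    rw [CategoryTheory.Functor.map_id, comp_id, hh]

end RetractTriangle

/-! ### Balanced tensor products and shifts. -/

section Shift

variable {K : Type u} [Category.{v} K] [HasShift K ℤ] [MonoidalCategory K] [SymmetricCategory K]
  [TensorShift K] {A B : K} [MonObj A] [MonObj B] [IsCommMonObj B] {g : A ⟶ B} [IsMonHom g]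
  [SeparableMonObj A]

/-- The action on `Z ⊗ X` through `X` is compatible with the shift of `X`. -/
lemma balR_shift (Z : Mod K B) (X : Mod K A) (n : ℤ) :
    (α_ Z.X A (X.X⟦n⟧)).hom ≫ Z.X ◁ shiftAct X n ≫ (tensorShiftIso Z.X X.X n).hom =
      (tensorShiftIso (Z.X ⊗ A) X.X n).hom ≫ ((α_ Z.X A X.X).hom ≫ Z.X ◁ act X)⟦n⟧' := by
  rw [shiftAct, MonoidalCategory.whiskerLeft_comp, assoc, tensorShiftIso_naturality_right,
    reassoc_of% (tensorShiftIso_assoc Z.X A X.X n), Functor.map_comp]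

/-- The balanced tensor product commutes with the shift. -/
lemma IsBalanced.shift {Z W : Mod K B} {X : Mod K A} {π : Z.X ⊗ X.X ⟶ W.X}
    (h : IsBalanced g Z X W π) (n : ℤ) :
    IsBalanced g Z (X⟦n⟧) (W⟦n⟧) ((tensorShiftIso Z.X X.X n).hom ≫ π⟦n⟧') := by
  obtain ⟨s⟩ := h.split
  have hs := s.map (shiftFunctor K n)
  have hepi : Epi (π⟦n⟧') := IsSplitCoequalizer.epi hs
  have hepi' : Epi ((tensorShiftIso Z.X X.X n).hom ≫ π⟦n⟧') := inferInstance
  refine IsBalanced.mk' ?_ ?_ hepi' ?_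
  · change rightAct g Z ▷ X.X⟦n⟧ ≫ (tensorShiftIso Z.X X.X n).hom ≫ π⟦n⟧' =
      (α_ Z.X A (X.X⟦n⟧)).hom ≫ Z.X ◁ shiftAct X n ≫ (tensorShiftIso Z.X X.X n).hom ≫ π⟦n⟧'
    rw [reassoc_of% (balR_shift Z X n), ← assoc, tensorShiftIso_naturality_left, assoc,
      ← Functor.map_comp, ← Functor.map_comp, h.balanced, assoc]
  · change act Z ▷ X.X⟦n⟧ ≫ (tensorShiftIso Z.X X.X n).hom ≫ π⟦n⟧' =
      (α_ B Z.X (X.X⟦n⟧)).hom ≫ B ◁ ((tensorShiftIso Z.X X.X n).hom ≫ π⟦n⟧') ≫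
        (tensorShiftIso B W.X n).hom ≫ (act W)⟦n⟧'
    rw [← assoc, tensorShiftIso_naturality_left, assoc, ← Functor.map_comp, h.linear,
      MonoidalCategory.whiskerLeft_comp, assoc, ← assoc (B ◁ π⟦n⟧'),
      tensorShiftIso_naturality_right, assoc, reassoc_of% (tensorShiftIso_assoc B Z.X X.X n),
      Functor.map_comp, Functor.map_comp]
  · intro w f hf
    obtain ⟨k, hk⟩ : ∃ k : Z.X ⊗ X.X⟦n⟧ ⟶ w, k = f := ⟨_, rfl⟩
    have hf' : rightAct g Z ▷ X.X⟦n⟧ ≫ k = (α_ Z.X A (X.X⟦n⟧)).hom ≫ Z.X ◁ shiftAct X n ≫ k := by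
      rw [hk]; exact hf
    obtain ⟨φ, hφ⟩ := IsSplitCoequalizer.exists_desc hs ((tensorShiftIso Z.X X.X n).inv ≫ k) (by
      rw [← cancel_epi (tensorShiftIso (Z.X ⊗ A) X.X n).hom]
      change _ ≫ ((α_ Z.X A X.X).hom ≫ Z.X ◁ act X)⟦n⟧' ≫ _ = _ ≫ (rightAct g Z ▷ X.X)⟦n⟧' ≫ _
      rw [← reassoc_of% (balR_shift Z X n), ← assoc _ ((rightAct g Z ▷ X.X)⟦n⟧'),
        ← tensorShiftIso_naturality_left]
      simp only [assoc, Iso.hom_inv_id_assoc]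
      exact hf'.symm)
    refine ⟨φ, Eq.trans ?_ hk⟩
    change ((tensorShiftIso Z.X X.X n).hom ≫ π⟦n⟧') ≫ φ = k
    rw [assoc, hφ, Iso.hom_inv_id_assoc]

end Shift

/-! ### Exactness of `Z ⊗_A -`. -/

section Exactness

variable {K : Type u} [Category.{v} K] [Preadditive K] [HasZeroObject K]
  [HasShift K ℤ] [∀ n : ℤ, (shiftFunctor K n).Additive] [Pretriangulated K]
  [MonoidalCategory K] [SymmetricCategory K] [MonoidalPreadditive K] [IsIdempotentComplete K]
  [TensorTriangulated K] {A B : K} [MonObj A] [MonObj B] [IsCommMonObj A] [IsCommMonObj B]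
  [SeparableMonObj A] [SeparableMonObj B] {g : A ⟶ B} [IsMonHom g]

/-- The balanced tensor product is exact in the second variable. -/
theorem IsBalanced.exists_triangle {Z W₁ W₂ W₃ : Mod K B} (T : Triangle (Mod K A))
    (hT : T ∈ TTStruct.distinguished) {π₁ : Z.X ⊗ T.obj₁.X ⟶ W₁.X} {π₂ : Z.X ⊗ T.obj₂.X ⟶ W₂.X}
    {π₃ : Z.X ⊗ T.obj₃.X ⟶ W₃.X} (h₁ : IsBalanced g Z T.obj₁ W₁ π₁)
    (h₂ : IsBalanced g Z T.obj₂ W₂ π₂) (h₃ : IsBalanced g Z T.obj₃ W₃ π₃) :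
    ∃ (m₁ : W₁ ⟶ W₂) (m₂ : W₂ ⟶ W₃) (m₃ : W₃ ⟶ W₁⟦(1 : ℤ)⟧),
      Triangle.mk m₁ m₂ m₃ ∈ TTStruct.distinguished := by
  -- One `w`, independent of the module, serves for all three vertices. The induced sections of
  -- `π₁`, `π₂`, `π₃` therefore commute with the maps of the triangle, and `Z ⊗_A T` is a retract of
  -- the distinguished triangle `Z ⊗ T`.
  obtain ⟨w, hw⟩ := exists_section_bal g Z
  have hsec {X : Mod K A} {W : Mod K B} {π : Z.X ⊗ X.X ⟶ W.X} (h : IsBalanced g Z X W π) :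
      ∃ i : W.X ⟶ Z.X ⊗ X.X, π ≫ i = w ▷ X.X ≫ (α_ Z.X A X.X).hom ≫ Z.X ◁ act X ∧
        i ≫ π = 𝟙 _ := by
    have hb := (hw X).2
    simp only [balL, balR, assoc] at hb
    obtain ⟨i, hi⟩ := h.exists_lift (w ▷ X.X ≫ (α_ Z.X A X.X).hom ≫ Z.X ◁ act X) hb
    have := h.epi
    refine ⟨i, hi, ?_⟩
    rw [← cancel_epi π, reassoc_of% hi, ← h.balanced, comp_id]
    exact ((assoc _ _ _).symm.trans (congrArg (· ≫ π) (hw X).1)).trans (id_comp π)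
  obtain ⟨i₁, hi₁, hi₁'⟩ := hsec h₁
  obtain ⟨i₂, hi₂, hi₂'⟩ := hsec h₂
  obtain ⟨i₃, hi₃, hi₃'⟩ := hsec h₃
  obtain ⟨m₁, hm₁⟩ := h₁.exists_map h₂ (𝟙 Z) T.mor₁
  obtain ⟨m₂, hm₂⟩ := h₂.exists_map h₃ (𝟙 Z) T.mor₂
  obtain ⟨m₃, hm₃⟩ := h₃.exists_map (h₁.shift 1) (𝟙 Z) T.mor₃
  have := h₁.epi
  have := h₂.epi
  have := h₃.epi
  obtain ⟨f₃, hf₃⟩ : ∃ f₃ : T.obj₃.X ⟶ T.obj₁.X⟦(1 : ℤ)⟧, f₃ = T.mor₃.hom := ⟨_, rfl⟩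
  obtain ⟨n₃, hn₃⟩ : ∃ n₃ : W₃.X ⟶ W₁.X⟦(1 : ℤ)⟧, n₃ = m₃.hom := ⟨_, rfl⟩
  have lin₃ : act T.obj₃ ≫ f₃ = A ◁ f₃ ≫ shiftAct T.obj₁ 1 := by rw [hf₃]; exact lin T.mor₃
  have e₃ : π₃ ≫ n₃ = Z.X ◁ f₃ ≫ (tensorShiftIso Z.X T.obj₁.X 1).hom ≫ π₁⟦(1 : ℤ)⟧' := by
    rw [hn₃, hf₃]
    rw [Mod.id_hom', id_whiskerRight, id_comp] at hm₃
    exact hm₃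
  rw [Mod.id_hom', id_whiskerRight, id_comp] at hm₁ hm₂
  refine ⟨m₁, m₂, m₃, ?_⟩
  have hx := TensorTriangulated.exact Z.X
  have hT' : Triangle.mk (Z.X ◁ T.mor₁.hom) (Z.X ◁ T.mor₂.hom)
      (Z.X ◁ f₃ ≫ (tensorShiftIso Z.X T.obj₁.X 1).hom) ∈ distTriang K := by
    rw [hf₃]
    exact (tensorLeft Z.X).map_distinguished _ hT
  change Triangle.mk m₁.hom m₂.hom m₃.hom ∈ distTriang K
  rw [← hn₃]
  refine distinguished_of_retract (T' := Triangle.mk (Z.X ◁ T.mor₁.hom) (Z.X ◁ T.mor₂.hom)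
    (Z.X ◁ f₃ ≫ (tensorShiftIso Z.X T.obj₁.X 1).hom)) ⟨Triangle.homMk _ _ i₁ i₂ i₃ ?_ ?_ ?_,
      Triangle.homMk _ _ π₁ π₂ π₃ ?_ ?_ ?_, ?_⟩ hT'
  · change m₁.hom ≫ i₂ = i₁ ≫ Z.X ◁ T.mor₁.hom
    rw [← cancel_epi π₁, reassoc_of% hm₁, hi₂, reassoc_of% hi₁,
      ← MonoidalCategory.whiskerLeft_comp, lin, whisker_exchange_assoc]
    monoidal
  · change m₂.hom ≫ i₃ = i₂ ≫ Z.X ◁ T.mor₂.hom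
    rw [← cancel_epi π₂, reassoc_of% hm₂, hi₃, reassoc_of% hi₂,
      ← MonoidalCategory.whiskerLeft_comp, lin, whisker_exchange_assoc]
    monoidal
  · change n₃ ≫ i₁⟦(1 : ℤ)⟧' = i₃ ≫ Z.X ◁ f₃ ≫ (tensorShiftIso Z.X T.obj₁.X 1).hom
    rw [← cancel_epi π₃, reassoc_of% e₃, reassoc_of% hi₃, ← Functor.map_comp, hi₁,
      Functor.map_comp, ← assoc (tensorShiftIso _ _ _).hom, ← tensorShiftIso_naturality_left,
      assoc, ← balR_shift, ← MonoidalCategory.whiskerLeft_comp_assoc, lin₃,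
      whisker_exchange_assoc]
    monoidal
  · exact hm₁.symm
  · exact hm₂.symm
  · change (Z.X ◁ f₃ ≫ (tensorShiftIso Z.X T.obj₁.X 1).hom) ≫ π₁⟦(1 : ℤ)⟧' = π₃ ≫ n₃
    rw [assoc, e₃]
  · ext
    · exact hi₁'
    · exact hi₂'
    · exact hi₃'

end Exactness

/-! ### Modules over tt-rings as tensor-triangulated categories and separable extensions. -/

section TT

variable {K : Type u} [Category.{v} K] [Preadditive K] [HasZeroObject K]
  [HasShift K ℤ] [∀ n : ℤ, (shiftFunctor K n).Additive] [Pretriangulated K]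
  [MonoidalCategory K] [SymmetricCategory K] [MonoidalPreadditive K] [IsIdempotentComplete K]
  [TensorTriangulated K]

variable (K) in
lemma isTensorTriangulated : IsTensorTriangulated K where
  exists_zero := HasZeroObject.zero
  exact x :=
    { isZero := fun h => isZero_tensor h x
      shift := fun y n => ⟨tensorShiftIso x y n⟩
      triangle := fun T hT => by
        have := TensorTriangulated.exact x
        exact ⟨_, (tensorLeft x).map_distinguished T hT, ⟨Iso.refl _⟩, ⟨Iso.refl _⟩, ⟨Iso.refl _⟩⟩
      retract := fun r => ⟨r.map (tensorLeft x)⟩ }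
  assoc x y z := ⟨α_ x y z⟩
  comm x y := ⟨β_ x y⟩
  exists_unit := ⟨𝟙_ K, fun x => ⟨ρ_ x⟩⟩

/-- A zero module is isomorphic to `F_A(0)`, whose underlying object `A ⊗ 0` is zero. -/
lemma isZero_of_isZero_mod {A : K} [MonObj A] [IsCommMonObj A] [SeparableMonObj A] {X : Mod K A} (h : IsZero X) : IsZero X.X := by
  obtain ⟨z, hz⟩ := HasZeroObject.zero (C := K)
  exact hz.of_iso ((Mod.forget A).mapIso
    (h.iso (isZero_mod (X := (extend A).obj z) (isZero_tensor hz A)))|>.trans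
      ((isZero_tensor hz A).iso hz))

variable {A B : K} [MonObj A] [MonObj B] [IsCommMonObj A] [IsCommMonObj B]
  [SeparableMonObj A] [SeparableMonObj B] {g : A ⟶ B} [IsMonHom g]

lemma IsBalanced.isZero {Z W : Mod K B} {X : Mod K A} {π : Z.X ⊗ X.X ⟶ W.X}
    (h : IsBalanced g Z X W π) (hX : IsZero X) : IsZero W := by
  have := h.epi
  exact isZero_mod ((isZero_tensor (isZero_of_isZero_mod hX) Z.X).of_epi π)

/-- The functors `Z ⊗_A -` are exact. -/
lemma isExactMap_of_isBalanced (Z : Mod K B) (W : Mod K A → Mod K B)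
    (h : ∀ X, ∃ π, IsBalanced g Z X (W X) π) : IsExactMap W where
  isZero {X} hX := (h X).choose_spec.isZero hX
  shift X n := (h (X⟦n⟧)).choose_spec.nonempty_iso ((h X).choose_spec.shift n) (Iso.refl _)
    (Iso.refl _)
  triangle T hT := by
    obtain ⟨π₁, h₁⟩ := h T.obj₁
    obtain ⟨π₂, h₂⟩ := h T.obj₂
    obtain ⟨π₃, h₃⟩ := h T.obj₃
    obtain ⟨m₁, m₂, m₃, hm⟩ := IsBalanced.exists_triangle T hT h₁ h₂ h₃
    exact ⟨_, hm, ⟨Iso.refl _⟩, ⟨Iso.refl _⟩, ⟨Iso.refl _⟩⟩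
  retract {X Y} r := (h X).choose_spec.nonempty_retract (h Y).choose_spec (Retract.refl Z) r

variable (A) in
lemma isTensorTriangulated_mod : IsTensorTriangulated (Mod K A) where
  exists_zero := by
    obtain ⟨z, hz⟩ := HasZeroObject.zero (C := K)
    exact ⟨(extend A).obj z, isZero_mod (isZero_tensor hz A)⟩
  exact X := isExactMap_of_isBalanced (g := 𝟙 A) X _ fun Y => isBalanced_relTensor X Y
  assoc X Y Z := by
    obtain ⟨π₁, h₁⟩ := isBalanced_relTensor Y Z
    obtain ⟨π₂, h₂⟩ := isBalanced_relTensor X (relTensor Y Z)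
    obtain ⟨π₃, h₃⟩ := isBalanced_relTensor X Y
    obtain ⟨π₄, h₄⟩ := isBalanced_relTensor (relTensor X Y) Z
    obtain ⟨π, h⟩ := IsBalanced.assoc_iso (k := 𝟙 A) (comp_id _).symm h₁ h₂ h₃
    exact h₄.nonempty_iso h (Iso.refl _) (Iso.refl _)
  comm X Y := by
    obtain ⟨π₁, h₁⟩ := isBalanced_relTensor X Y
    obtain ⟨π₂, h₂⟩ := isBalanced_relTensor Y X
    exact h₁.nonempty_iso h₂.braiding (Iso.refl _) (Iso.refl _)
  exists_unit := ⟨_, relTensor_unit⟩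

variable (g) in
/-- Extension of scalars along a morphism of tt-rings. -/
noncomputable def baseChange (X : Mod K A) : Mod K B :=
  (exists_isBalanced g (Mod.regular B) X).choose

variable (g) in
lemma isBalanced_baseChange (X : Mod K A) :
    ∃ π, IsBalanced g (Mod.regular B) X (baseChange g X) π :=
  (exists_isBalanced g (Mod.regular B) X).choose_spec

lemma relTensor_regular (Z : Mod K B) : Nonempty (relTensor Z (Mod.regular B) ≅ Z) := by
  obtain ⟨π, h⟩ := isBalanced_relTensor Z (Mod.regular B)
  exact h.nonempty_iso (isBalanced_extend (𝟙 B) Z (𝟙_ K)) (Iso.refl _)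
    (modTensorUnitIso (Mod.regular B)).symm |>.map (· ≪≫ modTensorUnitIso Z)

/-- Associativity: `Z ⊗_B (B ⊗_A X) ≅ (Z ⊗_B B) ⊗_A X`, and `Z ⊗_B B ≅ Z`. -/
lemma relTensor_baseChange {Z W : Mod K B} {X : Mod K A} {π : Z.X ⊗ X.X ⟶ W.X}
    (h : IsBalanced g Z X W π) : Nonempty (relTensor Z (baseChange g X) ≅ W) := by
  obtain ⟨π₁, h₁⟩ := isBalanced_baseChange g X
  obtain ⟨π₂, h₂⟩ := isBalanced_relTensor Z (baseChange g X)
  obtain ⟨π₃, h₃⟩ := isBalanced_relTensor Z (Mod.regular B)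
  obtain ⟨e⟩ := relTensor_regular Z
  obtain ⟨π', h'⟩ := IsBalanced.assoc_iso (comp_id g).symm h₁ h₂ h₃
  exact h'.nonempty_iso h e (Iso.refl _)

variable (g) in
lemma isExactMap_restrict : IsExactMap (restrict g : Mod K B → Mod K A) where
  isZero {Z} h := isZero_mod (X := restrict g Z) (isZero_of_isZero_mod (X := Z) h)
  shift Z n := ⟨mkIso (X := restrict g (Z⟦n⟧)) (Y := (restrict g Z)⟦n⟧) (Iso.refl (Z.X⟦n⟧)) (by
    change (g ▷ (Z.X⟦n⟧) ≫ (tensorShiftIso B Z.X n).hom ≫ (act Z)⟦n⟧') ≫ 𝟙 _ =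
      A ◁ 𝟙 _ ≫ (tensorShiftIso A Z.X n).hom ≫ (g ▷ Z.X ≫ act Z)⟦n⟧'
    rw [comp_id, ← assoc, tensorShiftIso_naturality_left, MonoidalCategory.whiskerLeft_id, id_comp,
      Functor.map_comp, assoc])⟩
  triangle T hT := by
    obtain ⟨f, hf⟩ : ∃ f : T.obj₃.X ⟶ T.obj₁.X⟦(1 : ℤ)⟧, f = T.mor₃.hom := ⟨_, rfl⟩
    have h : act T.obj₃ ≫ f = B ◁ f ≫ shiftAct T.obj₁ 1 := by rw [hf]; exact lin T.mor₃
    have h' : (g ▷ T.obj₃.X ≫ act T.obj₃) ≫ f =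
        A ◁ f ≫ (tensorShiftIso A T.obj₁.X 1).hom ≫ (g ▷ T.obj₁.X ≫ act T.obj₁)⟦(1 : ℤ)⟧' := by
      rw [assoc, h, shiftAct, ← whisker_exchange_assoc, Functor.map_comp, ← assoc (g ▷ _),
        tensorShiftIso_naturality_left, assoc]
    refine ⟨Triangle.mk (X := restrict g T.obj₁) (Y := restrict g T.obj₂)
      (Z := restrict g T.obj₃) ((Mod.comap g).map T.mor₁) ((Mod.comap g).map T.mor₂)
      (mkLin (X := restrict g T.obj₃) (Y := (restrict g T.obj₁)⟦(1 : ℤ)⟧) f h'), ?_,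
      ⟨Iso.refl _⟩, ⟨Iso.refl _⟩, ⟨Iso.refl _⟩⟩
    change Triangle.mk T.mor₁.hom T.mor₂.hom f ∈ distTriang K
    rw [hf]
    exact hT
  retract r := ⟨r.map (Mod.comap g)⟩

variable (g) in
/-- Extension and restriction of scalars along a morphism of tt-rings. -/
noncomputable def modExtension : SeparableExtension (Mod K A) (Mod K B) where
  F := baseChange g
  U := restrict g
  exact_F := isExactMap_of_isBalanced (Mod.regular B) _ (isBalanced_baseChange g)
  exact_U := isExactMap_restrict g
  tensor X Y := by
    -- `B ⊗_A (X ⊗_A Y) ≅ (B ⊗_A X) ⊗_A Y ≅ (B ⊗_A X) ⊗_B (B ⊗_A Y)`.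
    obtain ⟨π₁, h₁⟩ := isBalanced_relTensor X Y
    obtain ⟨π₂, h₂⟩ := isBalanced_baseChange g (relTensor X Y)
    obtain ⟨π₃, h₃⟩ := isBalanced_baseChange g X
    obtain ⟨π, h⟩ := IsBalanced.assoc_iso (id_comp g).symm h₁ h₂ h₃
    obtain ⟨e⟩ := relTensor_baseChange h
    exact ⟨e.symm⟩
  proj X Z := by
    -- Both sides are `Z ⊗_A X`, computed over `B` on the left and over `A` on the right.
    obtain ⟨W, π, h⟩ := exists_isBalanced g Z X
    obtain ⟨e⟩ := (isTensorTriangulated_mod B).comm (baseChange g X) Z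
    obtain ⟨e'⟩ := relTensor_baseChange h
    obtain ⟨π', h'⟩ := isBalanced_relTensor X (restrict g Z)
    obtain ⟨e''⟩ := h.restrictScalars.nonempty_iso h'.braiding (Iso.refl _) (Iso.refl _)
    exact ⟨(Mod.comap g).mapIso (e ≪≫ e') ≪≫ e''⟩
  retract Z := by
    obtain ⟨π, h⟩ := isBalanced_baseChange g (restrict g Z)
    exact h.retract_restrict

variable (A) in
/-- Extension of scalars to a tt-ring. -/
noncomputable def extension : SeparableExtension K (Mod K A) where
  F := (extend A).obj
  U := Mod.X
  exact_F :=
    { isZero := fun h => isZero_mod (isZero_tensor h A)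
      shift := fun x n => ⟨extendShiftIso x n⟩
      triangle := fun T hT => ⟨_, extendTriangle_distinguished T hT, ⟨Iso.refl _⟩, ⟨Iso.refl _⟩,
        ⟨Iso.refl _⟩⟩
      retract := fun r => ⟨r.map (extend A)⟩ }
  exact_U :=
    { isZero := isZero_of_isZero_mod
      shift := fun X n => ⟨Iso.refl _⟩
      triangle := fun T hT => ⟨_, hT, ⟨Iso.refl _⟩, ⟨Iso.refl _⟩, ⟨Iso.refl _⟩⟩
      retract := fun r => ⟨r.map (Mod.forget A)⟩ }
  tensor x y := by
    obtain ⟨e⟩ := extend_tensor (A := A) x y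
    exact ⟨e.symm⟩
  proj x Z := by
    obtain ⟨e⟩ := (isTensorTriangulated_mod A).comm ((extend A).obj x) Z
    obtain ⟨e'⟩ := (relTensor_spec Z ((extend A).obj x)).nonempty_iso (isRelTensor_extend Z x)
    exact ⟨(Mod.forget A).mapIso (e ≪≫ e') ≪≫ β_ Z.X x⟩
  retract Z := by
    obtain ⟨t, ht⟩ := exists_section_act_mod Z
    refine ⟨⟨t, mkLin (X := (extend A).obj Z.X) (Y := Z) (act Z) ?_, ?_⟩⟩
    · change ((α_ A A Z.X).inv ≫ μ ▷ Z.X) ≫ act Z = A ◁ act Z ≫ act Z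
      rw [assoc, mul_act, Iso.inv_hom_id_assoc]
    · ext
      exact ht

end TT

/-! ### Algebras with `T ⊗_S T ≅ T × T'`. -/

section Splitting

variable {K : Type u} [Category.{v} K] [Preadditive K] [HasBinaryBiproducts K]
  [MonoidalCategory K] [SymmetricCategory K]
  {S T T' : K} [MonObj S] [MonObj T] [MonObj T']

/-- The ring homomorphism `T ⊗ T ⟶ T × T'` with components the multiplication and `ℓ · r`. -/
noncomputable def splittingMap (ℓ r : T ⟶ T') : T ⊗ T ⟶ T ⊞ T' :=
  biprod.lift μ ((ℓ ⊗ₘ r) ≫ μ)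

/-- The ring homomorphism `(μ, ℓ · r) : T ⊗ T ⟶ T × T'` exhibits `T × T'` as `T ⊗_S T`, for `T` an
algebra over `S` with structure map `f`. -/
structure IsSplitting (f : S ⟶ T) (ℓ r : T ⟶ T') : Prop where
  comm : f ≫ ℓ = f ≫ r
  splitEpi : Nonempty (SplitEpi (splittingMap ℓ r))
  -- Descent is required after tensoring with any `y`, in order to apply it to `T ⊗ T ⊗ Y` for a
  -- module `Y`.
  exists_desc {y w : K} (k : (T ⊗ T) ⊗ y ⟶ w)
    (hk : balancingLeft f ▷ y ≫ k = balancingRight f ▷ y ≫ k) : ∃ l, splittingMap ℓ r ▷ y ≫ l = k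

/-- Here `θ` reverses the three factors, `t ⊗ s ⊗ t' ↦ t' ⊗ s ⊗ t`. This makes splittings symmetric
in `ℓ` and `r`. -/
lemma balancing_braiding [IsCommMonObj T] (f : S ⟶ T) :
    ∃ θ : (T ⊗ S) ⊗ T ≅ (T ⊗ S) ⊗ T, balancingLeft f ≫ (β_ T T).hom = θ.hom ≫ balancingRight f ∧
      balancingRight f ≫ (β_ T T).hom = θ.hom ≫ balancingLeft f := by
  have e₁ : (β_ T S).hom ≫ f ▷ T ≫ μ = T ◁ f ≫ μ := by
    rw [← BraidedCategory.braiding_naturality_right_assoc, IsCommMonObj.mul_comm]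
  have e₂ : (β_ S T).hom ≫ T ◁ f ≫ μ = f ▷ T ≫ μ := by
    rw [← e₁, SymmetricCategory.symmetry_assoc]
  refine ⟨(β_ (T ⊗ S) T) ≪≫ whiskerLeftIso T (β_ T S) ≪≫ (α_ T S T).symm, ?_, ?_⟩
  · rw [balancingLeft, BraidedCategory.braiding_naturality_left, ← e₁, balancingRight]
    simp
  · rw [balancingLeft, balancingRight, assoc, BraidedCategory.braiding_naturality_right, ← e₂]
    simp only [Iso.trans_hom, whiskerLeftIso_hom, Iso.symm_hom, comp_whiskerRight, assoc,
      BraidedCategory.braiding_tensor_left_hom, BraidedCategory.braiding_tensor_right_hom]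
    have h := congrArg (fun q => (α_ T S T).hom ≫ q ≫ (α_ T S T).inv ≫ (T ◁ f ≫ μ) ▷ T)
      (BraidedCategory.yang_baxter T S T)
    simp only [assoc, Iso.hom_inv_id_assoc, comp_whiskerRight] at h ⊢
    exact h

variable {f : S ⟶ T} {ℓ r : T ⟶ T'}

lemma splittingMap_braiding [IsCommMonObj T] [IsCommMonObj T'] (ℓ r : T ⟶ T') :
    splittingMap r ℓ = (β_ T T).hom ≫ splittingMap ℓ r := by
  refine biprod.hom_ext _ _ ?_ ?_
  · simp [splittingMap]
  · simp only [splittingMap, biprod.lift_snd, assoc]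
    rw [← BraidedCategory.braiding_naturality_assoc, IsCommMonObj.mul_comm]

/-- Splittings are symmetric. -/
lemma IsSplitting.symm [IsCommMonObj T] [IsCommMonObj T'] (h : IsSplitting f ℓ r) :
    IsSplitting f r ℓ where
  comm := h.comm.symm
  splitEpi := by
    obtain ⟨s⟩ := h.splitEpi
    refine ⟨⟨s.section_ ≫ (β_ T T).inv, ?_⟩⟩
    exact (congrArg (_ ≫ ·) (splittingMap_braiding ℓ r)).trans
      (by rw [assoc, Iso.inv_hom_id_assoc, s.id])
  exists_desc {y w} k hk := by
    obtain ⟨θ, h₁, h₂⟩ := balancing_braiding f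
    obtain ⟨l, hl⟩ := h.exists_desc ((β_ T T).hom ▷ y ≫ k) (by
      rw [← comp_whiskerRight_assoc, ← comp_whiskerRight_assoc, h₁, h₂, comp_whiskerRight_assoc,
        comp_whiskerRight_assoc, hk])
    refine ⟨l, ?_⟩
    rw [splittingMap_braiding, comp_whiskerRight_assoc, hl, ← comp_whiskerRight_assoc,
      SymmetricCategory.symmetry, id_whiskerRight, id_comp]

/-- Splittings can be transported along isomorphisms of rings. -/
lemma IsSplitting.of_iso (h : IsSplitting f ℓ r) {B : K} [MonObj B] (e : T ≅ B) [IsMonHom e.hom] :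
    IsSplitting (f ≫ e.hom) (e.inv ≫ ℓ) (e.inv ≫ r) := by
  have hq : splittingMap (e.inv ≫ ℓ) (e.inv ≫ r) =
      (e.inv ⊗ₘ e.inv) ≫ splittingMap ℓ r ≫ biprod.map e.hom (𝟙 _) := by
    refine biprod.hom_ext _ _ ?_ ?_
    · simp only [splittingMap, biprod.lift_fst, assoc, biprod.map_fst, biprod.lift_fst_assoc]
      rw [IsMonHom.mul_hom, MonoidalCategory.tensorHom_comp_tensorHom_assoc]
      simp
    · simp [splittingMap]
  have hm : e.hom ▷ S ≫ B ◁ (f ≫ e.hom) ≫ μ = (T ◁ f ≫ μ) ≫ e.hom := by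
    rw [assoc, IsMonHom.mul_hom, MonoidalCategory.tensorHom_def,
      MonoidalCategory.whiskerLeft_comp_assoc, ← whisker_exchange_assoc,
      ← whisker_exchange_assoc, assoc, whisker_exchange_assoc]
  have hm' : S ◁ e.hom ≫ (f ≫ e.hom) ▷ B ≫ μ = (f ▷ T ≫ μ) ≫ e.hom := by
    rw [assoc, IsMonHom.mul_hom, MonoidalCategory.tensorHom_def', comp_whiskerRight_assoc,
      whisker_exchange_assoc, whisker_exchange_assoc, assoc, whisker_exchange_assoc]
  have hl : balancingLeft f ≫ (e.hom ⊗ₘ e.hom) =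
      (e.hom ▷ S ⊗ₘ e.hom) ≫ balancingLeft (f ≫ e.hom) := by
    rw [balancingLeft, balancingLeft, ← MonoidalCategory.tensorHom_id (T ◁ f ≫ μ),
      ← MonoidalCategory.tensorHom_id (B ◁ _ ≫ _), MonoidalCategory.tensorHom_comp_tensorHom,
      MonoidalCategory.tensorHom_comp_tensorHom, hm, id_comp, comp_id]
  have hr : balancingRight f ≫ (e.hom ⊗ₘ e.hom) =
      (e.hom ▷ S ⊗ₘ e.hom) ≫ balancingRight (f ≫ e.hom) := by
    have : (e.hom ▷ S ⊗ₘ e.hom) ≫ (α_ B S B).hom =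
        (α_ T S T).hom ≫ (e.hom ⊗ₘ (S ◁ e.hom)) := by
      rw [← MonoidalCategory.tensorHom_id, ← MonoidalCategory.id_tensorHom, associator_naturality]
    rw [balancingRight, balancingRight, reassoc_of% this,
      ← MonoidalCategory.id_tensorHom _ (f ▷ T ≫ μ),
      ← MonoidalCategory.id_tensorHom _ ((f ≫ e.hom) ▷ B ≫ μ), assoc, MonoidalCategory.tensorHom_comp_tensorHom,
      MonoidalCategory.tensorHom_comp_tensorHom, hm', id_comp, comp_id]
  refine ⟨by simp [h.comm], ?_, ?_⟩
  · obtain ⟨s⟩ := h.splitEpi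
    refine ⟨⟨biprod.map e.inv (𝟙 _) ≫ s.section_ ≫ (e.hom ⊗ₘ e.hom), ?_⟩⟩
    refine (congrArg (_ ≫ ·) hq).trans ?_
    simp only [assoc, MonoidalCategory.tensorHom_comp_tensorHom_assoc, Iso.hom_inv_id,
      MonoidalCategory.id_tensorHom_id, id_comp]
    rw [s.id_assoc]
    ext <;> simp
  · intro y w k hk
    obtain ⟨l, hl⟩ := h.exists_desc ((e.hom ⊗ₘ e.hom) ▷ y ≫ k) (by
      rw [← comp_whiskerRight_assoc, ← comp_whiskerRight_assoc, hl, hr, comp_whiskerRight_assoc,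
        comp_whiskerRight_assoc, hk])
    refine ⟨(biprod.map e.inv (𝟙 _)) ▷ y ≫ l, ?_⟩
    have e₁ : biprod.map e.hom (𝟙 T') ≫ biprod.map e.inv (𝟙 T') = 𝟙 _ := by ext <;> simp
    rw [hq, ← comp_whiskerRight_assoc, assoc, assoc, e₁, comp_id, comp_whiskerRight_assoc, hl,
      ← comp_whiskerRight_assoc, MonoidalCategory.tensorHom_comp_tensorHom]
    simp

lemma rightAct_regular [IsCommMonObj T] [IsMonHom f] :
    rightAct f (Mod.regular T) = T ◁ f ≫ μ := by
  change T ◁ f ≫ (β_ T T).hom ≫ μ = _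
  rw [IsCommMonObj.mul_comm]

end Splitting

/-! ### `T ⊗_S Y` as a summand of `Y × (T' ⊗_T Y)`. -/

section Retraction

variable {K : Type u} [Category.{v} K] [Preadditive K] [HasBinaryBiproducts K]
  [MonoidalCategory K] [SymmetricCategory K] [MonoidalPreadditive K]
  {S T T' : K} [MonObj S] [MonObj T] [MonObj T'] {f : S ⟶ T} {ℓ r : T ⟶ T'}

/-- The left action of `T` on `T × T'`. -/
noncomputable def prodActLeft (ℓ : T ⟶ T') : T ⊗ (T ⊞ T') ⟶ T ⊞ T' :=
  biprod.lift (T ◁ biprod.fst ≫ μ) (T ◁ biprod.snd ≫ ℓ ▷ T' ≫ μ)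

/-- The right action of `T` on `T × T'`. -/
noncomputable def prodActRight (r : T ⟶ T') : (T ⊞ T') ⊗ T ⟶ T ⊞ T' :=
  biprod.lift (biprod.fst ▷ T ≫ μ) (biprod.snd ▷ T ≫ T' ◁ r ≫ μ)

lemma splittingMap_left [IsMonHom ℓ] :
    T ◁ splittingMap ℓ r ≫ prodActLeft ℓ = (α_ T T T).inv ≫ μ ▷ T ≫ splittingMap ℓ r := by
  refine biprod.hom_ext _ _ ?_ ?_
  · simp only [splittingMap, prodActLeft, assoc, biprod.lift_fst]
    rw [← MonoidalCategory.whiskerLeft_comp_assoc, biprod.lift_fst, MonObj.mul_assoc,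
      Iso.inv_hom_id_assoc]
  · simp only [splittingMap, prodActLeft, assoc, biprod.lift_snd]
    rw [← MonoidalCategory.whiskerLeft_comp_assoc, biprod.lift_snd, whisker_exchange_assoc,
      MonoidalCategory.tensorHom_def, assoc, ← comp_whiskerRight_assoc μ, IsMonHom.mul_hom,
      MonoidalCategory.tensorHom_def, comp_whiskerRight, assoc,
      ← whisker_exchange_assoc (μ : T' ⊗ T' ⟶ T') r, MonObj.mul_assoc]
    monoidal

lemma splittingMap_right [IsMonHom r] :
    splittingMap ℓ r ▷ T ≫ prodActRight r = (α_ T T T).hom ≫ T ◁ μ ≫ splittingMap ℓ r := by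
  refine biprod.hom_ext _ _ ?_ ?_
  · simp only [splittingMap, prodActRight, assoc, biprod.lift_fst]
    rw [← comp_whiskerRight_assoc, biprod.lift_fst, MonObj.mul_assoc]
  · simp only [splittingMap, prodActRight, assoc, biprod.lift_snd]
    rw [← comp_whiskerRight_assoc, biprod.lift_snd, MonoidalCategory.tensorHom_def, comp_whiskerRight,
      assoc, assoc, ← whisker_exchange_assoc (μ : T' ⊗ T' ⟶ T') r, MonObj.mul_assoc,
      whisker_exchange_assoc ℓ μ, ← MonoidalCategory.whiskerLeft_comp_assoc T' μ, IsMonHom.mul_hom,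
      MonoidalCategory.tensorHom_def]
    monoidal

lemma inl_prodActLeft : T ◁ biprod.inl ≫ prodActLeft ℓ = μ ≫ biprod.inl := by
  refine biprod.hom_ext _ _ ?_ ?_ <;>
    simp [prodActLeft, ← MonoidalCategory.whiskerLeft_comp_assoc]

lemma inr_prodActLeft : T ◁ biprod.inr ≫ prodActLeft ℓ = ℓ ▷ T' ≫ μ ≫ biprod.inr := by
  refine biprod.hom_ext _ _ ?_ ?_ <;>
    simp [prodActLeft, ← MonoidalCategory.whiskerLeft_comp_assoc]

lemma inl_prodActRight : biprod.inl ▷ T ≫ prodActRight r = μ ≫ biprod.inl := by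
  refine biprod.hom_ext _ _ ?_ ?_ <;>
    simp [prodActRight, ← comp_whiskerRight_assoc]

lemma inr_prodActRight : biprod.inr ▷ T ≫ prodActRight r = T' ◁ r ≫ μ ≫ biprod.inr := by
  refine biprod.hom_ext _ _ ?_ ?_ <;>
    simp [prodActRight, ← comp_whiskerRight_assoc]

/-- As `r` is unital, `t ⊗ 1` has image `(t, ℓ(t))` in `T × T'`. -/
lemma inl_add_inr [IsMonHom r] :
    biprod.inl + ℓ ≫ biprod.inr = (ρ_ T).inv ≫ T ◁ η ≫ splittingMap ℓ r := by
  refine biprod.hom_ext _ _ ?_ ?_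
  · simp [splittingMap]
  · have : (ρ_ T).inv ≫ T ◁ η ≫ (ℓ ⊗ₘ r) ≫ μ = ℓ := by
      rw [MonoidalCategory.tensorHom_def', assoc, ← MonoidalCategory.whiskerLeft_comp_assoc,
        IsMonHom.one_hom, whisker_exchange_assoc, MonObj.mul_one]
      simp
    simp [splittingMap, this]

variable [IsCommMonObj T] [IsCommMonObj T'] [IsMonHom f] [IsMonHom ℓ] [IsMonHom r]

/-- If `T ⊗_S T ≅ T × T'`, then `T ⊗_S Y` is a direct summand of (in fact, isomorphic to)
`Y × (T' ⊗_T Y)`. -/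
theorem IsSplitting.exists_retraction (h : IsSplitting f ℓ r) {Y M : Mod K T} {V : Mod K T'}
    {π : (Mod.regular T).X ⊗ (restrict f Y).X ⟶ M.X} {κ : (Mod.regular T').X ⊗ Y.X ⟶ V.X}
    (hπ : IsBalanced f (Mod.regular T) (restrict f Y) M π)
    (hκ : IsBalanced r (Mod.regular T') Y V κ) :
    ∃ (i₁ : M ⟶ Y) (i₂ : M ⟶ restrict ℓ V) (r₁ : Y ⟶ M) (r₂ : restrict ℓ V ⟶ M),
      i₁.hom ≫ r₁.hom + i₂.hom ≫ r₂.hom = 𝟙 M.X := by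
  obtain ⟨p, hp⟩ : ∃ p : T ⊗ Y.X ⟶ M.X, p = π := ⟨_, rfl⟩
  obtain ⟨k, hk⟩ : ∃ k : T' ⊗ Y.X ⟶ V.X, k = κ := ⟨_, rfl⟩
  have hpe : Epi p := hp ▸ hπ.epi
  have hke : Epi (T ◁ k) := hk ▸ hκ.epi_whiskerLeft T
  have hpl : μ ▷ Y.X ≫ p = (α_ T T Y.X).hom ≫ T ◁ p ≫ act M := by rw [hp]; exact hπ.linear
  have hkl : μ ▷ Y.X ≫ k = (α_ T' T' Y.X).hom ≫ T' ◁ k ≫ act V := by rw [hk]; exact hκ.linear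
  have hpb : (T ◁ f ≫ μ) ▷ Y.X ≫ p = (α_ T S Y.X).hom ≫ T ◁ (f ▷ Y.X ≫ act Y) ≫ p := by
    rw [hp, ← rightAct_regular]; exact hπ.balanced
  have hkb : (T' ◁ r ≫ μ) ▷ Y.X ≫ k = (α_ T' T Y.X).hom ≫ T' ◁ act Y ≫ k := by
    rw [hk, ← rightAct_regular]; exact hκ.balanced
  obtain ⟨s⟩ := h.splitEpi
  have hq₁ : Epi ((T ◁ splittingMap ℓ r) ▷ Y.X) :=
    ((s.map (tensorLeft T)).map (tensorRight Y.X)).epi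
  have hq₂ : Epi (splittingMap ℓ r ▷ T ▷ Y.X) :=
    ((s.map (tensorRight T)).map (tensorRight Y.X)).epi
  have hμ : T ◁ act Y ≫ act Y = (α_ T T Y.X).inv ≫ μ ▷ Y.X ≫ act Y := by
    rw [mul_act, Iso.inv_hom_id_assoc]
  -- The map `t ⊗ t' ⊗ y ↦ t ⊗ t' y` into `T ⊗_S Y` descends to `Φ` on `(T × T') ⊗ Y`. It is linear
  -- for the left action through `ℓ` and balanced for the right action through `r` (`hL`, `hR`); the
  -- retractions are its restrictions to the two factors.
  obtain ⟨Φ, hΦ⟩ := h.exists_desc ((α_ T T Y.X).hom ≫ T ◁ act Y ≫ p) (by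
    rw [balancingLeft, balancingRight, associator_naturality_left_assoc, ← whisker_exchange_assoc,
      hpb, associator_naturality_right_assoc, ← MonoidalCategory.whiskerLeft_comp_assoc T,
      whisker_exchange_assoc, hμ]
    monoidal)
  have hL : prodActLeft ℓ ▷ Y.X ≫ Φ = (α_ T (T ⊞ T') Y.X).hom ≫ T ◁ Φ ≫ act M := by
    rw [← cancel_epi ((T ◁ splittingMap ℓ r) ▷ Y.X), ← comp_whiskerRight_assoc, splittingMap_left,
      associator_naturality_middle_assoc, ← MonoidalCategory.whiskerLeft_comp_assoc, hΦ,
      comp_whiskerRight_assoc, comp_whiskerRight_assoc, hΦ, associator_naturality_left_assoc,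
      ← whisker_exchange_assoc, hpl]
    monoidal
  have hR : prodActRight r ▷ Y.X ≫ Φ = (α_ (T ⊞ T') T Y.X).hom ≫ (T ⊞ T') ◁ act Y ≫ Φ := by
    rw [← cancel_epi (splittingMap ℓ r ▷ T ▷ Y.X), ← comp_whiskerRight_assoc, splittingMap_right,
      associator_naturality_left_assoc, ← whisker_exchange_assoc, hΦ, comp_whiskerRight_assoc,
      comp_whiskerRight_assoc, hΦ, associator_naturality_right_assoc,
      ← MonoidalCategory.whiskerLeft_comp_assoc _ (T ◁ act Y), hμ]
    monoidal
  have hL₀ {x : K} (i : x ⟶ T ⊞ T') : T ◁ (i ▷ Y.X ≫ Φ) ≫ act M =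
      (α_ T x Y.X).inv ≫ (T ◁ i ≫ prodActLeft ℓ) ▷ Y.X ≫ Φ := by
    rw [comp_whiskerRight_assoc, hL]
    monoidal
  have hR₀ {x : K} (i : x ⟶ T ⊞ T') : x ◁ act Y ≫ i ▷ Y.X ≫ Φ =
      (α_ x T Y.X).inv ≫ (i ▷ T ≫ prodActRight r) ▷ Y.X ≫ Φ := by
    rw [comp_whiskerRight_assoc, hR, whisker_exchange_assoc]
    monoidal
  have hL₁ := hL₀ biprod.inl
  have hL₂ := hL₀ biprod.inr
  have hR₁ := hR₀ biprod.inl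
  have hR₂ := hR₀ biprod.inr
  rw [inl_prodActLeft] at hL₁
  rw [inr_prodActLeft] at hL₂
  rw [inl_prodActRight] at hR₁
  rw [inr_prodActRight] at hR₂
  -- For `r₁(y) = Φ((1,0) ⊗ y)`, balancing gives `r₁(t y) = Φ((t,0) ⊗ y)`.
  replace hR₁ : act Y ≫ (λ_ Y.X).inv ≫ η ▷ Y.X ≫ biprod.inl ▷ Y.X ≫ Φ =
      biprod.inl ▷ Y.X ≫ Φ := by
    rw [leftUnitor_inv_naturality_assoc, whisker_exchange_assoc, hR₁,
      associator_inv_naturality_left_assoc, ← comp_whiskerRight_assoc,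
      MonObj.one_mul_assoc]
    monoidal
  obtain ⟨r₂, hr₂⟩ := hκ.exists_lift (biprod.inr ▷ Y.X ≫ Φ) (by
    rw [rightAct_regular]
    change _ = (α_ T' T Y.X).hom ≫ T' ◁ act Y ≫ biprod.inr ▷ Y.X ≫ Φ
    rw [hR₂]
    monoidal)
  -- The inclusions are `t ⊗ y ↦ t y` for `i₁` and `t ⊗ y ↦ ℓ(t) ⊗ y` for `i₂`. The latter is
  -- balanced over `S` because `f ≫ ℓ = f ≫ r`.
  obtain ⟨i₁, hi₁⟩ := hπ.exists_desc (V := Y) (act Y) (by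
    rw [rightAct_regular]
    change (T ◁ f ≫ μ) ▷ Y.X ≫ act Y = (α_ T S Y.X).hom ≫ T ◁ (f ▷ Y.X ≫ act Y) ≫ act Y
    rw [comp_whiskerRight, assoc, mul_act]
    monoidal) (mul_act Y)
  obtain ⟨i₂, hi₂⟩ := hπ.exists_desc (V := restrict ℓ V) (ℓ ▷ Y.X ≫ k) (by
    rw [rightAct_regular]
    change (T ◁ f ≫ μ) ▷ Y.X ≫ ℓ ▷ Y.X ≫ k =
      (α_ T S Y.X).hom ≫ T ◁ (f ▷ Y.X ≫ act Y) ≫ ℓ ▷ Y.X ≫ k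
    have e : (T ◁ f ≫ μ) ≫ ℓ = ℓ ▷ S ≫ T' ◁ f ≫ T' ◁ r ≫ μ := by
      rw [assoc, IsMonHom.mul_hom, MonoidalCategory.tensorHom_def', assoc,
        ← MonoidalCategory.whiskerLeft_comp_assoc, h.comm, whisker_exchange_assoc,
        MonoidalCategory.whiskerLeft_comp_assoc]
    rw [← comp_whiskerRight_assoc, e, whisker_exchange_assoc, comp_whiskerRight,
      comp_whiskerRight, assoc, assoc, hkb]
    monoidal) (by
    change μ ▷ Y.X ≫ ℓ ▷ Y.X ≫ k =
      (α_ T T Y.X).hom ≫ T ◁ (ℓ ▷ Y.X ≫ k) ≫ ℓ ▷ V.X ≫ act V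
    rw [← comp_whiskerRight_assoc, IsMonHom.mul_hom, MonoidalCategory.tensorHom_def',
      comp_whiskerRight, comp_whiskerRight, assoc, assoc, hkl, MonoidalCategory.whiskerLeft_comp,
      assoc, whisker_exchange_assoc]
    monoidal)
  have hi₁' : p ≫ i₁.hom = act Y := hp ▸ hi₁
  have hi₂' : p ≫ i₂.hom = ℓ ▷ Y.X ≫ k := hp ▸ hi₂
  have hr₂' : k ≫ r₂ = biprod.inr ▷ Y.X ≫ Φ := hk ▸ hr₂
  refine ⟨i₁, i₂, mkLin ((λ_ Y.X).inv ≫ η ▷ Y.X ≫ biprod.inl ▷ Y.X ≫ Φ) ?_,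
    mkLin (X := restrict ℓ V) (Y := M) r₂ ?_, ?_⟩
  · rw [hR₁, MonoidalCategory.whiskerLeft_comp, MonoidalCategory.whiskerLeft_comp, assoc, assoc,
      hL₁, associator_inv_naturality_middle_assoc, ← comp_whiskerRight_assoc, MonObj.mul_one_assoc]
    monoidal
  · change (ℓ ▷ V.X ≫ act V) ≫ r₂ = T ◁ r₂ ≫ act M
    have e : T' ◁ k ≫ act V = (α_ T' T' Y.X).inv ≫ μ ▷ Y.X ≫ k := by
      rw [hkl, Iso.inv_hom_id_assoc]
    rw [← cancel_epi (T ◁ k), ← MonoidalCategory.whiskerLeft_comp_assoc, hr₂', hL₂, assoc,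
      whisker_exchange_assoc, reassoc_of% e, hr₂']
    monoidal
  · change i₁.hom ≫ (λ_ Y.X).inv ≫ η ▷ Y.X ≫ biprod.inl ▷ Y.X ≫ Φ + i₂.hom ≫ r₂ = 𝟙 M.X
    -- On `t ⊗ y` the sum is `Φ((t, ℓ(t)) ⊗ y)`; since `(t, ℓ(t))` is the image of `t ⊗ 1`, this is
    -- `t ⊗ y`.
    rw [← cancel_epi p, Preadditive.comp_add, reassoc_of% hi₁', reassoc_of% hi₂', hR₁, hr₂',
      ← comp_whiskerRight_assoc, ← Preadditive.add_comp, ← MonoidalPreadditive.add_whiskerRight,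
      inl_add_inr (r := r), comp_whiskerRight, comp_whiskerRight, assoc, assoc, hΦ, comp_id,
      associator_naturality_middle_assoc]
    have e : T ◁ η ▷ Y.X ≫ T ◁ act Y = T ◁ (λ_ Y.X).hom := by
      rw [← MonoidalCategory.whiskerLeft_comp, one_act]
    rw [reassoc_of% e]
    monoidal

end Retraction

/-! ### Direct sums of modules. -/

section Biproduct

variable {K : Type u} [Category.{v} K] [Preadditive K] [HasBinaryBiproducts K]
  [MonoidalCategory K] [MonoidalPreadditive K] {A : K} [MonObj A]

/-- The direct sum of two modules. -/
noncomputable def modBiprod (X Y : Mod K A) : Mod K A where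
  X := X.X ⊞ Y.X
  mod :=
    { smul := biprod.lift (A ◁ biprod.fst ≫ act X) (A ◁ biprod.snd ≫ act Y)
      one_smul := by
        change η ▷ (X.X ⊞ Y.X) ≫ biprod.lift (A ◁ biprod.fst ≫ act X) (A ◁ biprod.snd ≫ act Y) =
          (λ_ _).hom
        refine biprod.hom_ext _ _ ?_ ?_
        · rw [assoc, biprod.lift_fst, ← whisker_exchange_assoc, one_act, leftUnitor_naturality]
        · rw [assoc, biprod.lift_snd, ← whisker_exchange_assoc, one_act, leftUnitor_naturality]
      mul_smul := by
        change μ ▷ (X.X ⊞ Y.X) ≫ biprod.lift (A ◁ biprod.fst ≫ act X) (A ◁ biprod.snd ≫ act Y) =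
          (α_ A A _).hom ≫ A ◁ biprod.lift (A ◁ biprod.fst ≫ act X) (A ◁ biprod.snd ≫ act Y) ≫
            biprod.lift (A ◁ biprod.fst ≫ act X) (A ◁ biprod.snd ≫ act Y)
        refine biprod.hom_ext _ _ ?_ ?_
        · simp only [assoc, biprod.lift_fst]
          rw [← whisker_exchange_assoc, mul_act, ← MonoidalCategory.whiskerLeft_comp_assoc,
            biprod.lift_fst]
          monoidal
        · simp only [assoc, biprod.lift_snd]
          rw [← whisker_exchange_assoc, mul_act, ← MonoidalCategory.whiskerLeft_comp_assoc,
            biprod.lift_snd]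
          monoidal }

/-- The first inclusion into a direct sum of modules. -/
noncomputable def modInl (X Y : Mod K A) : X ⟶ modBiprod X Y :=
  mkLin (X := X) (Y := modBiprod X Y) biprod.inl (by
    change act X ≫ biprod.inl = A ◁ biprod.inl ≫
      biprod.lift (A ◁ biprod.fst ≫ act X) (A ◁ biprod.snd ≫ act Y)
    refine biprod.hom_ext _ _ ?_ ?_ <;> simp [← MonoidalCategory.whiskerLeft_comp_assoc])

/-- The second projection from a direct sum of modules. -/
noncomputable def modSnd (X Y : Mod K A) : modBiprod X Y ⟶ Y :=
  mkLin (X := modBiprod X Y) (Y := Y) biprod.snd (by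
    change biprod.lift (A ◁ biprod.fst ≫ act X) (A ◁ biprod.snd ≫ act Y) ≫ biprod.snd =
      A ◁ biprod.snd ≫ act Y
    exact biprod.lift_snd _ _)

lemma nonempty_retract_modBiprod {M X Y : Mod K A} (i₁ : M ⟶ X) (i₂ : M ⟶ Y) (r₁ : X ⟶ M)
    (r₂ : Y ⟶ M) (h : i₁.hom ≫ r₁.hom + i₂.hom ≫ r₂.hom = 𝟙 M.X) :
    Nonempty (Retract M (modBiprod X Y)) := by
  refine ⟨mkLin (X := M) (Y := modBiprod X Y) (biprod.lift i₁.hom i₂.hom) ?_,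
    mkLin (X := modBiprod X Y) (Y := M) (biprod.desc r₁.hom r₂.hom) ?_, ?_⟩
  · change act M ≫ biprod.lift i₁.hom i₂.hom = A ◁ biprod.lift i₁.hom i₂.hom ≫
      biprod.lift (A ◁ biprod.fst ≫ act X) (A ◁ biprod.snd ≫ act Y)
    refine biprod.hom_ext _ _ ?_ ?_
    · simp [← MonoidalCategory.whiskerLeft_comp_assoc]
    · simp [← MonoidalCategory.whiskerLeft_comp_assoc]
  · change biprod.lift (A ◁ biprod.fst ≫ act X) (A ◁ biprod.snd ≫ act Y) ≫
      biprod.desc r₁.hom r₂.hom = A ◁ biprod.desc r₁.hom r₂.hom ≫ act M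
    rw [biprod.lift_desc, assoc, assoc, lin, lin, ← MonoidalCategory.whiskerLeft_comp_assoc,
      ← MonoidalCategory.whiskerLeft_comp_assoc, ← Preadditive.add_comp,
      ← MonoidalPreadditive.whiskerLeft_add, biprod.desc_eq]
  · ext
    exact (biprod.lift_desc ..).trans h

end Biproduct

/-! ### The inductive step for modules. -/

section Step

variable {K : Type u} [Category.{v} K] [Preadditive K] [HasZeroObject K]
  [HasShift K ℤ] [∀ n : ℤ, (shiftFunctor K n).Additive] [Pretriangulated K]
  [MonoidalCategory K] [SymmetricCategory K] [MonoidalPreadditive K] [IsIdempotentComplete K]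
  [TensorTriangulated K]

/-- `M` is a summand of `X ⊕ Y`, which is the middle term of a split triangle on `X` and `Y`. -/
lemma IsThickTensorIdeal.of_retraction {A : K} [MonObj A] [IsCommMonObj A] [SeparableMonObj A]
    {P : ObjectProperty (Mod K A)} (hP : IsThickTensorIdeal P) {M X Y : Mod K A} (i₁ : M ⟶ X)
    (i₂ : M ⟶ Y) (r₁ : X ⟶ M) (r₂ : Y ⟶ M)
    (h : i₁.hom ≫ r₁.hom + i₂.hom ≫ r₂.hom = 𝟙 M.X) (hX : P X) (hY : P Y) : P M := by
  obtain ⟨r⟩ := nonempty_retract_modBiprod i₁ i₂ r₁ r₂ h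
  have h0 : act Y ≫ (0 : Y.X ⟶ X.X⟦(1 : ℤ)⟧) = A ◁ 0 ≫ shiftAct X 1 := by simp
  refine hP.of_retract r (hP.obj₂ (Triangle.mk (modInl X Y) (modSnd X Y)
    (mkLin (X := Y) (Y := X⟦(1 : ℤ)⟧) (0 : Y.X ⟶ X.X⟦(1 : ℤ)⟧) h0)) ?_ hX hY)
  exact binaryBiproductTriangle_distinguished X.X Y.X

variable {A B C : K} [MonObj A] [MonObj B] [MonObj C] [IsCommMonObj A] [IsCommMonObj B]
  [IsCommMonObj C] [SeparableMonObj A] [SeparableMonObj B] [SeparableMonObj C]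

lemma baseChange_extend (g : A ⟶ B) [IsMonHom g] (x : K) :
    Nonempty (baseChange g ((extend A).obj x) ≅ (extend B).obj x) := by
  obtain ⟨π, h⟩ := isBalanced_baseChange g ((extend A).obj x)
  exact h.nonempty_iso (isBalanced_extend g (Mod.regular B) x) (Iso.refl _) (Iso.refl _)

lemma baseChange_baseChange (g : A ⟶ B) [IsMonHom g] (h : B ⟶ C) [IsMonHom h] (k : A ⟶ C)
    [IsMonHom k] (hk : k = g ≫ h) (X : Mod K A) :
    Nonempty (baseChange h (baseChange g X) ≅ baseChange k X) := by
  obtain ⟨π₁, h₁⟩ := isBalanced_baseChange g X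
  obtain ⟨π₂, h₂⟩ := isBalanced_baseChange h (baseChange g X)
  obtain ⟨π₃, h₃⟩ := isBalanced_baseChange h (Mod.regular B)
  obtain ⟨π, h₄⟩ := IsBalanced.assoc_iso hk h₁ h₂ h₃
  obtain ⟨π', h'⟩ := isBalanced_baseChange k X
  obtain ⟨e⟩ := h₃.nonempty_iso (isBalanced_extend h (Mod.regular C) (𝟙_ K)) (Iso.refl _)
    (modTensorUnitIso (Mod.regular B)).symm
  exact h₄.nonempty_iso h' (e ≪≫ modTensorUnitIso (Mod.regular C)) (Iso.refl _)

namespace IsSplitting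

section

variable {S T T' : K} [MonObj S] [MonObj T] [MonObj T'] [IsCommMonObj T] [IsCommMonObj T']
  [SeparableMonObj T] [SeparableMonObj T'] {f : S ⟶ T} {ℓ r : T ⟶ T'} [IsMonHom f] [IsMonHom ℓ]
  [IsMonHom r]

lemma mem_of_isBalanced (h : IsSplitting f ℓ r) {P : ObjectProperty (Mod K T)}
    (hP : IsThickTensorIdeal P) {Y M : Mod K T} {π : (Mod.regular T).X ⊗ (restrict f Y).X ⟶ M.X}
    (hπ : IsBalanced f (Mod.regular T) (restrict f Y) M π) (hY : P Y)
    (hY' : P ((modExtension ℓ).U ((modExtension r).F Y))) : P M := by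
  obtain ⟨κ, hκ⟩ := isBalanced_baseChange r Y
  obtain ⟨i₁, i₂, r₁, r₂, hr⟩ := h.exists_retraction hπ hκ
  exact hP.of_retraction i₁ i₂ r₁ r₂ hr hY hY'

/-- The two composite maps of spectra agree because `f ≫ r = f ≫ ℓ`. -/
lemma step (h : IsSplitting f ℓ r) [IsCommMonObj S] [SeparableMonObj S] {n : ℕ}
    (hinc : (modExtension r).Incomparable (isTensorTriangulated_mod T))
    (hn : (modExtension r).FiberBound (isTensorTriangulated_mod T) n) :
    (modExtension f).Incomparable (isTensorTriangulated_mod S) ∧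
      (modExtension f).FiberBound (isTensorTriangulated_mod S) (n + 1) := by
  have hM (P : ObjectProperty (Mod K T)) (hP : IsThickTensorIdeal P) (Y : Mod K T) (hY : P Y)
      (hY' : P ((modExtension ℓ).U ((modExtension r).F Y))) :
      P ((modExtension f).F ((modExtension f).U Y)) :=
    h.mem_of_isBalanced hP (isBalanced_baseChange f (restrict f Y)).choose_spec hY hY'
  have hcomm (R : Spc (Mod K T')) : (modExtension f).pull (isTensorTriangulated_mod S)
      ((modExtension r).pull (isTensorTriangulated_mod T) R) =
      (modExtension f).pull (isTensorTriangulated_mod S)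
        ((modExtension ℓ).pull (isTensorTriangulated_mod T) R) := by
    refine Spc.ext (funext fun x => propext ?_)
    obtain ⟨e₁⟩ := baseChange_baseChange f r (f ≫ r) rfl x
    obtain ⟨e₂⟩ := baseChange_baseChange f ℓ (f ≫ r) h.comm.symm x
    exact ⟨R.isPrime.of_iso (e₁ ≪≫ e₂.symm), R.isPrime.of_iso (e₂ ≪≫ e₁.symm)⟩
  exact ⟨hinc.step _ _ (isTensorTriangulated_mod T') hM hcomm,
    hn.step _ _ (isTensorTriangulated_mod T') hM hcomm hinc⟩

/-- The bottom of the tower, where the base is `K` itself instead of modules over `S ≅ 𝟙`. There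
both balancing maps coincide, so that `T ⊗_S Y` is `T ⊗ Y`, with the identity as quotient map. -/
lemma step_extension (h : IsSplitting f ℓ r) {e : S ≅ 𝟙_ K} (he : f = e.hom ≫ η) {n : ℕ}
    (hinc : (modExtension r).Incomparable (isTensorTriangulated_mod T))
    (hn : (modExtension r).FiberBound (isTensorTriangulated_mod T) n) :
    (extension T).Incomparable (isTensorTriangulated K) ∧
      (extension T).FiberBound (isTensorTriangulated K) (n + 1) := by
  have hM (P : ObjectProperty (Mod K T)) (hP : IsThickTensorIdeal P) (Y : Mod K T) (hY : P Y)
      (hY' : P ((modExtension ℓ).U ((modExtension r).F Y))) :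
      P ((extension T).F ((extension T).U Y)) := by
    refine h.mem_of_isBalanced hP (M := (extend T).obj Y.X) (π := 𝟙 (T ⊗ Y.X)) ?_ hY hY'
    have e₁ : T ◁ f ≫ μ = T ◁ e.hom ≫ (ρ_ T).hom := by
      rw [he, MonoidalCategory.whiskerLeft_comp, assoc, MonObj.mul_one]
    have e₂ : f ▷ Y.X ≫ act Y = e.hom ▷ Y.X ≫ (λ_ Y.X).hom := by
      rw [he, comp_whiskerRight, assoc, one_act]
    have hL : balL f (Mod.regular T) (restrict f Y) = (T ◁ e.hom ≫ (ρ_ T).hom) ▷ Y.X := by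
      rw [← e₁, ← rightAct_regular]
      rfl
    have hR : balR (Mod.regular T) (restrict f Y) = (T ◁ e.hom ≫ (ρ_ T).hom) ▷ Y.X := by
      change (α_ T S Y.X).hom ≫ T ◁ (f ▷ Y.X ≫ act Y) = _
      rw [e₂]
      monoidal
    have hs : ((ρ_ T).inv ≫ T ◁ e.inv) ▷ Y.X ≫ (T ◁ e.hom ≫ (ρ_ T).hom) ▷ Y.X = 𝟙 (T ⊗ Y.X) := by
      rw [← comp_whiskerRight]
      simp
    refine ⟨⟨⟨𝟙 (T ⊗ Y.X), ((ρ_ T).inv ≫ T ◁ e.inv) ▷ Y.X, by rw [hL, hR], comp_id _, ?_, ?_⟩⟩, ?_⟩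
    · rw [hL]
      exact hs
    · rw [hR]
      exact hs.trans (comp_id _).symm
    · change μ ▷ Y.X ≫ 𝟙 (T ⊗ Y.X) =
        (α_ T T Y.X).hom ≫ T ◁ 𝟙 (T ⊗ Y.X) ≫ (α_ T T Y.X).inv ≫ μ ▷ Y.X
      simp
  have hcomm (R : Spc (Mod K T')) : (extension T).pull (isTensorTriangulated K)
      ((modExtension r).pull (isTensorTriangulated_mod T) R) =
      (extension T).pull (isTensorTriangulated K)
        ((modExtension ℓ).pull (isTensorTriangulated_mod T) R) := by
    refine Spc.ext (funext fun x => propext ?_)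
    obtain ⟨e₁⟩ := baseChange_extend r x
    obtain ⟨e₂⟩ := baseChange_extend ℓ x
    exact ⟨R.isPrime.of_iso (e₁ ≪≫ e₂.symm), R.isPrime.of_iso (e₂ ≪≫ e₁.symm)⟩
  exact ⟨hinc.step _ _ (isTensorTriangulated_mod T') hM hcomm,
    hn.step _ _ (isTensorTriangulated_mod T') hM hcomm hinc⟩

end

end IsSplitting

end Step

/-! ### Permanence of separability. -/

section Separable

variable {K : Type u} [Category.{v} K] [MonoidalCategory K]

instance separableMonObj_unit : SeparableMonObj (𝟙_ K) where
  exists_section := by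
    refine ⟨(λ_ (𝟙_ K)).inv, Iso.inv_hom_id _, ?_, ?_⟩
    · change (λ_ (𝟙_ K)).inv ▷ 𝟙_ K ≫ (α_ _ _ _).hom ≫ 𝟙_ K ◁ (λ_ (𝟙_ K)).hom =
        (λ_ (𝟙_ K)).hom ≫ (λ_ (𝟙_ K)).inv
      monoidal
    · change 𝟙_ K ◁ (λ_ (𝟙_ K)).inv ≫ (α_ _ _ _).inv ≫ (λ_ (𝟙_ K)).hom ▷ 𝟙_ K =
        (λ_ (𝟙_ K)).hom ≫ (λ_ (𝟙_ K)).inv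
      monoidal

/-- Split quotients of separable ring objects are separable. -/
lemma SeparableMonObj.of_splitEpi {A B : K} [MonObj A] [MonObj B] [SeparableMonObj A] (p : A ⟶ B)
    [IsMonHom p] (s : SplitEpi p) : SeparableMonObj B where
  exists_section := by
    obtain ⟨σ, h₁, h₂, h₃⟩ := SeparableMonObj.exists_section (A := A)
    have s₂ : (ρ_ A).inv ≫ A ◁ (η ≫ σ) ≫ (α_ A A A).inv ≫ μ ▷ A = σ := by
      rw [MonoidalCategory.whiskerLeft_comp, assoc, h₃, MonObj.mul_one_assoc, Iso.inv_hom_id_assoc]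
    -- From `σ(a) = a σ(1)`, the image of `σ(a)` in `B ⊗ B` depends only on `p(a)`. Hence `τ`
    -- satisfies `p ≫ τ = σ ≫ (p ⊗ p)`, although the section of `p` is not assumed multiplicative.
    have hσ : σ ≫ (p ⊗ₘ p) =
        p ≫ (ρ_ B).inv ≫ B ◁ (η ≫ σ ≫ (p ⊗ₘ p)) ≫ (α_ B B B).inv ≫ μ ▷ B := by
      conv_lhs => rw [← s₂]
      rw [rightUnitor_inv_naturality_assoc, ← whisker_exchange_assoc, ← assoc η,
        MonoidalCategory.whiskerLeft_comp A (η ≫ σ)]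
      simp only [assoc]
      rw [MonoidalCategory.tensorHom_def, ← comp_whiskerRight_assoc, IsMonHom.mul_hom]
      simp only [MonoidalCategory.tensorHom_def]
      have e : (A ◁ (p ▷ A ≫ B ◁ p)) ≫ p ▷ (B ⊗ B) ≫ (α_ B B B).inv ≫ μ ▷ B =
        (α_ A A A).inv ≫ ((p ▷ A ≫ B ◁ p) ≫ μ) ▷ A ≫ B ◁ p := by
        rw [comp_whiskerRight_assoc, ← whisker_exchange (μ : B ⊗ B ⟶ B) p,
          whisker_exchange_assoc p (p ▷ A ≫ B ◁ p)]
        monoidal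
      rw [← e]
    obtain ⟨τ, hτ⟩ : ∃ τ, τ = s.section_ ≫ σ ≫ (p ⊗ₘ p) := ⟨_, rfl⟩
    have hp : p ≫ τ = σ ≫ (p ⊗ₘ p) := by
      rw [hτ, hσ, s.id_assoc]
    have hpe : Epi p := s.epi
    have hpe₂ : Epi (p ⊗ₘ p) := by
      have : (s.section_ ⊗ₘ s.section_) ≫ (p ⊗ₘ p) = 𝟙 _ := by
        rw [MonoidalCategory.tensorHom_comp_tensorHom, s.id, MonoidalCategory.id_tensorHom_id]
      exact (SplitEpi.mk _ this).epi
    refine ⟨τ, ?_, ?_, ?_⟩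
    · rw [← cancel_epi p, reassoc_of% hp, ← IsMonHom.mul_hom, reassoc_of% h₁, comp_id]
    · have e : (p ⊗ₘ p) ≫ μ ≫ τ = μ ≫ σ ≫ (p ⊗ₘ p) := by
        rw [← IsMonHom.mul_hom_assoc, hp]
      have e' : ((p ⊗ₘ p) ⊗ₘ p) ≫ (α_ B B B).hom ≫ B ◁ μ =
          (α_ A A A).hom ≫ A ◁ μ ≫ (p ⊗ₘ p) := by
        rw [associator_naturality_assoc, ← MonoidalCategory.id_tensorHom,
          ← MonoidalCategory.id_tensorHom, MonoidalCategory.tensorHom_comp_tensorHom,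
          MonoidalCategory.tensorHom_comp_tensorHom, ← IsMonHom.mul_hom, id_comp, comp_id]
      rw [← cancel_epi (p ⊗ₘ p), e, ← reassoc_of% h₂, ← e', ← MonoidalCategory.tensorHom_id,
        ← MonoidalCategory.tensorHom_id, MonoidalCategory.tensorHom_comp_tensorHom_assoc,
        MonoidalCategory.tensorHom_comp_tensorHom_assoc, hp, comp_id, id_comp]
    · have e : (p ⊗ₘ p) ≫ μ ≫ τ = μ ≫ σ ≫ (p ⊗ₘ p) := by
        rw [← IsMonHom.mul_hom_assoc, hp]
      have e' : (p ⊗ₘ (p ⊗ₘ p)) ≫ (α_ B B B).inv ≫ μ ▷ B =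
          (α_ A A A).inv ≫ μ ▷ A ≫ (p ⊗ₘ p) := by
        rw [associator_inv_naturality_assoc, ← MonoidalCategory.tensorHom_id,
          ← MonoidalCategory.tensorHom_id, MonoidalCategory.tensorHom_comp_tensorHom,
          MonoidalCategory.tensorHom_comp_tensorHom, ← IsMonHom.mul_hom, id_comp, comp_id]
      rw [← cancel_epi (p ⊗ₘ p), e, ← reassoc_of% h₃, ← e', ← MonoidalCategory.id_tensorHom,
        ← MonoidalCategory.id_tensorHom, MonoidalCategory.tensorHom_comp_tensorHom_assoc,
        MonoidalCategory.tensorHom_comp_tensorHom_assoc, hp, comp_id, id_comp]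

/-- Tensor products of separable ring objects are separable. -/
instance SeparableMonObj.tensor [SymmetricCategory K] {A B : K} [MonObj A] [MonObj B]
    [SeparableMonObj A] [SeparableMonObj B] : SeparableMonObj (A ⊗ B) where
  exists_section := by
    obtain ⟨σ, h₁, h₂, h₃⟩ := SeparableMonObj.exists_section (A := A)
    obtain ⟨τ, k₁, k₂, k₃⟩ := SeparableMonObj.exists_section (A := B)
    have hμ : (μ : (A ⊗ B) ⊗ (A ⊗ B) ⟶ A ⊗ B) = tensorμ A B A B ≫ (μ ⊗ₘ μ) := rfl
    have hδ : Mono (tensorμ A B A B) := (SplitMono.mk _ (tensorμ_tensorδ A B A B)).mono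
    refine ⟨(σ ⊗ₘ τ) ≫ tensorδ A B A B, ?_, ?_, ?_⟩
    · rw [hμ, assoc, tensorδ_tensorμ_assoc, MonoidalCategory.tensorHom_comp_tensorHom, h₁, k₁,
        MonoidalCategory.id_tensorHom_id]
    · rw [← cancel_mono (tensorμ A B A B), hμ]
      simp only [assoc, tensorδ_tensorμ, comp_id, MonoidalCategory.whiskerLeft_comp,
        tensorμ_natural_right]
      rw [← tensor_associativity_assoc, comp_whiskerRight_assoc, ← comp_whiskerRight_assoc
        (tensorδ A B A B), tensorδ_tensorμ, id_whiskerRight, id_comp, tensorμ_natural_left_assoc]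
      simp only [MonoidalCategory.tensorHom_comp_tensorHom, h₂, k₂]
    · rw [← cancel_mono (tensorμ A B A B), hμ]
      have e : (α_ (A ⊗ B) (A ⊗ B) (A ⊗ B)).inv ≫ tensorμ A B A B ▷ (A ⊗ B) ≫
          tensorμ (A ⊗ A) (B ⊗ B) A B =
          (A ⊗ B) ◁ tensorμ A B A B ≫ tensorμ A B (A ⊗ A) (B ⊗ B) ≫
            ((α_ A A A).inv ⊗ₘ (α_ B B B).inv) := by
        rw [Iso.inv_comp_eq, ← tensor_associativity_assoc]
        simp [MonoidalCategory.tensorHom_comp_tensorHom]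
      simp only [assoc, tensorδ_tensorμ, comp_id, comp_whiskerRight, tensorμ_natural_left]
      rw [reassoc_of% e, MonoidalCategory.whiskerLeft_comp_assoc,
        ← MonoidalCategory.whiskerLeft_comp_assoc _ (tensorδ A B A B), tensorδ_tensorμ,
        MonoidalCategory.whiskerLeft_id, id_comp, tensorμ_natural_right_assoc]
      simp only [MonoidalCategory.tensorHom_comp_tensorHom, h₃, k₃]

end Separable

/-! ### Ring homomorphisms out of `T ⊗ T`. -/

section Homs

variable {K : Type u} [Category.{v} K] [MonoidalCategory K] [SymmetricCategory K]
  {T T' : K} [MonObj T] [MonObj T']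

instance isMonHom_η : IsMonHom (η : 𝟙_ K ⟶ T) where
  one_hom := id_comp _
  mul_hom := by
    change (λ_ (𝟙_ K)).hom ≫ η = (η ⊗ₘ η) ≫ μ
    rw [MonoidalCategory.tensorHom_def', assoc, MonObj.one_mul, leftUnitor_naturality]

/-- A ring homomorphism out of `T ⊗ T` is determined by its restrictions to both factors. -/
lemma tensorHom_comp_mul (p : T ⊗ T ⟶ T') [IsMonHom p] :
    (((ρ_ T).inv ≫ T ◁ η ≫ p) ⊗ₘ ((λ_ T).inv ≫ η ▷ T ≫ p)) ≫ μ = p := by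
  have hμ : (μ : (T ⊗ T) ⊗ (T ⊗ T) ⟶ T ⊗ T) = tensorμ T T T T ≫ (μ ⊗ₘ μ) := rfl
  -- This is `(t ⊗ 1)(1 ⊗ t') = t ⊗ t'`.
  have h : (((ρ_ T).inv ≫ T ◁ η) ⊗ₘ ((λ_ T).inv ≫ η ▷ T)) ≫ μ = 𝟙 (T ⊗ T) := by
    rw [hμ, ← MonoidalCategory.tensorHom_comp_tensorHom, ← MonoidalCategory.id_tensorHom T,
      ← MonoidalCategory.tensorHom_id _ T, assoc, tensorμ_natural_assoc,
      MonoidalCategory.tensorHom_comp_tensorHom, MonoidalCategory.id_tensorHom,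
      MonoidalCategory.tensorHom_id, MonObj.mul_one, MonObj.one_mul]
    simp only [tensorμ]
    have : (β_ (𝟙_ K) (𝟙_ K)).hom = 𝟙 _ := by
      rw [braiding_tensorUnit_right, ← unitors_equal, Iso.hom_inv_id]
    rw [this]
    monoidal
  have e : (((ρ_ T).inv ≫ T ◁ η ≫ p) ⊗ₘ ((λ_ T).inv ≫ η ▷ T ≫ p)) =
      (((ρ_ T).inv ≫ T ◁ η) ⊗ₘ ((λ_ T).inv ≫ η ▷ T)) ≫ (p ⊗ₘ p) := by
    rw [MonoidalCategory.tensorHom_comp_tensorHom, assoc, assoc]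
  rw [e, assoc, ← IsMonHom.mul_hom, reassoc_of% h]

/-- A morphism out of `T ⊗ T` that is balanced over `S` coequalizes the two maps from `S`. -/
lemma comp_eq_of_balanced {S y : K} {f : S ⟶ T} {p : T ⊗ T ⟶ y}
    (h : balancingLeft f ≫ p = balancingRight f ≫ p) :
    f ≫ (ρ_ T).inv ≫ T ◁ η ≫ p = f ≫ (λ_ T).inv ≫ η ▷ T ≫ p := by
  -- The balancing relation is evaluated at `1 ⊗ s ⊗ 1`.
  have e₁ : ((λ_ S).inv ≫ η ▷ S) ▷ 𝟙_ K ≫ (T ⊗ S) ◁ η ≫ balancingLeft f =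
      (ρ_ S).hom ≫ f ≫ (ρ_ T).inv ≫ T ◁ η := by
    rw [balancingLeft, whisker_exchange, ← comp_whiskerRight_assoc, assoc,
      ← whisker_exchange_assoc, MonObj.one_mul]
    monoidal
  have e₂ : ((λ_ S).inv ≫ η ▷ S) ▷ 𝟙_ K ≫ (T ⊗ S) ◁ η ≫ balancingRight f =
      (ρ_ S).hom ≫ f ≫ (λ_ T).inv ≫ η ▷ T := by
    rw [balancingRight, associator_naturality_right_assoc, ← MonoidalCategory.whiskerLeft_comp,
      whisker_exchange_assoc, MonObj.mul_one, comp_whiskerRight_assoc,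
      associator_naturality_left_assoc, ← whisker_exchange]
    monoidal
  have h' := congrArg (fun q => ((λ_ S).inv ≫ η ▷ S) ▷ 𝟙_ K ≫ (T ⊗ S) ◁ η ≫ q) h
  rw [reassoc_of% e₁, reassoc_of% e₂, cancel_epi] at h'
  exact h'

end Homs

/-! ### The splitting tower. -/

section Tower

variable {K : Type u} [Category.{v} K] [Preadditive K] [HasBinaryBiproducts K]
  [MonoidalCategory K] [SymmetricCategory K]

lemma exists_isSplitCoequalizer_balancing [IsIdempotentComplete K] {S T : K} [MonObj S]
    [SeparableMonObj S] [MonObj T] [IsCommMonObj T] (f : S ⟶ T) [IsMonHom f] :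
    ∃ (w : K) (p : T ⊗ T ⟶ w),
      Nonempty (IsSplitCoequalizer (balancingRight f) (balancingLeft f) p) := by
  obtain ⟨W, π, ⟨s⟩, -⟩ := exists_isBalanced f (Mod.regular T) (restrict f (Mod.regular T))
  have hL : balL f (Mod.regular T) (restrict f (Mod.regular T)) = balancingLeft f := by
    rw [balL, rightAct_regular]
    rfl
  rw [hL] at s
  exact ⟨W.X, π, ⟨s⟩⟩

namespace SplittingTower

variable (T : SplittingTower K) (n : ℕ)

/-- The structure maps of the tower. -/
abbrev left : (T.obj n).X ⟶ (T.obj (n + 1)).X := (T.map n).hom.hom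

/-- The restriction of the projection `Tₙ₊₁ ⊗ Tₙ₊₁ ⟶ Tₙ₊₂` to the second factor. -/
abbrev right : (T.obj (n + 1)).X ⟶ (T.obj (n + 2)).X := (λ_ _).inv ≫ η ▷ _ ≫ T.proj n

instance : IsMonHom (T.left n) := (T.map n).hom.isMonHom_hom

instance : IsMonHom (T.right n) := by
  have := T.proj_hom n
  infer_instance

/-- A ring homomorphism out of `T ⊗ T` is the product of its restrictions to the factors; for `proj
n` these are the next structure map and `right n`. -/
lemma splittingMap_eq :
    splittingMap (T.left (n + 1)) (T.right n) = biprod.lift μ (T.proj n) := by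
  have := T.proj_hom n
  rw [splittingMap, left, T.map_succ, tensorHom_comp_mul]

lemma left_comp_left : T.left n ≫ T.left (n + 1) = T.left n ≫ T.right n := by
  have hb : balancingLeft (T.left n) ≫ biprod.lift μ (T.proj n) =
      balancingRight (T.left n) ≫ biprod.lift μ (T.proj n) := T.balanced n
  have h : balancingLeft (T.left n) ≫ T.proj n = balancingRight (T.left n) ≫ T.proj n := by
    have h := congrArg (· ≫ biprod.snd) hb
    simpa only [assoc, biprod.lift_snd] using h
  have hs : T.left (n + 1) = (ρ_ _).inv ≫ _ ◁ η ≫ T.proj n := T.map_succ n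
  rw [hs]
  exact comp_eq_of_balanced h

variable [IsIdempotentComplete K]

/-- The coequalizer in the tower is not given as split, so its behaviour under tensoring is unknown.
Separability of the base provides a split coequalizer of the same pair, and comparing the two
transfers the splitting. -/
lemma isSplitting [SeparableMonObj (T.obj n).X] :
    IsSplitting (T.left n) (T.left (n + 1)) (T.right n) := by
  obtain ⟨w, p, ⟨s⟩⟩ := exists_isSplitCoequalizer_balancing (T.left n)
  obtain ⟨c⟩ := T.universal n
  have hq := T.splittingMap_eq n
  have hqe : Epi (splittingMap (T.left (n + 1)) (T.right n)) :=
    hq ▸ ⟨fun a b hab => Cofork.IsColimit.hom_ext c hab⟩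
  obtain ⟨l, hl⟩ := IsSplitCoequalizer.exists_desc s (splittingMap (T.left (n + 1)) (T.right n))
    (by rw [hq]; exact (T.balanced n).symm)
  obtain ⟨m, hm⟩ : ∃ m, splittingMap (T.left (n + 1)) (T.right n) ≫ m = p := by
    refine ⟨c.desc (Cofork.ofπ p s.condition.symm), ?_⟩
    rw [hq]
    exact c.fac _ WalkingParallelPair.one
  have hml : m ≫ l = 𝟙 _ := by
    rw [← cancel_epi (splittingMap (T.left (n + 1)) (T.right n)), reassoc_of% hm, hl, comp_id]
  refine ⟨T.left_comp_left n, ⟨⟨m ≫ s.rightSection, ?_⟩⟩, ?_⟩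
  · rw [← hl, assoc, s.rightSection_π_assoc, hml]
  · intro y w k hk
    obtain ⟨l', hl'⟩ := IsSplitCoequalizer.exists_desc (s.map (tensorRight y)) k hk.symm
    refine ⟨m ▷ y ≫ l', ?_⟩
    rw [← comp_whiskerRight_assoc, hm]
    exact hl'

/-- `T_{n+2}` is a factor of `T_{n+1} ⊗ T_{n+1}`. Separability of `T_n` is also needed, to split the
projection; hence the recursion on two preceding terms. -/
lemma separable (T : SplittingTower K) (h₀ : SeparableMonObj (T.obj 0).X)
    (h₁ : SeparableMonObj (T.obj 1).X) :
    ∀ n, SeparableMonObj (T.obj n).X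
  | 0 => h₀
  | 1 => h₁
  | n + 2 => by
    have := T.separable h₀ h₁ n
    have := T.separable h₀ h₁ (n + 1)
    have := T.proj_hom n
    obtain ⟨s⟩ := (T.isSplitting n).splitEpi
    refine SeparableMonObj.of_splitEpi (T.proj n) ⟨biprod.inr ≫ s.section_, ?_⟩
    have h := congrArg (fun q => biprod.inr ≫ q ≫ biprod.snd) s.id
    simpa [splittingMap_eq] using h

end SplittingTower

end Tower

/-! ### Induction along the tower and conclusion. -/

section Main

variable {K : Type u} [Category.{v} K] [Preadditive K] [HasZeroObject K]
  [HasShift K ℤ] [∀ n : ℤ, (shiftFunctor K n).Additive] [Pretriangulated K]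
  [MonoidalCategory K] [SymmetricCategory K] [MonoidalPreadditive K] [IsIdempotentComplete K]
  [TensorTriangulated K]

/-- Over the zero ring the unit acts both as the identity and as zero, so all modules vanish and no
ideal is proper. -/
lemma isEmpty_spc {A : K} [MonObj A] [IsCommMonObj A] [SeparableMonObj A] (hA : IsZero A) :
    IsEmpty (Spc (Mod K A)) := by
  refine ⟨fun P => ?_⟩
  obtain ⟨X, hX⟩ := P.isPrime.proper
  refine hX (P.isPrime.toIsThickTensorIdeal.of_isZero (isZero_mod ?_))
  rw [IsZero.iff_id_eq_zero, ← Iso.inv_hom_id (λ_ X.X), ← one_act, hA.eq_of_tgt η 0]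
  simp

/-- Splittings can be transported along isomorphisms of the base ring. -/
lemma IsSplitting.comp_iso {S S' T T' : K} [MonObj S] [MonObj S'] [MonObj T] [MonObj T']
    {f : S ⟶ T} {ℓ r : T ⟶ T'} (h : IsSplitting f ℓ r) (e : S' ≅ S) :
    IsSplitting (e.hom ≫ f) ℓ r where
  comm := by rw [assoc, assoc, h.comm]
  splitEpi := h.splitEpi
  exists_desc {y w} k hk := by
    have hl : balancingLeft (e.hom ≫ f) = (T ◁ e.hom) ▷ T ≫ balancingLeft f := by
      simp [balancingLeft]
    have hr : balancingRight (e.hom ≫ f) = (T ◁ e.hom) ▷ T ≫ balancingRight f := by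
      simp [balancingRight]
    rw [hl, hr, comp_whiskerRight_assoc, comp_whiskerRight_assoc, cancel_epi] at hk
    exact h.exists_desc k hk

namespace SplittingTower

variable (T : SplittingTower K) [hT : ∀ n, SeparableMonObj (T.obj n).X]

/-- Here `k` counts the steps from `T_{n+1}` to the vanishing term, and the induction moves `n`
upwards. The base `B` is left free so that the result applies to `A` itself, which is only
isomorphic to `T_1`. -/
lemma bounds (k : ℕ) : ∀ (n : ℕ) {B : K} [MonObj B] [IsCommMonObj B] [SeparableMonObj B]
    (f : B ⟶ (T.obj (n + 1)).X) [IsMonHom f],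
    IsSplitting f (T.left (n + 1)) (T.right n) → IsZero (T.obj (n + k + 1)).X →
    (modExtension f).Incomparable (isTensorTriangulated_mod B) ∧
      (modExtension f).FiberBound (isTensorTriangulated_mod B) k := by
  induction k with
  | zero =>
    intro n B _ _ _ f _ _ h
    have := isEmpty_spc h
    exact ⟨fun P => isEmptyElim P, fun Q => by simp [Set.eq_empty_of_isEmpty]⟩
  | succ k ih =>
    intro n B _ _ _ f _ hf h
    obtain ⟨h₁, h₂⟩ := ih (n + 1) (T.left (n + 1)) (T.isSplitting (n + 1)) (by
      rwa [show n + 1 + k + 1 = n + (k + 1) + 1 by omega])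
    -- The inductive hypothesis concerns the structure map `left (n + 1)`, whereas `step` uses the
    -- second map of a splitting; hence the symmetry.
    exact hf.symm.step h₁ h₂

end SplittingTower

theorem HasDegree.bounds {A : K} [MonObj A] [IsCommMonObj A] [SeparableMonObj A] {d : ℕ}
    (hd : HasDegree A d) : (extension A).Incomparable (isTensorTriangulated K) ∧
      (extension A).FiberBound (isTensorTriangulated K) d := by
  obtain ⟨T, ⟨e₀⟩, ⟨e₁⟩, -, hT⟩ := hd
  let i₀ : (T.obj 0).X ≅ 𝟙_ K := (CommMon.forget K).mapIso e₀
  let i₁ : (T.obj 1).X ≅ A := (CommMon.forget K).mapIso e₁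
  have hi₀ : IsMonHom i₀.hom := e₀.hom.hom.isMonHom_hom
  have hi₁ : IsMonHom i₁.hom := e₁.hom.hom.isMonHom_hom
  have hsep := T.separable (SeparableMonObj.of_splitEpi i₀.inv ⟨i₀.hom, i₀.hom_inv_id⟩)
    (SeparableMonObj.of_splitEpi i₁.inv ⟨i₁.hom, i₁.hom_inv_id⟩)
  cases d with
  | zero =>
    -- For `d = 0` the vanishing term is `T_1 ≅ A`.
    have := isEmpty_spc (hT.of_iso i₁.symm)
    exact ⟨fun P => isEmptyElim P, fun Q => by simp [Set.eq_empty_of_isEmpty]⟩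
  | succ k =>
    have hf := (T.isSplitting 0).symm.of_iso i₁
    obtain ⟨h₁, h₂⟩ := T.bounds k 1 (i₁.inv ≫ T.left 1) ((T.isSplitting 1).comp_iso i₁.symm)
      (by rwa [show 1 + k + 1 = k + 1 + 1 by omega])
    refine hf.step_extension (e := i₀) ?_ h₁ h₂
    -- A ring homomorphism out of `𝟙` is the unit of its target.
    rw [← Iso.inv_comp_eq]
    have h := IsMonHom.one_hom (i₀.inv ≫ T.left 0 ≫ i₁.hom)
    exact (id_comp _).symm.trans h

end Main

end TTGeometry

theorem theorem3p7 {K : Type u} [Category.{v} K] [Preadditive K] [HasZeroObject K]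
    [HasShift K ℤ] [∀ n : ℤ, (shiftFunctor K n).Additive] [Pretriangulated K] [IsTriangulated K]
    [IsIdempotentComplete K] [MonoidalCategory K] [SymmetricCategory K] [MonoidalPreadditive K]
    [TensorTriangulated K] (A : K) [MonObj A] [IsCommMonObj A] [SeparableMonObj A]
    (d : ℕ) (hd : HasDegree A d) :
    (∀ P P' : Spc (Mod K A), P.carrier ≤ P'.carrier → spcMap A P = spcMap A P' → P = P') ∧
    topologicalKrullDim (Spc (Mod K A)) = topologicalKrullDim (supp A) ∧
    ∀ Q : Spc K, DiscreteTopology (spcMap A ⁻¹' {Q}) ∧ (spcMap A ⁻¹' {Q}).encard ≤ d := by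
  obtain ⟨h₁, h₂⟩ := hd.bounds
  refine ⟨h₁, ?_, fun Q => ⟨?_, h₂ Q⟩⟩
  · rw [(extension A).krullDim_eq (isTensorTriangulated K) (isTensorTriangulated_mod A)
      relTensor_unit h₁]
    -- The unit module is `F_A(𝟙)`, with underlying object `A ⊗ 𝟙 ≅ A`.
    have : supp ((extension A).U ((extend A).obj (𝟙_ K))) = supp A := by
      ext P
      exact not_congr ⟨P.isPrime.of_iso (ρ_ A), P.isPrime.of_iso (ρ_ A).symm⟩
    rw [this]
  · refine discreteTopology_of_incomparable (Set.finite_of_encard_le_coe (h₂ Q)) ?_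
    intro P hP P' hP' hle
    exact h₁ P P' hle (hP.trans hP'.symm)
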